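/- Let $\mathcal F$ be the free nilpotent $\mathbb Z$-Lie ring of class $4$ on generators $X,Y,Z$, let $\mathcal I$ be the ideal of $\mathcal F$ generated by $$R_1=[[[Y,X],X],X]-[[Y,Z],Y],\qquad R_2=[[[Z,X],X],X]-[[Z,Y],Z],$$ and let $\Lambda=\mathcal F/\mathcal I$. Then $\Lambda$ is a free $\mathbb Z$-module of rank $25$. Let $\Gamma=\exp(24\Lambda)$, that is, the set $24\Lambda\subset\mathbb Q\otimes_{\mathbb Z}\Lambda$ with the product given by the Hausdorff series (truncated after degree $4$), $$x*y=x+y+\tfrac12[x,y]-\tfrac1{12}[[x,y],x]+\tfrac1{12}[[x,y],y]-\tfrac1{24}[[[x,y],x],y].$$ Then $\Gamma$ is a torsion-free finitely generated nilpotent group of nilpotency class $4$ and Hirsch length $25$ with the following properties. For $n\ge 1$ let $a_n^\wedge(\Gamma)$ be the number of subgroups $\Delta\le\Gamma$ of index $n$ whose profinite completion is isomorphic to that of $\Gamma$, and for a prime $p$ let $\zeta_{\Gamma,p}^\wedge(s)=\sum_{k\ge0}a_{p^k}^\wedge(\Gamma)\,p^{-ks}$ be the local pro-isomorphic zeta function.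 Then, for every prime $p>3$: (1) for all $s\in\mathbb C$ with $\operatorname{Re}(s)>573/204$ the series converges and $$\zeta_{\Gamma,p}^\wedge(s)=\frac{1+p^{285-102s}+2p^{286-102s}+2p^{572-204s}}{(1-p^{285-102s})(1-p^{573-204s})};$$ (2) $\zeta_{\Gamma,p}^\wedge(s)$ satisfies no functional equation under $p\to p^{-1}$: there are no integers $a,b,c$ and no rational function $W(x,t)$ over $\mathbb Q$ in two variables, whose denominator vanishes identically neither at $x=p$ nor at $x=p^{-1}$, such that $\zeta_{\Gamma,q}^\wedge(s)=W(q,q^{-s})$ for $q=p$ and for all but finitely many primes $q$, and $W(p^{-1},t^{-1})=(-1)^a p^b t^c\,W(p,t)$ as rational functions in $t$ (where $t$ stands for $p^{-s}$). -/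

import Mathlib

open scoped TensorProduct Polynomial

noncomputable section

/-! ### The Lie lattice `Λ` -/

namespace LieLattice

/-- The free Lie ring on three generators `X, Y, Z` (indexed by `0, 1, 2`). -/
abbrev Free : Type := FreeLieAlgebra ℤ (Fin 3)

/-- The generator `X`. -/
def X : Free := FreeLieAlgebra.of ℤ 0

/-- The generator `Y`. -/
def Y : Free := FreeLieAlgebra.of ℤ 1

/-- The generator `Z`. -/
def Z : Free := FreeLieAlgebra.of ℤ 2

/-- `R₁ = YXXX - YZY`, in left-normed notation `ABC = [[A, B], C]`. -/
def R₁ : Free := ⁅⁅⁅Y, X⁆, X⁆, X⁆ - ⁅⁅Y, Z⁆, Y⁆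

/-- `R₂ = ZXXX - ZYZ`, in left-normed notation `ABC = [[A, B], C]`. -/
def R₂ : Free := ⁅⁅⁅Z, X⁆, X⁆, X⁆ - ⁅⁅Z, Y⁆, Z⁆

/-- The ideal of the free Lie ring generated by `R₁`, `R₂` and the fifth term `γ₅` of the lower
central series (Mathlib numbers the series from `0`, so that `γ₅` has index `4`). -/
def relations : LieIdeal ℤ Free :=
  LieSubmodule.lieSpan ℤ Free {R₁, R₂} ⊔ LieModule.lowerCentralSeries ℤ Free Free 4

end LieLattice

/-- The Lie ring `Λ`: the quotient of the free nilpotent Lie ring of class `4` on `X, Y, Z` by the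
ideal generated by `R₁` and `R₂`. -/
abbrev Lam : Type := LieLattice.Free ⧸ LieLattice.relations

/-! ### The group `exp(mΛ)` -/

/-- The Hausdorff series `log (exp x exp y)`, truncated after the terms of total degree `4`. -/
def hausdorff₄ {L : Type*} [LieRing L] [LieAlgebra ℚ L] (x y : L) : L :=
  x + y + (1 / 2 : ℚ) • ⁅x, y⁆ - (1 / 12 : ℚ) • ⁅⁅x, y⁆, x⁆ + (1 / 12 : ℚ) • ⁅⁅x, y⁆, y⁆
    - (1 / 24 : ℚ) • ⁅⁅⁅x, y⁆, x⁆, y⁆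

/-- `Γ` is (isomorphic to) the group `exp(mL)`: its elements are identified with the elements of
the sublattice `mL` of `ℚ ⊗ L` in such a way that the product is the Hausdorff product. -/
def IsExp (m : ℕ) (L : Type*) [LieRing L] (Γ : Type*) [Group Γ] : Prop :=
  ∃ φ : Γ → ℚ ⊗[ℤ] L, Function.Injective φ ∧
    Set.range φ = Set.range (fun v : L => (m : ℚ) ⊗ₜ[ℤ] v) ∧
    ∀ g h : Γ, φ (g * h) = hausdorff₄ (φ g) (φ h)

/-! ### Group-theoretic notions -/

/-- `G` has Hirsch length `h`: there is a series `1 = H₀ ⊴ H₁ ⊴ ⋯ ⊴ Hₙ = G` with cyclic factors,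
exactly `h` of which are infinite. -/
def HasHirschLength (G : Type*) [Group G] (h : ℕ) : Prop :=
  ∃ (n : ℕ) (H : Fin (n + 1) → Subgroup G), H 0 = ⊥ ∧ H (Fin.last n) = ⊤ ∧
    (∀ i : Fin n, H i.castSucc ≤ H i.succ ∧
      ∃ _ : ((H i.castSucc).subgroupOf (H i.succ)).Normal,
        IsCyclic (↥(H i.succ) ⧸ (H i.castSucc).subgroupOf (H i.succ))) ∧
    Nat.card {i : Fin n // Infinite (↥(H i.succ) ⧸ (H i.castSucc).subgroupOf (H i.succ))} = h

/-- The profinite completions of `G` and `H` are isomorphic as topological groups. -/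
def ProIsomorphic (G H : Type) [Group G] [Group H] : Prop :=
  Nonempty (ProfiniteGrp.ProfiniteCompletion.completion (GrpCat.of G) ≃ₜ*
    ProfiniteGrp.ProfiniteCompletion.completion (GrpCat.of H))

/-- The number of subgroups `Δ` of index `n` in `Γ` whose profinite completion is isomorphic to that
of `Γ`. (It is finite if `Γ` is finitely generated and `n ≠ 0`.) -/
def proIsoCount (Γ : Type) [Group Γ] (n : ℕ) : ℕ :=
  Nat.card {Δ : Subgroup Γ // Δ.index = n ∧ ProIsomorphic Δ Γ}

/-! ### Functional equations -/

/-- For `P ∈ ℚ[x][t]`, the polynomial `P(a, t)` in `t`. -/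
def specialize (P : ℚ[X][X]) (a : ℚ) : ℚ[X] := P.map (Polynomial.evalRingHom a)

/-- The local pro-isomorphic zeta function of `Γ` at `p`, the power series `∑ₖ a_{p^k} t ^ k` in
`t = p⁻ˢ`, is the rational function `P(p, t) / Q(p, t)`. -/
def LocalZetaEq (Γ : Type) [Group Γ] (P Q : ℚ[X][X]) (p : ℕ) : Prop :=
  specialize Q p ≠ 0 ∧
    (specialize Q p : PowerSeries ℚ) * PowerSeries.mk (fun k => (proIsoCount Γ (p ^ k) : ℚ)) =
      (specialize P p : PowerSeries ℚ)

/-- The local pro-isomorphic zeta function of `Γ` at `p` satisfies a functional equation under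
`p → p⁻¹`: there is a rational function `W = P / Q` of two variables with
`ζ_{Γ,q}(s) = W(q, q⁻ˢ)` for almost all primes `q` and for `q = p`, such that for some integers
`a, b, c` one has `W(p⁻¹, t⁻¹) = (-1) ^ a p ^ b t ^ c W(p, t)`, where `t` stands for `p⁻ˢ`. -/
def HasFunctionalEquationAt (Γ : Type) [Group Γ] (p : ℕ) : Prop :=
  ∃ P Q : ℚ[X][X],
    {q : ℕ | q.Prime ∧ ¬ LocalZetaEq Γ P Q q}.Finite ∧ LocalZetaEq Γ P Q p ∧
    specialize Q (p : ℚ)⁻¹ ≠ 0 ∧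
    ∃ a b c : ℤ, ∀ t : ℚ, t ≠ 0 →
      (specialize P (p : ℚ)⁻¹).eval t⁻¹ * (specialize Q p).eval t =
        (-1) ^ a * (p : ℚ) ^ b * t ^ c *
          ((specialize P p).eval t * (specialize Q (p : ℚ)⁻¹).eval t⁻¹)

end

/-! ### The Hausdorff group of a Lie ring of class at most four -/

noncomputable section

/-! Conjugating by multiplication by 24 turns the Hausdorff product on `24Λ` into a product `bch` on
`Λ` with integral coefficients, and `Λ` is identified with an explicit lattice `Model ℤ` of rank 25
(`ofModel_bijective`). For p > 3 the number 24 is invertible modulo p^n, and there a homomorphism of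
Hausdorff groups is a homomorphism of Lie rings (`toLieHom`). An isomorphism of profinite
completions gives coherent homomorphisms modulo all p^n. In the limit, a subgroup of p-power index
that is pro-isomorphic to Γ becomes the image of an injective endomorphism of the Lie ring over ℤ_p,
that is, of a triple x, y, z satisfying R₁ and R₂ with independent linear parts.

The relations make such triples rigid (`Relations.isDiagTriple_or`). Up to the exchange of Y and Z,
which is an automorphism and does not change the image, the linear part is diagonal, X ↦ λX, Y ↦ aY,
Z ↦ bZ, with λ³ = ab. The only other conditions are in degree two: y has no ZX-coefficient, z has no
YX-coefficient, and the YX-coefficient of y and the ZX-coefficient of z are linked by one equation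
(`cross`).

Every image has exactly one generating triple in a Hermite type normal form over ℤ, with λ = p^k, a
= p^i, b = p^j, i + j = 3k and reduced remaining coordinates (`exists_isReduced`,
`IsReduced.unique`). Its index is p^(102k), and for fixed i, j there are p^(285k + min(i, j)) such
triples: the two linked coefficients depend on a single parameter modulo p^(min(i, j) + k), which is
where the minimum comes from. Hence a_{p^(102k)} = p^(285k) ∑_{i+j=3k} p^min(i, j), and all other
p-power indices contribute nothing. The sum over i, j satisfies a two-step recurrence in k, which
yields the closed form.

A rational function W that gives the local factors at almost all primes is determined by infinitely
many of them, so it is the explicit one, also at p⁻¹. The denominator has a functional equation. If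
W had one too, the numerator would be proportional to its reversed form at p⁻¹; its extreme
coefficients are 1 and 2p^572, and comparing them gives 4 = 1 (`not_hasFunctionalEquationAt`). -/

/-- A Lie ring of nilpotency class at most four. -/
class IsNilFour (L : Type*) [LieRing L] : Prop where
  lie_five : ∀ a b c d e : L, ⁅⁅⁅⁅a, b⁆, c⁆, d⁆, e⁆ = 0

section LieFour

variable {L : Type*} [LieRing L]

/-- The Jacobi identity, oriented so that as a rewriting rule it turns every iterated bracket into
left-normed words. -/
theorem lie_lie_eq_sub (a b c : L) : ⁅a, ⁅b, c⁆⁆ = ⁅⁅a, b⁆, c⁆ - ⁅⁅a, c⁆, b⁆ := by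
  rw [leibniz_lie a b c, ← lie_skew ⁅a, c⁆ b]
  abel

/-- Expansion of iterated brackets in a Hall basis of left-normed words in `v > u`. -/
theorem lie_vuvu (u v : L) : ⁅⁅⁅v, u⁆, v⁆, u⁆ = ⁅⁅⁅v, u⁆, u⁆, v⁆ := by
  have h := lie_lie_eq_sub ⁅v, u⁆ v u
  rw [lie_self] at h
  exact sub_eq_zero.1 h.symm

theorem lie_wvu (u v w : L) : ⁅⁅w, v⁆, u⁆ = ⁅⁅w, u⁆, v⁆ - ⁅⁅v, u⁆, w⁆ := by
  have h := lie_lie_eq_sub w v u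
  rw [← lie_skew] at h
  rw [sub_eq_add_neg, h]
  abel

theorem lie_wuvu (u v w : L) :
    ⁅⁅⁅w, u⁆, v⁆, u⁆ = ⁅⁅⁅w, u⁆, u⁆, v⁆ - ⁅⁅⁅v, u⁆, w⁆, u⁆ + ⁅⁅⁅v, u⁆, u⁆, w⁆ := by
  have h1 := lie_lie_eq_sub ⁅w, u⁆ v u
  rw [← lie_skew, lie_lie_eq_sub ⁅v, u⁆ w u] at h1
  rw [← sub_eq_zero] at h1 ⊢
  rw [← neg_eq_zero, ← h1]
  abel

/-- The bracket of ⁅w, v⁆ and ⁅c, u⁆ is expanded from both sides. The letter c is arbitrary, so one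
identity serves all words with first letters w, v and last letter u. -/
theorem lie_wvcu (u v w c : L) :
    ⁅⁅⁅w, v⁆, c⁆, u⁆ =
      ⁅⁅⁅w, u⁆, v⁆, c⁆ - ⁅⁅⁅v, u⁆, w⁆, c⁆ - ⁅⁅⁅c, u⁆, w⁆, v⁆ + ⁅⁅⁅c, u⁆, v⁆, w⁆ := by
  have h1 := lie_lie_eq_sub ⁅w, v⁆ c u
  have h2 := lie_lie_eq_sub ⁅c, u⁆ w v
  rw [← lie_skew, h2, lie_wvu u v w, sub_lie] at h1
  rw [← sub_eq_zero] at h1 ⊢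
  rw [← neg_eq_zero, ← h1]
  abel

end LieFour

/-- The group structure that the Hausdorff series puts on `24 L`, transported to `L`. -/
def ExpGroup (L : Type*) := L

namespace ExpGroup

variable {L : Type*} [LieRing L]

/-- The Hausdorff product on `24 L`, transported to `L`. -/
def bch (u v : L) : L :=
  -- Conjugation by multiplication by 24 multiplies the terms of degree d by 24^(d-1): the
  -- coefficients are 24/2, 24²/12, 24²/12 and 24³/24.
  u + v + (12 : ℤ) • ⁅u, v⁆ - (48 : ℤ) • ⁅⁅u, v⁆, u⁆ + (48 : ℤ) • ⁅⁅u, v⁆, v⁆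
    - (576 : ℤ) • ⁅⁅⁅u, v⁆, u⁆, v⁆

/-- Both sides are expanded into left-normed words, which are rewritten in a Hall basis for the
order u < v < w; then the coefficients agree. -/
theorem bch_assoc [IsNilFour L] (u v w : L) : bch (bch u v) w = bch u (bch v w) := by
  simp only [bch, lie_add, add_lie, sub_lie, lie_sub, smul_lie, lie_smul, lie_lie_eq_sub,
    IsNilFour.lie_five, zero_lie, smul_zero, sub_zero, add_zero, sub_self]
  rw [← lie_skew u v, ← lie_skew u w, ← lie_skew v w]
  simp only [neg_lie, lie_wvu u v w, lie_wvcu u v w, lie_wuvu u v w, sub_lie]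
  module

/-- The element of `ExpGroup L` given by an element of `L`. -/
def of : L ≃ ExpGroup L := Equiv.refl _

theorem zero_bch (u : L) : bch 0 u = u := by simp [bch]

theorem bch_zero (u : L) : bch u 0 = u := by simp [bch]

theorem bch_of_lie_eq_zero {u v : L} (h : ⁅u, v⁆ = 0) : bch u v = u + v := by
  simp [bch, h]

theorem neg_bch_self (u : L) : bch (-u) u = 0 := by
  rw [bch_of_lie_eq_zero (by simp), neg_add_cancel]

instance [IsNilFour L] : Group (ExpGroup L) where
  mul u v := of (bch (of.symm u) (of.symm v))
  mul_assoc _ _ _ := bch_assoc (L := L) _ _ _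
  one := of 0
  one_mul _ := zero_bch (L := L) _
  mul_one _ := bch_zero (L := L) _
  inv u := of (-of.symm u)
  inv_mul_cancel _ := neg_bch_self (L := L) _

variable [IsNilFour L]

theorem of_mul (u v : L) : of u * of v = of (bch u v) := rfl

theorem of_zero : of (0 : L) = 1 := rfl

theorem of_inv (u : L) : (of u)⁻¹ = of (-u) := rfl

theorem of_pow (u : L) (n : ℕ) : of u ^ n = of ((n : ℤ) • u) := by
  induction n with
  | zero => simp [of_zero]
  | succ n ih =>
    rw [pow_succ, ih, of_mul, bch_of_lie_eq_zero (by simp)]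
    congr 1
    push_cast
    module

theorem of_zpow (u : L) (n : ℤ) : of u ^ n = of (n • u) := by
  cases n with
  | ofNat n => simpa using of_pow u n
  | negSucc n =>
    rw [zpow_negSucc, of_pow, of_inv]
    congr 1
    rw [Int.negSucc_eq]
    push_cast
    module

/-- The leading term is 24 times the Lie bracket, so that brackets can be recovered from commutators
wherever 24 is invertible. -/
theorem of_commutator (u v : L) :
    of u * of v * (of u)⁻¹ * (of v)⁻¹ = of ((24 : ℤ) • ⁅u, v⁆ - (288 : ℤ) • ⁅⁅u, v⁆, u⁆ - (288 : ℤ) • ⁅⁅u, v⁆, v⁆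
      + (2304 : ℤ) • ⁅⁅⁅u, v⁆, u⁆, u⁆ + (3456 : ℤ) • ⁅⁅⁅u, v⁆, u⁆, v⁆
      + (2304 : ℤ) • ⁅⁅⁅u, v⁆, v⁆, v⁆) := by
  rw [of_inv, of_inv, of_mul, of_mul, of_mul]
  congr 1
  simp only [bch, lie_add, add_lie, sub_lie, lie_sub, smul_lie, lie_smul, lie_lie_eq_sub, neg_lie,
    lie_neg, IsNilFour.lie_five, zero_lie, lie_zero, smul_zero, sub_zero, add_zero, sub_self, lie_self,
    neg_zero]
  rw [← lie_skew v u]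
  simp only [neg_lie, lie_vuvu v u]
  module

/-- A Lie ring homomorphism induces a homomorphism of groups. -/
def map {M : Type*} [LieRing M] [IsNilFour M] (f : L →ₗ⁅ℤ⁆ M) : ExpGroup L →* ExpGroup M where
  toFun u := of (f (of.symm u))
  map_one' := congrArg of (map_zero f)
  map_mul' u v := by
    obtain ⟨u, rfl⟩ := of.surjective u
    obtain ⟨v, rfl⟩ := of.surjective v
    simp only [of_mul, Equiv.symm_apply_apply]
    congr 1
    simp only [bch, map_add, map_sub, map_zsmul, LieHom.map_lie]

theorem map_of {M : Type*} [LieRing M] [IsNilFour M] (f : L →ₗ⁅ℤ⁆ M) (u : L) :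
    map f (of u) = of (f u) := rfl

end ExpGroup
end

/-! ### The coordinate model of `Λ` and its universal property -/

noncomputable section

/-- A coordinate model over `R` of the Lie ring `Λ`. The basis consists of the left-normed words
`X, Y, Z, YX, ZX, YZ, YXX, ZXX, YXY, ZXZ, YXZ, ZXY, YXXX, ZXXX, YXXY, ZXXZ, YXXZ, ZXXY, YXZX, YXYY,
ZXZZ, YXYZ, YXZY, ZXZY, ZXYZ`. -/
def Model (R : Type*) := Fin 25 → R

namespace Model

variable {R : Type*} [CommRing R]

instance : AddCommGroup (Model R) := inferInstanceAs (AddCommGroup (Fin 25 → R))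

instance : Module R (Model R) := inferInstanceAs (Module R (Fin 25 → R))

instance {S : Type*} : CoeFun (Model S) fun _ => Fin 25 → S := ⟨id⟩

@[simp] theorem add_apply (u v : Model R) (i : Fin 25) : (u + v) i = u i + v i := rfl

@[simp] theorem sub_apply (u v : Model R) (i : Fin 25) : (u - v) i = u i - v i := rfl

@[simp] theorem neg_apply (u : Model R) (i : Fin 25) : (-u) i = -u i := rfl

@[simp] theorem zero_apply (i : Fin 25) : (0 : Model R) i = 0 := rfl

@[simp] theorem smul_apply (r : R) (u : Model R) (i : Fin 25) : (r • u) i = r * u i := rfl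

@[simp] theorem zsmul_apply (n : ℤ) (u : Model R) (i : Fin 25) : (n • u) i = n * u i := by
  rw [← zsmul_eq_mul]
  rfl

@[ext] theorem ext {S : Type*} {u v : Model S} (h : ∀ i, u i = v i) : u = v := funext h

/-- The bracket, in coordinates. -/
instance : Bracket (Model R) (Model R) where
  bracket u v := ![
    0,
    0,
    0,
    (u 1 * v 0 - u 0 * v 1),
    (u 2 * v 0 - u 0 * v 2),
    (u 1 * v 2 - u 2 * v 1),
    (u 3 * v 0 - u 0 * v 3),
    (u 4 * v 0 - u 0 * v 4),
    (u 3 * v 1 - u 1 * v 3),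
    (u 4 * v 2 - u 2 * v 4),
    (u 3 * v 2 - u 2 * v 3) + (u 5 * v 0 - u 0 * v 5),
    (u 4 * v 1 - u 1 * v 4) - (u 5 * v 0 - u 0 * v 5),
    -- The relations enter here and in the next entry: YZY = YXXX and YZZ = -ZXXX, so the bracket of
    -- YZ with Y or Z jumps to degree four.
    (u 6 * v 0 - u 0 * v 6) + (u 5 * v 1 - u 1 * v 5),
    (u 7 * v 0 - u 0 * v 7) - (u 5 * v 2 - u 2 * v 5),
    (u 6 * v 1 - u 1 * v 6) + (u 8 * v 0 - u 0 * v 8),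
    (u 7 * v 2 - u 2 * v 7) + (u 9 * v 0 - u 0 * v 9),
    (u 6 * v 2 - u 2 * v 6) + (u 11 * v 0 - u 0 * v 11) - (u 3 * v 4 - u 4 * v 3),
    (u 7 * v 1 - u 1 * v 7) + (u 11 * v 0 - u 0 * v 11),
    (u 10 * v 0 - u 0 * v 10) - (u 11 * v 0 - u 0 * v 11) + (u 3 * v 4 - u 4 * v 3),
    (u 8 * v 1 - u 1 * v 8),
    (u 9 * v 2 - u 2 * v 9),
    (u 8 * v 2 - u 2 * v 8) - (u 11 * v 1 - u 1 * v 11) + (u 3 * v 5 - u 5 * v 3),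
    (u 10 * v 1 - u 1 * v 10) + 2 * (u 11 * v 1 - u 1 * v 11) - (u 3 * v 5 - u 5 * v 3),
    (u 9 * v 1 - u 1 * v 9) - (u 10 * v 2 - u 2 * v 10) - (u 4 * v 5 - u 5 * v 4),
    2 * (u 10 * v 2 - u 2 * v 10) + (u 11 * v 2 - u 2 * v 11) + (u 4 * v 5 - u 5 * v 4)]

@[simp] theorem lie_apply_0 (u v : Model R) :
    ⁅u, v⁆ 0 = 0 := rfl

@[simp] theorem lie_apply_1 (u v : Model R) :
    ⁅u, v⁆ 1 = 0 := rfl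

@[simp] theorem lie_apply_2 (u v : Model R) :
    ⁅u, v⁆ 2 = 0 := rfl

@[simp] theorem lie_apply_3 (u v : Model R) :
    ⁅u, v⁆ 3 = (u 1 * v 0 - u 0 * v 1) := rfl

@[simp] theorem lie_apply_4 (u v : Model R) :
    ⁅u, v⁆ 4 = (u 2 * v 0 - u 0 * v 2) := rfl

@[simp] theorem lie_apply_5 (u v : Model R) :
    ⁅u, v⁆ 5 = (u 1 * v 2 - u 2 * v 1) := rfl

@[simp] theorem lie_apply_6 (u v : Model R) :
    ⁅u, v⁆ 6 = (u 3 * v 0 - u 0 * v 3) := rfl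

@[simp] theorem lie_apply_7 (u v : Model R) :
    ⁅u, v⁆ 7 = (u 4 * v 0 - u 0 * v 4) := rfl

@[simp] theorem lie_apply_8 (u v : Model R) :
    ⁅u, v⁆ 8 = (u 3 * v 1 - u 1 * v 3) := rfl

@[simp] theorem lie_apply_9 (u v : Model R) :
    ⁅u, v⁆ 9 = (u 4 * v 2 - u 2 * v 4) := rfl

@[simp] theorem lie_apply_10 (u v : Model R) :
    ⁅u, v⁆ 10 = (u 3 * v 2 - u 2 * v 3) + (u 5 * v 0 - u 0 * v 5) := rfl

@[simp] theorem lie_apply_11 (u v : Model R) :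
    ⁅u, v⁆ 11 = (u 4 * v 1 - u 1 * v 4) - (u 5 * v 0 - u 0 * v 5) := rfl

@[simp] theorem lie_apply_12 (u v : Model R) :
    ⁅u, v⁆ 12 = (u 6 * v 0 - u 0 * v 6) + (u 5 * v 1 - u 1 * v 5) := rfl

@[simp] theorem lie_apply_13 (u v : Model R) :
    ⁅u, v⁆ 13 = (u 7 * v 0 - u 0 * v 7) - (u 5 * v 2 - u 2 * v 5) := rfl

@[simp] theorem lie_apply_14 (u v : Model R) :
    ⁅u, v⁆ 14 = (u 6 * v 1 - u 1 * v 6) + (u 8 * v 0 - u 0 * v 8) := rfl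

@[simp] theorem lie_apply_15 (u v : Model R) :
    ⁅u, v⁆ 15 = (u 7 * v 2 - u 2 * v 7) + (u 9 * v 0 - u 0 * v 9) := rfl

@[simp] theorem lie_apply_16 (u v : Model R) :
    ⁅u, v⁆ 16 = (u 6 * v 2 - u 2 * v 6) + (u 11 * v 0 - u 0 * v 11) - (u 3 * v 4 - u 4 * v 3) := rfl

@[simp] theorem lie_apply_17 (u v : Model R) :
    ⁅u, v⁆ 17 = (u 7 * v 1 - u 1 * v 7) + (u 11 * v 0 - u 0 * v 11) := rfl

@[simp] theorem lie_apply_18 (u v : Model R) :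
    ⁅u, v⁆ 18 = (u 10 * v 0 - u 0 * v 10) - (u 11 * v 0 - u 0 * v 11) + (u 3 * v 4 - u 4 * v 3) := rfl

@[simp] theorem lie_apply_19 (u v : Model R) :
    ⁅u, v⁆ 19 = (u 8 * v 1 - u 1 * v 8) := rfl

@[simp] theorem lie_apply_20 (u v : Model R) :
    ⁅u, v⁆ 20 = (u 9 * v 2 - u 2 * v 9) := rfl

@[simp] theorem lie_apply_21 (u v : Model R) :
    ⁅u, v⁆ 21 = (u 8 * v 2 - u 2 * v 8) - (u 11 * v 1 - u 1 * v 11) + (u 3 * v 5 - u 5 * v 3) := rfl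

@[simp] theorem lie_apply_22 (u v : Model R) :
    ⁅u, v⁆ 22 = (u 10 * v 1 - u 1 * v 10) + 2 * (u 11 * v 1 - u 1 * v 11) - (u 3 * v 5 - u 5 * v 3) := rfl

@[simp] theorem lie_apply_23 (u v : Model R) :
    ⁅u, v⁆ 23 = (u 9 * v 1 - u 1 * v 9) - (u 10 * v 2 - u 2 * v 10) - (u 4 * v 5 - u 5 * v 4) := rfl

@[simp] theorem lie_apply_24 (u v : Model R) :
    ⁅u, v⁆ 24 = 2 * (u 10 * v 2 - u 2 * v 10) + (u 11 * v 2 - u 2 * v 11) + (u 4 * v 5 - u 5 * v 4) := rfl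

theorem ext_coord {S : Type*} {u v : Model S} (h0 : u 0 = v 0) (h1 : u 1 = v 1) (h2 : u 2 = v 2) (h3 : u 3 = v 3) (h4 : u 4 = v 4)
    (h5 : u 5 = v 5) (h6 : u 6 = v 6) (h7 : u 7 = v 7) (h8 : u 8 = v 8) (h9 : u 9 = v 9)
    (h10 : u 10 = v 10) (h11 : u 11 = v 11) (h12 : u 12 = v 12) (h13 : u 13 = v 13) (h14 : u 14 = v 14)
    (h15 : u 15 = v 15) (h16 : u 16 = v 16) (h17 : u 17 = v 17) (h18 : u 18 = v 18) (h19 : u 19 = v 19)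
    (h20 : u 20 = v 20) (h21 : u 21 = v 21) (h22 : u 22 = v 22) (h23 : u 23 = v 23) (h24 : u 24 = v 24) : u = v := by
  ext i
  fin_cases i <;> assumption

instance : LieRing (Model R) where
  add_lie u v w := by
    apply ext_coord <;> simp <;> ring
  lie_add u v w := by
    apply ext_coord <;> simp <;> ring
  lie_self u := by
    apply ext_coord <;> simp <;> ring
  leibniz_lie u v w := by
    apply ext_coord <;> simp <;> ring

instance : LieAlgebra R (Model R) where
  lie_smul r u v := by
    apply ext_coord <;> simp <;> ring

instance : IsNilFour (Model R) where
  lie_five a b c d e := by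
    apply ext_coord <;> simp

end Model
end

noncomputable section

namespace Model

section Lift

variable {R L : Type*} [CommRing R] [LieRing L] [LieAlgebra R L] [IsNilFour L]

/-- The linear map that sends the basis of `Model R` to the words in `x, y, z`. -/
def liftLinear (x y z : L) : Model R →ₗ[R] L where
  toFun v := v 0 • x + v 1 • y + v 2 • z + v 3 • ⁅y, x⁆ + v 4 • ⁅z, x⁆ + v 5 • ⁅y, z⁆
    + v 6 • ⁅⁅y, x⁆, x⁆ + v 7 • ⁅⁅z, x⁆, x⁆ + v 8 • ⁅⁅y, x⁆, y⁆ + v 9 • ⁅⁅z, x⁆, z⁆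
    + v 10 • ⁅⁅y, x⁆, z⁆ + v 11 • ⁅⁅z, x⁆, y⁆
    + v 12 • ⁅⁅⁅y, x⁆, x⁆, x⁆ + v 13 • ⁅⁅⁅z, x⁆, x⁆, x⁆ + v 14 • ⁅⁅⁅y, x⁆, x⁆, y⁆
    + v 15 • ⁅⁅⁅z, x⁆, x⁆, z⁆ + v 16 • ⁅⁅⁅y, x⁆, x⁆, z⁆ + v 17 • ⁅⁅⁅z, x⁆, x⁆, y⁆
    + v 18 • ⁅⁅⁅y, x⁆, z⁆, x⁆ + v 19 • ⁅⁅⁅y, x⁆, y⁆, y⁆ + v 20 • ⁅⁅⁅z, x⁆, z⁆, z⁆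
    + v 21 • ⁅⁅⁅y, x⁆, y⁆, z⁆ + v 22 • ⁅⁅⁅y, x⁆, z⁆, y⁆ + v 23 • ⁅⁅⁅z, x⁆, z⁆, y⁆
    + v 24 • ⁅⁅⁅z, x⁆, y⁆, z⁆
  map_add' u v := by
    simp only [add_apply]
    module
  map_smul' r u := by
    simp only [smul_apply, RingHom.id_apply]
    module

theorem liftLinear_lie (x y z : L) (h₁ : ⁅⁅⁅y, x⁆, x⁆, x⁆ = ⁅⁅y, z⁆, y⁆)
    (h₂ : ⁅⁅⁅z, x⁆, x⁆, x⁆ = ⁅⁅z, y⁆, z⁆) (u v : Model R) :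
    liftLinear x y z ⁅u, v⁆ = ⁅liftLinear x y z u, liftLinear (R := R) x y z v⁆ := by
  -- By R₁ and R₂ the elements ZYY and YZZ have degree four, so their brackets with x vanish.
  -- Written in left-normed words this eliminates ZXYY and YXZZ, which are absent from the basis.
  have e₁ : ⁅⁅z, y⁆, y⁆ = -⁅⁅⁅y, x⁆, x⁆, x⁆ := by
    rw [h₁, ← lie_skew z y, neg_lie]
  have e₂ : ⁅⁅⁅z, x⁆, y⁆, y⁆ = (2 : R) • ⁅⁅⁅y, x⁆, z⁆, y⁆ - ⁅⁅⁅y, x⁆, y⁆, z⁆ := by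
    have h := lie_wvcu x y z y
    rw [e₁, neg_lie, IsNilFour.lie_five, neg_zero] at h
    linear_combination (norm := module) (-1 : R) • h
  have e₃ : ⁅⁅⁅y, x⁆, z⁆, z⁆ = (2 : R) • ⁅⁅⁅z, x⁆, y⁆, z⁆ - ⁅⁅⁅z, x⁆, z⁆, y⁆ := by
    have h := lie_wvcu x y z z
    rw [← h₂, IsNilFour.lie_five] at h
    linear_combination (norm := module) (1 : R) • h
  simp only [liftLinear, LinearMap.coe_mk, AddHom.coe_mk, lie_add, add_lie, sub_lie, smul_lie, lie_smul,
    lie_lie_eq_sub, IsNilFour.lie_five, zero_lie, smul_zero, add_zero, sub_self,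
    lie_self]
  rw [← lie_skew x y, ← lie_skew x z, ← lie_skew y z]
  simp only [neg_lie, e₁, ← h₂, lie_wvu x y z, lie_vuvu x y, lie_vuvu x z, lie_wuvu x y z, sub_lie,
    e₂, e₃, smul_neg, neg_neg,
    lie_apply_0, lie_apply_1, lie_apply_2, lie_apply_3, lie_apply_4, lie_apply_5,
    lie_apply_6, lie_apply_7, lie_apply_8, lie_apply_9, lie_apply_10, lie_apply_11,
    lie_apply_12, lie_apply_13, lie_apply_14, lie_apply_15, lie_apply_16, lie_apply_17,
    lie_apply_18, lie_apply_19, lie_apply_20, lie_apply_21, lie_apply_22, lie_apply_23,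
    lie_apply_24]
  simp only [IsNilFour.lie_five]
  module

end Lift

end Model
end

noncomputable section

namespace Model

section

variable {R L : Type*} [CommRing R] [LieRing L] [LieAlgebra R L]

/-- The homomorphism of Lie algebras from `Model R` given by three elements that satisfy the
relations `R₁` and `R₂`. -/
def lift [IsNilFour L] (x y z : L) (h₁ : ⁅⁅⁅y, x⁆, x⁆, x⁆ = ⁅⁅y, z⁆, y⁆)
    (h₂ : ⁅⁅⁅z, x⁆, x⁆, x⁆ = ⁅⁅z, y⁆, z⁆) : Model R →ₗ⁅R⁆ L :=
  { liftLinear x y z with map_lie' := liftLinear_lie x y z h₁ h₂ _ _ }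

/-- The basis vectors of `Model R`. -/
def basisVec (i : Fin 25) : Model R := fun j => if j = i then 1 else 0

theorem basisVec_apply (i j : Fin 25) : (basisVec i : Model R) j = if j = i then 1 else 0 := rfl

theorem liftLinear_basisVec (v : Model R) :
    liftLinear (basisVec 0) (basisVec 1) (basisVec 2) v = v := by
  apply ext_coord <;> simp [liftLinear, basisVec_apply, -lie_skew, -lie_lie]

theorem liftLinear_zero (x y z : L) : liftLinear x y z (basisVec 0 : Model R) = x := by
  simp [liftLinear, basisVec_apply, -lie_skew, -lie_lie]

theorem liftLinear_one (x y z : L) : liftLinear x y z (basisVec 1 : Model R) = y := by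
  simp [liftLinear, basisVec_apply, -lie_skew, -lie_lie]

theorem liftLinear_two (x y z : L) : liftLinear x y z (basisVec 2 : Model R) = z := by
  simp [liftLinear, basisVec_apply, -lie_skew, -lie_lie]

theorem map_liftLinear {M : Type*} [LieRing M] [LieAlgebra R M] (f : L →ₗ⁅R⁆ M) (x y z : L)
    (v : Model R) : f (liftLinear x y z v) = liftLinear (f x) (f y) (f z) v := by
  simp only [liftLinear, LinearMap.coe_mk, AddHom.coe_mk, map_add, map_smul, LieHom.map_lie]

theorem basisVec_relation_one :
    ⁅⁅⁅(basisVec 1 : Model R), (basisVec 0 : Model R)⁆, (basisVec 0 : Model R)⁆,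
      (basisVec 0 : Model R)⁆ =
    ⁅⁅(basisVec 1 : Model R), (basisVec 2 : Model R)⁆, (basisVec 1 : Model R)⁆ := by
  apply ext_coord <;> simp [basisVec_apply, -lie_skew, -lie_lie]

theorem basisVec_relation_two :
    ⁅⁅⁅(basisVec 2 : Model R), (basisVec 0 : Model R)⁆, (basisVec 0 : Model R)⁆,
      (basisVec 0 : Model R)⁆ =
    ⁅⁅(basisVec 2 : Model R), (basisVec 1 : Model R)⁆, (basisVec 2 : Model R)⁆ := by
  apply ext_coord <;> simp [basisVec_apply, -lie_skew, -lie_lie]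

/-- The degrees of the basis vectors of the model. -/
def degree (i : Fin 25) : ℕ := if i < 3 then 1 else if i < 6 then 2 else if i < 12 then 3 else 4

theorem degree_pos (i : Fin 25) : 1 ≤ degree i := by
  unfold degree
  split_ifs <;> omega

theorem degree_le (i : Fin 25) : degree i ≤ 4 := by
  unfold degree
  split_ifs <;> omega

theorem lt_of_degree_lt {i j : Fin 25} (h : degree i < degree j) : i < j := by
  revert i j
  decide

theorem degree_mono {i j : Fin 25} (h : i ≤ j) : degree i ≤ degree j := by
  by_contra! hlt
  exact absurd (lt_of_degree_lt hlt) (not_lt.2 h)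

theorem lie_apply_eq_zero_of_degree (u v : Model R) (i : Fin 25)
    (h : ∀ j, degree j < degree i → v j = 0) : ⁅u, v⁆ i = 0 := by
  fin_cases i
  all_goals
    simp only [Fin.forall_fin_succ, degree] at h
    simp at h ⊢ <;> simp [h]

/-- The bracket raises the coordinate filtration. -/
theorem lie_apply_eq_zero (u v : Model R) (i : Fin 25) (h : ∀ j < i, v j = 0) : ⁅u, v⁆ i = 0 :=
  lie_apply_eq_zero_of_degree u v i fun _ hj => h _ (lt_of_degree_lt hj)

end

end Model

/-! ### The isomorphism between the model and `Λ` -/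

namespace LieLattice

instance : IsNilFour Lam where
  lie_five a b c d e := by
    obtain ⟨a, rfl⟩ := LieSubmodule.Quotient.surjective_mk' _ a
    obtain ⟨b, rfl⟩ := LieSubmodule.Quotient.surjective_mk' _ b
    obtain ⟨c, rfl⟩ := LieSubmodule.Quotient.surjective_mk' _ c
    obtain ⟨d, rfl⟩ := LieSubmodule.Quotient.surjective_mk' _ d
    obtain ⟨e, rfl⟩ := LieSubmodule.Quotient.surjective_mk' _ e
    change LieSubmodule.Quotient.mk' relations ⁅⁅⁅⁅a, b⁆, c⁆, d⁆, e⁆ = 0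
    rw [LieSubmodule.Quotient.mk_eq_zero]
    refine le_sup_right (a := LieSubmodule.lieSpan ℤ Free {R₁, R₂}) ?_
    have key : ∀ (n : ℕ) (u v : Free), u ∈ LieModule.lowerCentralSeries ℤ Free Free n →
        ⁅u, v⁆ ∈ LieModule.lowerCentralSeries ℤ Free Free (n + 1) := by
      intro n u v hu
      rw [← lie_skew, LieModule.lowerCentralSeries_succ]
      exact neg_mem (LieSubmodule.lie_mem_lie (LieSubmodule.mem_top v) hu)
    exact key 3 _ _ (key 2 _ _ (key 1 _ _ (key 0 _ _ (by simp))))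

/-- The projection onto `Λ`. -/
abbrev proj : Free → Lam := LieSubmodule.Quotient.mk' relations

theorem proj_lie (a b : Free) : proj ⁅a, b⁆ = ⁅proj a, proj b⁆ := rfl

/-- The homomorphism from the coordinate model to `Λ`. -/
def ofModel : Model ℤ →ₗ⁅ℤ⁆ Lam :=
  Model.lift (proj X) (proj Y) (proj Z)
    (by
      rw [← sub_eq_zero]
      simp only [← proj_lie, ← map_sub]
      rw [LieSubmodule.Quotient.mk_eq_zero]
      exact le_sup_left (a := LieSubmodule.lieSpan ℤ Free {R₁, R₂})
        (LieSubmodule.subset_lieSpan (by simp [R₁, -lie_skew, -lie_lie])))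
    (by
      rw [← sub_eq_zero]
      simp only [← proj_lie, ← map_sub]
      rw [LieSubmodule.Quotient.mk_eq_zero]
      exact le_sup_left (a := LieSubmodule.lieSpan ℤ Free {R₁, R₂})
        (LieSubmodule.subset_lieSpan (by simp [R₂, -lie_skew, -lie_lie])))

/-- The homomorphism from the free Lie ring to the coordinate model. -/
def toModel : Free →ₗ⁅ℤ⁆ Model ℤ :=
  FreeLieAlgebra.lift ℤ ![Model.basisVec 0, Model.basisVec 1, Model.basisVec 2]

theorem toModel_X : toModel X = Model.basisVec 0 :=
  FreeLieAlgebra.lift_of_apply _ (0 : Fin 3)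

theorem toModel_Y : toModel Y = Model.basisVec 1 :=
  FreeLieAlgebra.lift_of_apply _ (1 : Fin 3)

theorem toModel_Z : toModel Z = Model.basisVec 2 :=
  FreeLieAlgebra.lift_of_apply _ (2 : Fin 3)

theorem ofModel_toModel (a : Free) : ofModel (toModel a) = proj a := by
  let q : Free →ₗ⁅ℤ⁆ Lam :=
    { (LieSubmodule.Quotient.mk' relations : Free →ₗ[ℤ] Lam) with
      map_lie' := rfl }
  have h : ofModel.comp toModel = q := by
    apply FreeLieAlgebra.hom_ext
    intro i
    fin_cases i
    · exact (congrArg ofModel toModel_X).trans (Model.liftLinear_zero _ _ _)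
    · exact (congrArg ofModel toModel_Y).trans (Model.liftLinear_one _ _ _)
    · exact (congrArg ofModel toModel_Z).trans (Model.liftLinear_two _ _ _)
  exact congrArg (fun f : Free →ₗ⁅ℤ⁆ Lam => f a) h

theorem toModel_eq_zero {a : Free} (ha : a ∈ relations) : toModel a = 0 := by
  have h : relations ≤ toModel.ker := by
    refine sup_le ?_ ?_
    · rw [LieSubmodule.lieSpan_le]
      rintro _ (rfl | rfl)
      · change toModel R₁ = 0
        rw [R₁, map_sub, sub_eq_zero]
        simp only [LieHom.map_lie, toModel_X, toModel_Y, toModel_Z]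
        exact Model.basisVec_relation_one
      · change toModel R₂ = 0
        rw [R₂, map_sub, sub_eq_zero]
        simp only [LieHom.map_lie, toModel_X, toModel_Y, toModel_Z]
        exact Model.basisVec_relation_two
    -- The term of index n in the lower central series lies in degrees at least n + 1; the model has
    -- no degree above 4, so index 4 is sent to zero.
    · have key : ∀ (n : ℕ) (b : Free), b ∈ LieModule.lowerCentralSeries ℤ Free Free n →
          ∀ j, Model.degree j < n + 1 → toModel b j = 0 := by
        intro n
        induction n with
        | zero => exact fun b _ j hj => absurd (Model.degree_pos j) (by omega)
        | succ n ih =>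
          let N : LieIdeal ℤ Free :=
            { carrier := {b | ∀ j, Model.degree j < n + 1 + 1 → toModel b j = 0}
              add_mem' := fun {b c} hb hc j hj => by
                rw [map_add, Model.add_apply, hb j hj, hc j hj, add_zero]
              zero_mem' := fun j _ => by rw [map_zero, Model.zero_apply]
              smul_mem' := fun r b hb j hj => by
                rw [map_zsmul, Model.zsmul_apply, hb j hj, mul_zero]
              lie_mem := fun {b c} hc j hj => by
                rw [LieHom.map_lie]
                exact Model.lie_apply_eq_zero_of_degree _ _ _ fun i hi => hc i (by omega) }
          have hN : LieModule.lowerCentralSeries ℤ Free Free (n + 1) ≤ N := by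
            rw [LieModule.lowerCentralSeries_succ, LieSubmodule.lie_le_iff]
            intro b _ c hc j hj
            rw [LieHom.map_lie]
            exact Model.lie_apply_eq_zero_of_degree _ _ _ fun i hi => ih c hc i (by omega)
          exact fun b hb => hN hb
      intro a ha
      exact Model.ext fun j => key 4 a ha j (by have := Model.degree_le j; omega)
  exact h ha

theorem ofModel_bijective : Function.Bijective ofModel := by
  constructor
  · rw [injective_iff_map_eq_zero]
    intro v hv
    obtain ⟨a, rfl⟩ : ∃ a, toModel a = v := ⟨Model.liftLinear X Y Z v, by
      rw [Model.map_liftLinear, toModel_X, toModel_Y, toModel_Z]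
      exact Model.liftLinear_basisVec v⟩
    rw [ofModel_toModel, LieSubmodule.Quotient.mk_eq_zero] at hv
    exact toModel_eq_zero hv
  · intro w
    obtain ⟨a, rfl⟩ := LieSubmodule.Quotient.surjective_mk' _ w
    exact ⟨toModel a, ofModel_toModel a⟩

end LieLattice
end

/-! ### Torsion, finite generation, Hirsch length and nilpotency class -/

noncomputable section

namespace Model

variable {R : Type*} [CommRing R]

/-- If the coordinates of v before i vanish, every bracket involving v vanishes up to and including
the coordinate i, so there the product is the sum. This makes the coordinates homomorphisms on the
successive tails. -/
theorem bch_apply (u v : Model R) (i : Fin 25) (h : ∀ j < i, v j = 0) :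
    ExpGroup.bch u v i = u i + v i := by
  have h₀ : ∀ j ≤ i, ⁅u, v⁆ j = 0 := fun j hj =>
    lie_apply_eq_zero _ _ _ fun k hk => h k (hk.trans_le hj)
  have h₁ : ∀ w : Model R, ⁅⁅u, v⁆, w⁆ i = 0 := fun w => by
    rw [← lie_skew, neg_apply, lie_apply_eq_zero _ _ _ fun j hj => h₀ j hj.le, neg_zero]
  have h₂ : ⁅⁅⁅u, v⁆, u⁆, v⁆ i = 0 := lie_apply_eq_zero _ _ _ h
  simp only [ExpGroup.bch, add_apply, sub_apply, zsmul_apply, h₀ i le_rfl, h₁, h₂]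
  ring

/-- The subgroup of the elements whose coordinates before the `l`-th one vanish. -/
def tail (R : Type*) [CommRing R] (l : ℕ) : Subgroup (ExpGroup (Model R)) where
  carrier := {g | ∀ j : Fin 25, (j : ℕ) < l → (ExpGroup.of.symm g : Model R) j = 0}
  one_mem' _ _ := rfl
  mul_mem' {a b} ha hb j hj := by
    change ExpGroup.bch (ExpGroup.of.symm a : Model R) (ExpGroup.of.symm b) j = 0
    rw [bch_apply _ _ _ fun k hk => hb k (lt_trans hk hj), ha j hj, hb j hj, add_zero]
  inv_mem' {a} ha j hj := by
    change -(ExpGroup.of.symm a : Model R) j = 0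
    rw [ha j hj, neg_zero]

theorem tail_zero : tail R 0 = ⊤ := by
  rw [eq_top_iff]
  intro g _ j hj
  exact absurd hj (by omega)

theorem tail_top : tail R 25 = ⊥ := by
  rw [eq_bot_iff]
  intro g hg
  exact ext fun j => hg j j.2

theorem tail_antitone {k l : ℕ} (h : k ≤ l) : tail R l ≤ tail R k :=
  fun _ hg j hj => hg j (hj.trans_le h)

/-- The coordinate that maps the `l`-th tail onto `R`. -/
def tailCoord (l : Fin 25) : tail R l →* Multiplicative R where
  toFun g := Multiplicative.ofAdd ((ExpGroup.of.symm g.1 : Model R) l)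
  map_one' := rfl
  map_mul' a b := by
    rw [← ofAdd_add]
    congr 1
    exact bch_apply _ _ _ fun j hj => b.2 j hj

theorem tailCoord_surjective (l : Fin 25) : Function.Surjective (tailCoord (R := R) l) := fun r =>
  ⟨⟨ExpGroup.of (r.toAdd • basisVec l), fun j hj => by
    change r.toAdd * basisVec l j = 0
    rw [basisVec_apply, if_neg (by rintro rfl; omega), mul_zero]⟩, by
    change Multiplicative.ofAdd (r.toAdd * basisVec l l) = r
    rw [basisVec_apply, if_pos rfl, mul_one, ofAdd_toAdd]⟩

theorem ker_tailCoord (l : Fin 25) :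
    (tailCoord (R := R) l).ker = (tail R (l + 1)).subgroupOf (tail R l) := by
  ext g
  rw [MonoidHom.mem_ker, Subgroup.mem_subgroupOf]
  change (ExpGroup.of.symm g.1 : Model R) l = 0 ↔ _
  constructor
  · intro h j hj
    rcases Nat.lt_succ_iff_lt_or_eq.1 hj with hj | hj
    · exact g.2 j hj
    · rwa [Fin.ext hj]
  · exact fun h => h l (by omega)

theorem isOfFinOrder_eq_one (g : ExpGroup (Model ℤ)) (hg : IsOfFinOrder g) : g = 1 := by
  obtain ⟨n, hn, h⟩ := isOfFinOrder_iff_pow_eq_one.1 hg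
  obtain ⟨v, rfl⟩ := ExpGroup.of.surjective g
  rw [ExpGroup.of_pow] at h
  refine congrArg ExpGroup.of (ext fun i => ?_)
  have hi : ((n : ℤ) • v) i = 0 := congrArg (fun w : Model ℤ => w i) (ExpGroup.of.injective h)
  rw [zsmul_apply] at hi
  exact (mul_eq_zero.1 hi).resolve_left (by simpa using hn.ne')

theorem tail_fg (l : ℕ) (hl : l ≤ 25) : (tail ℤ l).FG := by
  induction hl using Nat.decreasingInduction with
  | self =>
    rw [tail_top]
    exact ⟨∅, by simp⟩
  | of_succ k hk ih =>
    obtain ⟨S, hS⟩ := ih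
    classical
    let b : ExpGroup (Model ℤ) := ExpGroup.of (basisVec ⟨k, hk⟩)
    have hb : b ∈ tail ℤ k := fun j hj => by
      change basisVec ⟨k, hk⟩ j = 0
      rw [basisVec_apply, if_neg (by rintro rfl; simp at hj)]
    refine ⟨insert b S, le_antisymm ?_ ?_⟩
    · rw [Subgroup.closure_le]
      intro g hg
      rcases Finset.mem_insert.1 (Finset.mem_coe.1 hg) with rfl | hg
      · exact hb
      · exact tail_antitone (Nat.le_succ k) (hS ▸ Subgroup.subset_closure hg)
    · intro g hg
      let r : ℤ := (ExpGroup.of.symm g : Model ℤ) ⟨k, hk⟩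
      have hbC : b ∈ Subgroup.closure (insert b S : Finset _) :=
        Subgroup.subset_closure (by simp)
      have hbr : b ^ r ∈ tail ℤ k := zpow_mem hb r
      have hmem : g * (b ^ r)⁻¹ ∈ tail ℤ (k + 1) := by
        have h1 : (⟨g, hg⟩ * (⟨b ^ r, hbr⟩ : tail ℤ k)⁻¹) ∈ (tailCoord (⟨k, hk⟩ : Fin 25)).ker := by
          rw [MonoidHom.mem_ker, map_mul, map_inv, mul_inv_eq_one]
          change Multiplicative.ofAdd r = Multiplicative.ofAdd
            ((ExpGroup.of.symm (b ^ r) : Model ℤ) ⟨k, hk⟩)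
          rw [ExpGroup.of_zpow, Equiv.symm_apply_apply, zsmul_apply, basisVec_apply, if_pos rfl]
          simp
        rw [ker_tailCoord] at h1
        exact h1
      rw [← hS] at hmem
      have h2 := Subgroup.closure_mono (Finset.coe_subset.2 (Finset.subset_insert b S)) hmem
      simpa using mul_mem h2 (zpow_mem hbC r)

theorem expGroup_fg : Group.FG (ExpGroup (Model ℤ)) :=
  Group.fg_def.2 (tail_zero (R := ℤ) ▸ tail_fg 0 (by omega))

theorem hasHirschLength : HasHirschLength (ExpGroup (Model ℤ)) 25 := by
  have key : ∀ i : Fin 25, tail ℤ (25 - i.castSucc.val) ≤ tail ℤ (25 - i.succ.val) ∧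
      ∃ _ : ((tail ℤ (25 - i.castSucc.val)).subgroupOf (tail ℤ (25 - i.succ.val))).Normal,
        Nonempty (tail ℤ (25 - i.succ.val) ⧸ (tail ℤ (25 - i.castSucc.val)).subgroupOf
          (tail ℤ (25 - i.succ.val)) ≃* Multiplicative ℤ) := by
    intro i
    -- The tails decrease, so the ascending series runs through them backwards: its i-th factor is
    -- the one with coordinate 24 - i.
    obtain ⟨l, h₁, h₂⟩ : ∃ l : Fin 25, 25 - i.castSucc.val = l + 1 ∧ 25 - i.succ.val = l :=
      ⟨⟨24 - i, by omega⟩, by simp; omega, by simp; try omega⟩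
    rw [h₁, h₂, ← ker_tailCoord]
    refine ⟨?_, inferInstance,
      ⟨QuotientGroup.quotientKerEquivOfSurjective _ (tailCoord_surjective l)⟩⟩
    exact tail_antitone (Nat.le_succ _)
  refine ⟨25, fun i => tail ℤ (25 - i), ?_, ?_, fun i => ?_, ?_⟩
  · simpa using tail_top
  · simpa using tail_zero
  · obtain ⟨hle, hn, ⟨f⟩⟩ := key i
    exact ⟨hle, hn, isCyclic_of_surjective f.symm f.symm.surjective⟩
  · have hinf : ∀ i : Fin 25, Infinite (↥(tail ℤ (25 - i.succ.val)) ⧸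
        (tail ℤ (25 - i.castSucc.val)).subgroupOf (tail ℤ (25 - i.succ.val))) := by
      intro i
      obtain ⟨hle, hn, ⟨f⟩⟩ := key i
      exact Infinite.of_injective f.symm f.symm.injective
    rw [Nat.card_congr (Equiv.subtypeUnivEquiv hinf)]
    simp

/-- The subgroup of the elements whose coordinates of degree at most `d` vanish. -/
def degreeTail (R : Type*) [CommRing R] (d : ℕ) : Subgroup (ExpGroup (Model R)) where
  carrier := {g | ∀ j, degree j ≤ d → (ExpGroup.of.symm g : Model R) j = 0}
  one_mem' _ _ := rfl
  mul_mem' {a b} ha hb j hj := by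
    change ExpGroup.bch (ExpGroup.of.symm a : Model R) (ExpGroup.of.symm b) j = 0
    rw [bch_apply _ _ _ fun k hk => hb k ((degree_mono hk.le).trans hj), ha j hj, hb j hj, add_zero]
  inv_mem' {a} ha j hj := by
    change -(ExpGroup.of.symm a : Model R) j = 0
    rw [ha j hj, neg_zero]

/-- The group commutator, transported to the Lie ring. -/
def groupComm (u v : Model R) : Model R :=
  ExpGroup.of.symm (ExpGroup.of u * ExpGroup.of v * (ExpGroup.of u)⁻¹ * (ExpGroup.of v)⁻¹)

theorem groupComm_eq (u v : Model R) : groupComm u v =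
    (24 : ℤ) • ⁅u, v⁆ - (288 : ℤ) • ⁅⁅u, v⁆, u⁆ - (288 : ℤ) • ⁅⁅u, v⁆, v⁆
      + (2304 : ℤ) • ⁅⁅⁅u, v⁆, u⁆, u⁆ + (3456 : ℤ) • ⁅⁅⁅u, v⁆, u⁆, v⁆
      + (2304 : ℤ) • ⁅⁅⁅u, v⁆, v⁆, v⁆ :=
  ExpGroup.of_commutator u v

theorem groupComm_apply_eq_zero {u v : Model R} {d : ℕ} (h : ∀ j, degree j ≤ d → u j = 0)
    (i : Fin 25) (hi : degree i ≤ d + 1) : groupComm u v i = 0 := by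
  have key : ∀ w : Model R, (∀ j, degree j ≤ d → w j = 0) → ∀ u' : Model R, ∀ j,
      degree j ≤ d + 1 → ⁅w, u'⁆ j = 0 := fun w hw u' j hj => by
    rw [← lie_skew, neg_apply, lie_apply_eq_zero_of_degree _ _ _ fun k hk => hw k (by omega),
      neg_zero]
  have key' : ∀ w : Model R, (∀ j, degree j ≤ d + 1 → w j = 0) → ∀ u' : Model R, ∀ j,
      degree j ≤ d + 1 → ⁅w, u'⁆ j = 0 := fun w hw u' => key w (fun j hj => hw j (by omega)) u'
  have k₁ := key u h v
  simp only [groupComm_eq, add_apply, sub_apply, zsmul_apply, k₁ i hi, key' _ k₁ _ i hi,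
    key' _ (key' _ k₁ _) _ i hi]
  ring

theorem lowerCentralSeries_le_degreeTail (n : ℕ) :
    (⊤ : Subgroup (ExpGroup (Model R))).lowerCentralSeries n ≤ degreeTail R n := by
  induction n with
  | zero => exact fun g _ j hj => absurd (degree_pos j) (by omega)
  | succ n ih =>
    rw [Subgroup.lowerCentralSeries_succ, Subgroup.commutator_le]
    intro g hg k _ j hj
    exact groupComm_apply_eq_zero (ih hg) j hj

/-- In the iterated commutator of Y with X, X, X each step multiplies the leading coefficient by 24.
The coordinate of YXXX (number 12) is therefore 24³, not zero. -/
theorem lowerCentralSeries_three_ne_bot :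
    (⊤ : Subgroup (ExpGroup (Model ℤ))).lowerCentralSeries 3 ≠ ⊥ := by
  intro h
  let c : Model ℤ → Model ℤ := fun u => groupComm u (basisVec 0)
  have hmem : ∀ n u, ExpGroup.of u ∈ (⊤ : Subgroup (ExpGroup (Model ℤ))).lowerCentralSeries n →
      ExpGroup.of (c u) ∈ (⊤ : Subgroup (ExpGroup (Model ℤ))).lowerCentralSeries (n + 1) := by
    intro n u hu
    rw [Subgroup.lowerCentralSeries_succ]
    exact Subgroup.commutator_mem_commutator hu (Subgroup.mem_top (ExpGroup.of (basisVec 0)))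
  have h3 := hmem 2 _ (hmem 1 _ (hmem 0 (basisVec 1) trivial))
  rw [h, Subgroup.mem_bot] at h3
  have h12 : c (c (c (basisVec 1))) 12 = 0 := by
    have h1 : ∀ w : Model ℤ, ExpGroup.of w = 1 → w = 0 := fun w hw => hw
    rw [h1 _ h3, zero_apply]
  have c3 : c (basisVec 1) 3 = 24 := by
    have u0 : (basisVec 1 : Model ℤ) 0 = 0 := rfl
    have u1 : (basisVec 1 : Model ℤ) 1 = 1 := rfl
    generalize (basisVec 1 : Model ℤ) = u at u0 u1
    simp [c, groupComm_eq, basisVec_apply, -lie_skew, -lie_lie, u0, u1]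
  have cz : ∀ d u, (∀ j, degree j ≤ d → u j = 0) → ∀ j, degree j ≤ d + 1 → c u j = 0 :=
    fun d u hu j hj => groupComm_apply_eq_zero hu j hj
  have z0 : ∀ j, degree j ≤ 0 → (basisVec 1 : Model ℤ) j = 0 :=
    fun j hj => absurd (degree_pos j) (by omega)
  have z1 := cz 0 _ z0
  have z2 := cz 1 _ z1
  have c6 : c (c (basisVec 1)) 6 = 576 := by
    generalize c (basisVec 1) = u at c3 z1
    have u0 := z1 0 (by decide)
    have u1 := z1 1 (by decide)
    simp [c, groupComm_eq, basisVec_apply, -lie_skew, -lie_lie, u0, u1, c3]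
  generalize c (c (basisVec 1)) = u at h12 c6 z2
  have u0 := z2 0 (by decide)
  have u1 := z2 1 (by decide)
  have u2 := z2 2 (by decide)
  have u3 := z2 3 (by decide)
  have u5 := z2 5 (by decide)
  simp [c, groupComm_eq, basisVec_apply, -lie_skew, -lie_lie, u0, u1, u2, u3, u5, c6] at h12

theorem lowerCentralSeries_four :
    (⊤ : Subgroup (ExpGroup (Model R))).lowerCentralSeries 4 = ⊥ := by
  rw [eq_bot_iff]
  intro g hg
  exact ext fun j => lowerCentralSeries_le_degreeTail 4 hg j (degree_le j)

instance : Group.IsNilpotent (ExpGroup (Model R)) :=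
  Subgroup.nilpotent_iff_lowerCentralSeries.2 ⟨4, lowerCentralSeries_four⟩

theorem nilpotencyClass_eq_four : Group.nilpotencyClass (ExpGroup (Model ℤ)) = 4 := by
  apply le_antisymm
  · exact Subgroup.lowerCentralSeries_eq_bot_iff_nilpotencyClass_le.1 lowerCentralSeries_four
  · by_contra! h
    exact lowerCentralSeries_three_ne_bot
      (Subgroup.lowerCentralSeries_eq_bot_iff_nilpotencyClass_le.2 (by omega))

end Model
end

/-! ### Change of coefficients, and the model as `exp(24Λ)` -/

noncomputable section

namespace Model

/-- Change of coefficients, as a function. -/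
def coeffFun {R S : Type*} (f : R → S) (v : Model R) : Model S := fun i => f (v i)

theorem coeffFun_apply {R S : Type*} (f : R → S) (v : Model R) (i : Fin 25) :
    coeffFun f v i = f (v i) := rfl

/-- Change of coefficients. -/
def mapCoeff {R S : Type*} [CommRing R] [CommRing S] (f : R →+* S) : Model R →ₗ⁅ℤ⁆ Model S where
  toFun v := coeffFun f v
  map_add' u v := ext fun i => map_add f (u i) (v i)
  map_smul' n u := ext fun i => by
    simp [coeffFun_apply]
  map_lie' {u v} := by
    apply ext_coord <;> simp [coeffFun_apply, map_ofNat f 2]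

@[simp] theorem mapCoeff_apply {R S : Type*} [CommRing R] [CommRing S] (f : R →+* S) (v : Model R)
    (i : Fin 25) : mapCoeff f v i = f (v i) := rfl

end Model

namespace LieLattice

/-- The additive isomorphism between the coordinate model and `Λ`. -/
def modelEquiv : Model ℤ ≃+ Lam := AddEquiv.ofBijective ofModel ofModel_bijective

theorem modelEquiv_lie (u v : Model ℤ) : modelEquiv ⁅u, v⁆ = ⁅modelEquiv u, modelEquiv v⁆ :=
  LieHom.map_lie ofModel u v

theorem module_free_lam : Module.Free ℤ Lam ∧ Module.finrank ℤ Lam = 25 := by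
  have e : (Fin 25 → ℤ) ≃ₗ[ℤ] Lam :=
    AddEquiv.toIntLinearEquiv (show (Fin 25 → ℤ) ≃+ Lam from modelEquiv)
  refine ⟨Module.Free.of_equiv e, ?_⟩
  rw [← e.finrank_eq]
  simp

theorem isExp_model : IsExp 24 Lam (ExpGroup (Model ℤ)) := by
  -- Reads off rational coordinates; it serves to show that v ↦ 24 ⊗ v is injective.
  let ψ : ℚ ⊗[ℤ] Lam →ₗ[ℤ] Model ℚ := TensorProduct.lift
    { toFun := fun q =>
        { toFun := fun w => q • Model.mapCoeff (Int.castRingHom ℚ) (modelEquiv.symm w)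
          map_add' := fun a b => by rw [map_add, map_add, smul_add]
          map_smul' := fun n a => by
            rw [map_zsmul, map_zsmul, smul_comm]
            rfl }
      map_add' := fun a b => LinearMap.ext fun w => add_smul _ _ _
      map_smul' := fun n a => LinearMap.ext fun w => by
        change (n • a) • Model.mapCoeff (Int.castRingHom ℚ) (modelEquiv.symm w) =
          n • (a • Model.mapCoeff (Int.castRingHom ℚ) (modelEquiv.symm w))
        rw [smul_assoc] }
  have hψ : ∀ (q : ℚ) (v : Model ℤ), ψ (q ⊗ₜ modelEquiv v) =
      q • Model.mapCoeff (Int.castRingHom ℚ) v := fun q v => by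
    change q • Model.mapCoeff (Int.castRingHom ℚ) (modelEquiv.symm (modelEquiv v)) = _
    rw [AddEquiv.symm_apply_apply]
  refine ⟨fun g => (24 : ℚ) ⊗ₜ[ℤ] modelEquiv (ExpGroup.of.symm g), ?_, ?_, ?_⟩
  · intro a b hab
    have h := congrArg ψ hab
    simp only [hψ] at h
    refine congrArg ExpGroup.of (Model.ext (u := ExpGroup.of.symm a) (v := ExpGroup.of.symm b)
      fun i => ?_)
    have hi := congrArg (fun w : Model ℚ => w i) h
    simpa using hi
  · ext t
    constructor
    · rintro ⟨g, rfl⟩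
      exact ⟨modelEquiv (ExpGroup.of.symm g), by norm_num⟩
    · rintro ⟨w, rfl⟩
      exact ⟨ExpGroup.of (modelEquiv.symm w), by simp⟩
  · intro g h
    obtain ⟨u, rfl⟩ := ExpGroup.of.surjective g
    obtain ⟨v, rfl⟩ := ExpGroup.of.surjective h
    have hb : ∀ a b : Lam, ⁅(24 : ℚ) ⊗ₜ[ℤ] a, (24 : ℚ) ⊗ₜ[ℤ] b⁆ =
        (24 : ℚ) • ((24 : ℚ) ⊗ₜ[ℤ] ⁅a, b⁆) := fun a b => by
      rw [LieAlgebra.ExtendScalars.bracket_tmul, TensorProduct.smul_tmul', smul_eq_mul]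
    have hc : ∀ (c : ℚ) (a b : Lam), ⁅c • ((24 : ℚ) ⊗ₜ[ℤ] a), (24 : ℚ) ⊗ₜ[ℤ] b⁆ =
        (c * 24) • ((24 : ℚ) ⊗ₜ[ℤ] ⁅a, b⁆) := fun c a b => by
      rw [TensorProduct.smul_tmul', LieAlgebra.ExtendScalars.bracket_tmul,
        TensorProduct.smul_tmul', smul_eq_mul, smul_eq_mul, mul_assoc]
    have hz : ∀ (n : ℤ) (a : Lam), (24 : ℚ) ⊗ₜ[ℤ] (n • a) = (n : ℚ) • ((24 : ℚ) ⊗ₜ[ℤ] a) :=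
      fun n a => by
        rw [TensorProduct.tmul_smul, Int.cast_smul_eq_zsmul]
    rw [ExpGroup.of_mul]
    simp only [Equiv.symm_apply_apply]
    simp only [ExpGroup.bch, hausdorff₄, map_add, map_sub, map_zsmul, modelEquiv_lie,
      TensorProduct.tmul_add, TensorProduct.tmul_sub, hb, hz, hc]
    module

end LieLattice
end

/-! ### Subgroups are Lie subrings when 24 is invertible -/

noncomputable section

namespace ExpGroup

section Lazard

variable {L : Type*} [LieRing L] [IsNilFour L]

/-- The group commutator, transported to the Lie ring. -/
def commutator (u v : L) : L :=
  (24 : ℤ) • ⁅u, v⁆ - (288 : ℤ) • ⁅⁅u, v⁆, u⁆ - (288 : ℤ) • ⁅⁅u, v⁆, v⁆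
      + (2304 : ℤ) • ⁅⁅⁅u, v⁆, u⁆, u⁆ + (3456 : ℤ) • ⁅⁅⁅u, v⁆, u⁆, v⁆
      + (2304 : ℤ) • ⁅⁅⁅u, v⁆, v⁆, v⁆

variable (H : Subgroup (ExpGroup L))

/-- The fourfold brackets of elements of a subgroup, and their sums. -/
def fourfold : AddSubgroup L := AddSubgroup.closure
  {x | ∃ u v w z, of u ∈ H ∧ of v ∈ H ∧ of w ∈ H ∧ of z ∈ H ∧ x = ⁅⁅⁅u, v⁆, w⁆, z⁆}

/-- The threefold and fourfold brackets of elements of a subgroup, and their sums. -/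
def threefold : AddSubgroup L := AddSubgroup.closure
  ({x | ∃ u v w, of u ∈ H ∧ of v ∈ H ∧ of w ∈ H ∧ x = ⁅⁅u, v⁆, w⁆} ∪ fourfold H)

variable {H}

theorem fourfold_mem {u v w z : L} (hu : of u ∈ H) (hv : of v ∈ H) (hw : of w ∈ H)
    (hz : of z ∈ H) : ⁅⁅⁅u, v⁆, w⁆, z⁆ ∈ fourfold H :=
  AddSubgroup.subset_closure ⟨u, v, w, z, hu, hv, hw, hz, rfl⟩

theorem fourfold_le_threefold : fourfold H ≤ threefold H := fun _ hx =>
  AddSubgroup.subset_closure (Or.inr hx)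

theorem threefold_mem {u v w : L} (hu : of u ∈ H) (hv : of v ∈ H) (hw : of w ∈ H) :
    ⁅⁅u, v⁆, w⁆ ∈ threefold H :=
  AddSubgroup.subset_closure (Or.inl ⟨u, v, w, hu, hv, hw, rfl⟩)

theorem of_zsmul_mem {u : L} (hu : of u ∈ H) (n : ℤ) : of (n • u) ∈ H := by
  rw [← of_zpow]
  exact zpow_mem hu n

theorem of_add_mem {u v : L} (hu : of u ∈ H) (hv : of v ∈ H) (h : ⁅u, v⁆ = 0) :
    of (u + v) ∈ H := by
  rw [← bch_of_lie_eq_zero h, ← of_mul]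
  exact mul_mem hu hv

theorem of_sub_mem {u v : L} (hu : of u ∈ H) (hv : of v ∈ H) (h : ⁅u, v⁆ = 0) :
    of (u - v) ∈ H := by
  rw [sub_eq_add_neg]
  refine of_add_mem hu ?_ (by rw [lie_neg, h, neg_zero])
  rw [← of_inv]
  exact inv_mem hv

theorem of_commutator_mem {u v : L} (hu : of u ∈ H) (hv : of v ∈ H) :
    of (commutator u v) ∈ H := by
  rw [commutator, ← of_commutator]
  exact mul_mem (mul_mem (mul_mem hu hv) (inv_mem hu)) (inv_mem hv)

theorem lie_eq_zero_of_mem_fourfold {x : L} (hx : x ∈ fourfold H) (a : L) : ⁅x, a⁆ = 0 := by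
  induction hx using AddSubgroup.closure_induction with
  | mem x hx =>
    obtain ⟨u, v, w, z, -, -, -, -, rfl⟩ := hx
    exact IsNilFour.lie_five _ _ _ _ _
  | zero => exact zero_lie a
  | add x y _ _ hx hy => rw [add_lie, hx, hy, add_zero]
  | neg x _ hx => rw [neg_lie, hx, neg_zero]

theorem lie_fourfold_eq_zero {x : L} (hx : x ∈ fourfold H) (a : L) : ⁅a, x⁆ = 0 := by
  rw [← lie_skew, lie_eq_zero_of_mem_fourfold hx, neg_zero]

theorem lie_threefold_eq_zero {x : L} (hx : x ∈ threefold H) (a b : L) : ⁅⁅a, b⁆, x⁆ = 0 := by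
  induction hx using AddSubgroup.closure_induction with
  | mem x hx =>
    rcases hx with ⟨u, v, w, -, -, -, rfl⟩ | hx
    · simp only [lie_lie_eq_sub, sub_lie, IsNilFour.lie_five, sub_self]
    · exact lie_fourfold_eq_zero hx _
  | zero => exact lie_zero _
  | add x y _ _ hx hy => rw [lie_add, hx, hy, add_zero]
  | neg x _ hx => rw [lie_neg, hx, neg_zero]

theorem lie_lie_threefold_eq_zero {x : L} (hx : x ∈ threefold H) (a b : L) :
    ⁅⁅a, x⁆, b⁆ = 0 := by
  induction hx using AddSubgroup.closure_induction with
  | mem x hx =>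
    rcases hx with ⟨u, v, w, -, -, -, rfl⟩ | hx
    · simp only [lie_lie_eq_sub, sub_lie, IsNilFour.lie_five, sub_self]
    · rw [lie_fourfold_eq_zero hx, zero_lie]
  | zero => rw [lie_zero, zero_lie]
  | add x y _ _ hx hy => rw [lie_add, add_lie, hx, hy, add_zero]
  | neg x _ hx => rw [lie_neg, neg_lie, hx, neg_zero]

theorem threefold_lie_threefold {x y : L} (hx : x ∈ threefold H) (hy : y ∈ threefold H) :
    ⁅x, y⁆ = 0 := by
  induction hx using AddSubgroup.closure_induction with
  | mem x hx =>
    rcases hx with ⟨u, v, w, -, -, -, rfl⟩ | hx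
    · exact lie_threefold_eq_zero hy _ _
    · exact lie_eq_zero_of_mem_fourfold hx _
  | zero => exact zero_lie _
  | add x y _ _ hx hy => rw [add_lie, hx, hy, add_zero]
  | neg x _ hx => rw [neg_lie, hx, neg_zero]

theorem lie_threefold_mem {x a : L} (hx : x ∈ threefold H) (ha : of a ∈ H) :
    ⁅a, x⁆ ∈ fourfold H := by
  induction hx using AddSubgroup.closure_induction with
  | mem x hx =>
    rcases hx with ⟨u, v, w, hu, hv, hw, rfl⟩ | hx
    · rw [← lie_skew]
      exact neg_mem (fourfold_mem hu hv hw ha)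
    · rw [lie_fourfold_eq_zero hx]
      exact zero_mem _
  | zero => rw [lie_zero]; exact zero_mem _
  | add x y _ _ hx hy => rw [lie_add]; exact add_mem hx hy
  | neg x _ hx => rw [lie_neg]; exact neg_mem hx

variable {c : ℤ} (hc : ∀ v : L, (c * 24) • v = v)

include hc

theorem of_mem_of_twentyfour {u : L} (h : of ((24 : ℤ) • u) ∈ H) : of u ∈ H := by
  have := of_zsmul_mem h c
  rwa [smul_smul, hc] at this

theorem of_mem_of_mem_fourfold {x : L} (hx : x ∈ fourfold H) : of x ∈ H := by
  have key : x ∈ fourfold H ∧ of x ∈ H := by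
    induction hx using AddSubgroup.closure_induction with
    | mem x hx =>
      refine ⟨AddSubgroup.subset_closure hx, ?_⟩
      obtain ⟨u, v, w, z, hu, hv, hw, hz, rfl⟩ := hx
      -- In class four the iterated commutator of four elements is exactly 24³ times their fourfold
      -- bracket.
      have h := of_commutator_mem (of_commutator_mem (of_commutator_mem hu hv) hw) hz
      apply of_mem_of_twentyfour hc
      apply of_mem_of_twentyfour hc
      apply of_mem_of_twentyfour hc
      convert h using 2
      simp only [commutator, lie_add, add_lie, sub_lie, lie_sub, smul_lie, lie_smul, lie_lie_eq_sub,
        IsNilFour.lie_five, zero_lie, smul_zero, sub_zero, add_zero, sub_self]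
    | zero => exact ⟨zero_mem _, one_mem H⟩
    | add x y _ _ hx hy => 
      exact ⟨add_mem hx.1 hy.1, of_add_mem hx.2 hy.2 (lie_eq_zero_of_mem_fourfold hx.1 _)⟩
    | neg x _ hx => exact ⟨neg_mem hx.1, inv_mem hx.2⟩
  exact key.2

theorem of_mem_of_mem_threefold {x : L} (hx : x ∈ threefold H) : of x ∈ H := by
  have key : x ∈ threefold H ∧ of x ∈ H := by
    induction hx using AddSubgroup.closure_induction with
    | mem x hx =>
      refine ⟨AddSubgroup.subset_closure hx, ?_⟩
      rcases hx with ⟨u, v, w, hu, hv, hw, rfl⟩ | hx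
      · have h := of_commutator_mem (of_commutator_mem hu hv) hw
        apply of_mem_of_twentyfour hc
        apply of_mem_of_twentyfour hc
        -- The error terms of the commutator of three elements are fourfold brackets, which are
        -- already known to lie in H and are central.
        have hq : commutator (commutator u v) w - (24 : ℤ) • (24 : ℤ) • ⁅⁅u, v⁆, w⁆ =
            -(6912 : ℤ) • ⁅⁅⁅u, v⁆, u⁆, w⁆ - (6912 : ℤ) • ⁅⁅⁅u, v⁆, v⁆, w⁆
              - (6912 : ℤ) • ⁅⁅⁅u, v⁆, w⁆, w⁆ := by
          simp only [commutator, lie_add, add_lie, sub_lie, lie_sub, smul_lie, lie_smul,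
            lie_lie_eq_sub, IsNilFour.lie_five, zero_lie, smul_zero, sub_zero, add_zero, sub_self]
          module
        have hmem : commutator (commutator u v) w - (24 : ℤ) • (24 : ℤ) • ⁅⁅u, v⁆, w⁆ ∈
            fourfold H := by
          rw [hq]
          exact sub_mem (sub_mem (zsmul_mem (fourfold_mem hu hv hu hw) _)
            (zsmul_mem (fourfold_mem hu hv hv hw) _)) (zsmul_mem (fourfold_mem hu hv hw hw) _)
        have := of_sub_mem h (of_mem_of_mem_fourfold hc hmem) (lie_fourfold_eq_zero hmem _)
        rwa [sub_sub_cancel] at this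
      · exact of_mem_of_mem_fourfold hc hx
    | zero => exact ⟨zero_mem _, one_mem H⟩
    | add x y _ _ hx hy =>
      exact ⟨add_mem hx.1 hy.1, of_add_mem hx.2 hy.2 (threefold_lie_threefold hx.1 hy.1)⟩
    | neg x _ hx => exact ⟨neg_mem hx.1, inv_mem hx.2⟩
  exact key.2

/-- A subgroup is closed under the Lie bracket if `24` is invertible. -/
theorem of_lie_mem {u v : L} (hu : of u ∈ H) (hv : of v ∈ H) : of ⁅u, v⁆ ∈ H := by
  apply of_mem_of_twentyfour hc
  -- The commutator minus its leading term 24 ⁅u, v⁆ is a sum of three- and fourfold brackets. These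
  -- lie in H and commute with the commutator, so the group operation subtracts them.
  have hmem : -(288 : ℤ) • ⁅⁅u, v⁆, u⁆ - (288 : ℤ) • ⁅⁅u, v⁆, v⁆
      + (2304 : ℤ) • ⁅⁅⁅u, v⁆, u⁆, u⁆ + (3456 : ℤ) • ⁅⁅⁅u, v⁆, u⁆, v⁆
      + (2304 : ℤ) • ⁅⁅⁅u, v⁆, v⁆, v⁆ ∈ threefold H :=
    add_mem (add_mem (add_mem (sub_mem (zsmul_mem (threefold_mem hu hv hu) _)
      (zsmul_mem (threefold_mem hu hv hv) _))
      (zsmul_mem (fourfold_le_threefold (fourfold_mem hu hv hu hu)) _))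
      (zsmul_mem (fourfold_le_threefold (fourfold_mem hu hv hu hv)) _))
      (zsmul_mem (fourfold_le_threefold (fourfold_mem hu hv hv hv)) _)
  have h := of_sub_mem (of_commutator_mem hu hv) (of_mem_of_mem_threefold hc hmem) (by
    rw [commutator]
    simp only [add_lie, sub_lie, smul_lie, lie_threefold_eq_zero hmem]
    simp)
  convert h using 2
  rw [commutator]
  module

/-- A subgroup is closed under addition if `24` is invertible. -/
theorem of_add_mem_of_mem {u v : L} (hu : of u ∈ H) (hv : of v ∈ H) : of (u + v) ∈ H := by
  have hb := of_lie_mem hc hu hv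
  -- Multiplying u * v by -12 ⁅u, v⁆ cancels the term of degree two; the remaining error consists of
  -- three- and fourfold brackets.
  have h₁ : of (bch (bch u v) (-(12 : ℤ) • ⁅u, v⁆)) ∈ H := by
    rw [← of_mul, ← of_mul]
    exact mul_mem (mul_mem hu hv) (of_zsmul_mem hb _)
  have hq : bch (bch u v) (-(12 : ℤ) • ⁅u, v⁆) - (u + v) = (96 : ℤ) • ⁅⁅u, v⁆, u⁆
      + (192 : ℤ) • ⁅⁅u, v⁆, v⁆ - (576 : ℤ) • ⁅⁅⁅u, v⁆, u⁆, u⁆ - (1728 : ℤ) • ⁅⁅⁅u, v⁆, u⁆, v⁆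
      - (576 : ℤ) • ⁅⁅⁅u, v⁆, v⁆, v⁆ := by
    simp only [bch, lie_add, add_lie, sub_lie, lie_sub, smul_lie, lie_smul, lie_lie_eq_sub,
      IsNilFour.lie_five, zero_lie, smul_zero, sub_zero, add_zero, sub_self, lie_self]
    rw [← lie_skew v u]
    simp only [neg_lie, lie_vuvu v u]
    module
  have ht : bch (bch u v) (-(12 : ℤ) • ⁅u, v⁆) - (u + v) ∈ threefold H := by
    rw [hq]
    exact sub_mem (sub_mem (sub_mem (add_mem (zsmul_mem (threefold_mem hu hv hu) _)
      (zsmul_mem (threefold_mem hu hv hv) _))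
      (zsmul_mem (fourfold_le_threefold (fourfold_mem hu hv hu hu)) _))
      (zsmul_mem (fourfold_le_threefold (fourfold_mem hu hv hu hv)) _))
      (zsmul_mem (fourfold_le_threefold (fourfold_mem hu hv hv hv)) _)
  obtain ⟨t, ht'⟩ : ∃ t, t = bch (bch u v) (-(12 : ℤ) • ⁅u, v⁆) - (u + v) := ⟨_, rfl⟩
  rw [← ht'] at ht
  have h₁' : of (u + v + t) ∈ H := by
    rw [ht']
    convert h₁ using 2
    abel
  have h₂ : of (bch (u + v + t) (-t)) ∈ H := by
    rw [← of_mul, ← of_inv]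
    exact mul_mem h₁' (inv_mem (of_mem_of_mem_threefold hc ht))
  -- Dividing by t leaves only an error of degree four, which is central and lies in H.
  have h₃ : bch (u + v + t) (-t) = u + v - (12 : ℤ) • (⁅u, t⁆ + ⁅v, t⁆) := by
    simp only [bch, lie_add, add_lie, lie_neg, neg_lie, lie_self, lie_lie_threefold_eq_zero ht]
    simp only [add_zero, neg_zero, smul_zero, sub_zero, zero_lie]
    module
  have h₄ : -(12 : ℤ) • (⁅u, t⁆ + ⁅v, t⁆) ∈ fourfold H :=
    zsmul_mem (add_mem (lie_threefold_mem ht hu) (lie_threefold_mem ht hv)) _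
  have h₅ := of_sub_mem h₂ (of_mem_of_mem_fourfold hc h₄) (lie_fourfold_eq_zero h₄ _)
  convert h₅ using 2
  rw [h₃]
  module

end Lazard

end ExpGroup
end

/-! ### Group homomorphisms as Lie homomorphisms; powers in subgroups of finite index -/

noncomputable section

namespace ExpGroup

section Graph

variable {L M : Type*} [LieRing L] [IsNilFour L] [LieRing M] [IsNilFour M]

instance : IsNilFour (L × M) where
  lie_five a b c d e := Prod.ext (IsNilFour.lie_five a.1 b.1 c.1 d.1 e.1)
    (IsNilFour.lie_five a.2 b.2 c.2 d.2 e.2)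

variable (f : ExpGroup L →* ExpGroup M)

/-- The graph of a homomorphism. -/
def graph : Subgroup (ExpGroup (L × M)) where
  carrier := {g | f (of (of.symm g : L × M).1) = of (of.symm g : L × M).2}
  one_mem' := map_one f
  mul_mem' {a b} ha hb := by
    obtain ⟨a, rfl⟩ := of.surjective a
    obtain ⟨b, rfl⟩ := of.surjective b
    change f (of a.1) = of a.2 at ha
    change f (of b.1) = of b.2 at hb
    change f (of a.1 * of b.1) = of a.2 * of b.2
    rw [map_mul, ha, hb]
  inv_mem' {a} ha := by
    obtain ⟨a, rfl⟩ := of.surjective a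
    change f (of a.1) = of a.2 at ha
    change f ((of a.1)⁻¹) = (of a.2)⁻¹
    rw [map_inv, ha]

theorem of_mem_graph {u : L} {v : M} : of (u, v) ∈ graph f ↔ f (of u) = of v := Iff.rfl

variable {c : ℤ} (hcL : ∀ v : L, (c * 24) • v = v) (hcM : ∀ v : M, (c * 24) • v = v)

/-- If `24` is invertible, then homomorphisms of groups are homomorphisms of Lie rings. -/
def toLieHom : L →ₗ⁅ℤ⁆ M where
  toFun u := of.symm (f (of u))
  -- The graph of f is a subgroup of the group of L × M. Being closed under sums and brackets means
  -- that f is additive and preserves brackets.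
  map_add' u v := of.injective (of_add_mem_of_mem
    (fun w => Prod.ext (hcL w.1) (hcM w.2) : ∀ w : L × M, (c * 24) • w = w)
    ((of_mem_graph f).2 (of.apply_symm_apply (f (of u))).symm)
    ((of_mem_graph f).2 (of.apply_symm_apply (f (of v))).symm))
  map_smul' n u := of.injective (by
    rw [← of_zpow, map_zpow]
    simp only [Equiv.apply_symm_apply, RingHom.id_apply]
    rw [← of_zpow, Equiv.apply_symm_apply])
  map_lie' {u v} := of.injective (of_lie_mem
    (fun w => Prod.ext (hcL w.1) (hcM w.2) : ∀ w : L × M, (c * 24) • w = w)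
    ((of_mem_graph f).2 (of.apply_symm_apply (f (of u))).symm)
    ((of_mem_graph f).2 (of.apply_symm_apply (f (of v))).symm))

end Graph

end ExpGroup

/-- A power of every element of a nilpotent group lies in a given subgroup of finite index. -/
theorem pow_index_mem_of_isNilpotent {G : Type*} [Group G] [Group.IsNilpotent G] (n : ℕ) :
    ∀ H : Subgroup G, H.index = n → n ≠ 0 → ∀ g : G, g ^ n ∈ H := by
  induction n using Nat.strong_induction_on with
  | _ n ih =>
    intro H hH hn g
    by_cases htop : H = ⊤
    · rw [htop]
      trivial
    -- A proper subgroup of a nilpotent group is strictly smaller than its normalizer. Induction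
    -- applies to the normalizer, and inside it H is normal.
    · have hlt : H < Subgroup.normalizer (H : Set G) :=
        Group.normalizerCondition_of_isNilpotent H (lt_top_iff_ne_top.2 htop)
      have hmul := Subgroup.relIndex_mul_index hlt.le
      rw [hH] at hmul
      have hr : H.relIndex (Subgroup.normalizer (H : Set G)) ≠ 1 := fun h =>
        hlt.not_ge (Subgroup.relIndex_eq_one.1 h)
      have hi0 : (Subgroup.normalizer (H : Set G)).index ≠ 0 := fun h =>
        hn (by rw [← hmul, h, mul_zero])
      have hr0 : H.relIndex (Subgroup.normalizer (H : Set G)) ≠ 0 := fun h =>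
        hn (by rw [← hmul, h, zero_mul])
      have h1 := ih _ (by rw [← hmul]; exact lt_mul_of_one_lt_left (by omega) (by omega)) _ rfl hi0 g
      have h2 : (⟨_, h1⟩ : Subgroup.normalizer (H : Set G)) ^
          (H.subgroupOf (Subgroup.normalizer (H : Set G))).index ∈
          H.subgroupOf (Subgroup.normalizer (H : Set G)) := Subgroup.pow_index_mem _ _
      rw [Subgroup.mem_subgroupOf] at h2
      rw [← hmul, mul_comm, pow_mul]
      exact h2
end

/-! ### Profinite completions and finite quotients -/

noncomputable section

open CategoryTheory in
theorem proIsomorphic_of_mulEquiv {G H : Type} [Group G] [Group H] (e : G ≃* H) :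
    ProIsomorphic G H := by
  obtain ⟨i⟩ : Nonempty (ProfiniteGrp.ProfiniteCompletion.completion (GrpCat.of G) ≅
      ProfiniteGrp.ProfiniteCompletion.completion (GrpCat.of H)) :=
    ⟨ProfiniteGrp.profiniteCompletion.mapIso
      (MulEquiv.toGrpIso (X := GrpCat.of G) (Y := GrpCat.of H) e)⟩
  exact ⟨{ toFun := i.hom.hom
           invFun := i.inv.hom
           left_inv := fun x => ConcreteCategory.congr_hom i.hom_inv_id x
           right_inv := fun x => ConcreteCategory.congr_hom i.inv_hom_id x
           map_mul' := map_mul i.hom.hom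
           continuous_toFun := i.hom.hom.continuous_toFun
           continuous_invFun := i.inv.hom.continuous_toFun }⟩

section

open ProfiniteGrp.ProfiniteCompletion

variable {D G : Type} [Group D] [Group G]

/-- The extension of a homomorphism to a finite group to the profinite completion. -/
def completionLift {Q : Type} [Group Q] (π : D →* Q) [Finite Q] :
    completion (GrpCat.of D) →* Q where
  toFun x :=
    letI K : FiniteIndexNormalSubgroup D :=
      haveI := Subgroup.finiteIndex_ker π
      FiniteIndexNormalSubgroup.ofSubgroup π.ker
    QuotientGroup.kerLift π (x.1 K)
  map_one' := map_one (QuotientGroup.kerLift π)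
  map_mul' _ _ := map_mul (QuotientGroup.kerLift π) _ _

theorem isOpen_completionLift {Q : Type} [Group Q] (π : D →* Q) [Finite Q] (s : Set Q) :
    IsOpen {x | completionLift π x ∈ s} := by
  have := Subgroup.finiteIndex_ker π
  let K : FiniteIndexNormalSubgroup D := FiniteIndexNormalSubgroup.ofSubgroup π.ker
  have hc : Continuous fun x : completion (GrpCat.of D) => x.1 K :=
    (continuous_apply K).comp continuous_subtype_val
  have : DiscreteTopology ((diagram (GrpCat.of D)).obj K) := ⟨rfl⟩
  have ho : IsOpen ({y | QuotientGroup.kerLift π y ∈ s} : Set ((diagram (GrpCat.of D)).obj K)) :=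
    isOpen_discrete _
  exact ho.preimage hc

theorem exists_completionLift_eq {Q : Type} [Group Q] (π : D →* Q) [Finite Q]
    {S : Type*} {f : S → completion (GrpCat.of D)} (hf : DenseRange f)
    (x : completion (GrpCat.of D)) : ∃ s, completionLift π (f s) = completionLift π x := by
  obtain ⟨s, hs⟩ := hf.exists_mem_open (isOpen_completionLift π {completionLift π x}) ⟨x, rfl⟩
  exact ⟨s, hs⟩

/-- A group with the same profinite completion as `D` has coherent families of homomorphisms to
finite groups with the same images as those of `D`. -/
theorem exists_coherent_homs (h : ProIsomorphic D G) {Q : ℕ → Type} [∀ n, Group (Q n)]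
    [∀ n, Finite (Q n)] (π : ∀ n, D →* Q n) (r : ∀ n, Q (n + 1) →* Q n)
    (hπ : ∀ n d, r n (π (n + 1) d) = π n d) :
    ∃ F : ∀ n, G →* Q n, (∀ n g, r n (F (n + 1) g) = F n g) ∧ ∀ n, (F n).range = (π n).range := by
  obtain ⟨e⟩ := h
  -- Through the isomorphism, G is dense in the completion of D just as D is; a homomorphism to a
  -- finite group with open fibres has the same image on any two dense subsets.
  have hG : DenseRange fun g : G => e.symm (etaFn (GrpCat.of G) g) :=
    e.symm.surjective.denseRange.comp (ProfiniteGrp.ProfiniteCompletion.denseRange (GrpCat.of G))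
      e.symm.continuous_toFun
  have hD : DenseRange (etaFn (GrpCat.of D)) :=
    ProfiniteGrp.ProfiniteCompletion.denseRange (GrpCat.of D)
  refine ⟨fun n => (completionLift (π n)).comp
    ((e.symm : _ →* _).comp (ProfiniteGrp.ProfiniteCompletion.eta (GrpCat.of G)).hom), ?_, ?_⟩
  · intro n g
    set x := e.symm (etaFn (GrpCat.of G) g)
    change r n (completionLift (π (n + 1)) x) = completionLift (π n) x
    obtain ⟨d, hd⟩ := hD.exists_mem_open
      ((isOpen_completionLift (π (n + 1)) {completionLift (π (n + 1)) x}).inter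
        (isOpen_completionLift (π n) {completionLift (π n) x})) ⟨x, rfl, rfl⟩
    have h1 : π (n + 1) d = completionLift (π (n + 1)) x := hd.1
    have h2 : π n d = completionLift (π n) x := hd.2
    rw [← h1, ← h2, hπ]
  · intro n
    ext q
    constructor
    · rintro ⟨g, rfl⟩
      exact exists_completionLift_eq (π n) hD _
    · rintro ⟨d, rfl⟩
      exact exists_completionLift_eq (π n) hG (etaFn (GrpCat.of D) d)

end
end

/-! ### Rigidity of triples satisfying the relations -/

noncomputable section

namespace Model

/-- The defining relations of `Λ`, for three elements of a Lie ring. -/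
structure Relations {L : Type*} [LieRing L] (x y z : L) : Prop where
  one : ⁅⁅⁅y, x⁆, x⁆, x⁆ = ⁅⁅y, z⁆, y⁆
  two : ⁅⁅⁅z, x⁆, x⁆, x⁆ = ⁅⁅z, y⁆, z⁆

theorem Relations.swap {L : Type*} [LieRing L] {x y z : L} (h : Relations x y z) :
    Relations x z y := ⟨h.two, h.one⟩

theorem Relations.map {L M F : Type*} [LieRing L] [LieRing M] [FunLike F L M] (f : F)
    (hf : ∀ a b, f ⁅a, b⁆ = ⁅f a, f b⁆) {x y z : L} (h : Relations x y z) :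
    Relations (f x) (f y) (f z) :=
  ⟨by simp only [← hf, h.one], by simp only [← hf, h.two]⟩

variable {R : Type*} [CommRing R]

/-- The triples of elements of the model that are diagonal modulo the derived ring and satisfy the
defining relations, in coordinates. -/
structure IsDiagTriple (x y z : Model R) : Prop where
  x1 : x 1 = 0
  x2 : x 2 = 0
  y0 : y 0 = 0
  y2 : y 2 = 0
  y4 : y 4 = 0
  z0 : z 0 = 0
  z1 : z 1 = 0
  z3 : z 3 = 0
  cube : x 0 ^ 3 = y 1 * z 2
  cross : y 3 * z 2 = z 4 * y 1

theorem IsDiagTriple.relations {x y z : Model R} (h : IsDiagTriple x y z) : Relations x y z := by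
  obtain ⟨x1, x2, y0, y2, y4, z0, z1, z3, hc, hk⟩ := h
  constructor <;> apply ext_coord <;>
    simp [x1, x2, y0, y2, y4, z0, z1, z3, -lie_skew, -lie_lie]
  · linear_combination y 1 * hc
  · linear_combination y 1 * hk
  · linear_combination (-2 * y 1) * hk
  · linear_combination z 2 * hc
  · linear_combination -z 2 * hk
  · linear_combination 2 * z 2 * hk

/-- The determinant of the linear parts of three elements. -/
def linDet (x y z : Model R) : R :=
  x 0 * (y 1 * z 2 - y 2 * z 1) - x 1 * (y 0 * z 2 - y 2 * z 0) + x 2 * (y 0 * z 1 - y 1 * z 0)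

theorem linDet_swap (x y z : Model R) : linDet x z y = -linDet x y z := by
  unfold linDet
  ring

/-- The left sides of the relations have degree four, so the degree-three coordinates of ⁅⁅y, z⁆, y⁆
and ⁅⁅z, y⁆, z⁆ vanish. They are built from the 2 × 2 minors of the linear parts of y and z times
entries of y or z, and they force y and z into the span of Y and Z modulo the derived ring. -/
theorem Relations.linear [IsDomain R] {x y z : Model R} (h : Relations x y z)
    (hd : linDet x y z ≠ 0) : y 0 = 0 ∧ z 0 = 0 ∧ x 0 ≠ 0 ∧ y 1 * z 2 - y 2 * z 1 ≠ 0 := by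
  have e : ∀ i, ⁅⁅⁅y, x⁆, x⁆, x⁆ i = ⁅⁅y, z⁆, y⁆ i := fun i => by rw [h.one]
  have f : ∀ i, ⁅⁅⁅z, x⁆, x⁆, x⁆ i = ⁅⁅z, y⁆, z⁆ i := fun i => by rw [h.two]
  have e6 := e 6
  have e8 := e 8
  have e7 := e 7
  have e9 := e 9
  have e10 := e 10
  have f6 := f 6
  have f8 := f 8
  have f7 := f 7
  have f9 := f 9
  have f10 := f 10
  simp [-lie_skew, -lie_lie, -zero_eq_mul, -mul_eq_zero] at e6 e7 e8 e9 e10 f6 f7 f8 f9 f10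
  -- If this minor is nonzero, the coordinates of YXX and YXY force y 0 = y 1 = 0, which makes the
  -- minor zero.
  have P3 : y 1 * z 0 - y 0 * z 1 = 0 := by
    by_contra hP
    apply hP
    have h1 : y 0 = 0 := by simpa [hP] using e6.symm
    have h2 : y 1 = 0 := by simpa [hP] using e8.symm
    rw [h1, h2]
    ring
  have P4 : y 2 * z 0 - y 0 * z 2 = 0 := by
    by_contra hP
    apply hP
    have h1 : y 0 = 0 := by simpa [hP] using e7.symm
    have h2 : y 2 = 0 := by simpa [hP] using e9.symm
    rw [h1, h2]
    ring
  have hdet : linDet x y z = x 0 * (y 1 * z 2 - y 2 * z 1) := by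
    unfold linDet
    linear_combination x 1 * P4 - x 2 * P3
  rw [hdet] at hd
  have hP := right_ne_zero_of_mul hd
  refine ⟨?_, ?_, left_ne_zero_of_mul hd, hP⟩
  · rw [P3] at e10
    simpa [hP] using e10.symm
  · have P3' : z 1 * y 0 - z 0 * y 1 = 0 := by linear_combination -P3
    have hP' : z 1 * y 2 - z 2 * y 1 ≠ 0 := fun h0 => hP (by linear_combination -h0)
    rw [P3'] at f10
    simpa [hP'] using f10.symm

/-- The words YXXY and ZXXZ do not occur on the right sides once y 0 = z 0 = 0. On the left their
coefficients are 2 x₀² x₁ or 2 x₀² x₂ times an entry of y or z, and the minor of y and z is not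
zero. -/
theorem Relations.x_linear [IsDomain R] (h2 : (2 : R) ≠ 0) {x y z : Model R} (h : Relations x y z)
    (hd : linDet x y z ≠ 0) : x 1 = 0 ∧ x 2 = 0 := by
  obtain ⟨y0, z0, hx, hP⟩ := h.linear hd
  have e : ∀ i, ⁅⁅⁅y, x⁆, x⁆, x⁆ i = ⁅⁅y, z⁆, y⁆ i := fun i => by rw [h.one]
  have f : ∀ i, ⁅⁅⁅z, x⁆, x⁆, x⁆ i = ⁅⁅z, y⁆, z⁆ i := fun i => by rw [h.two]
  have e14 := e 14
  have e15 := e 15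
  have f14 := f 14
  have f15 := f 15
  simp [-lie_skew, -lie_lie, -zero_eq_mul, -mul_eq_zero, y0, z0] at e14 e15 f14 f15
  have hx2 : 2 * x 0 ^ 2 ≠ 0 := mul_ne_zero h2 (pow_ne_zero 2 hx)
  constructor
  · refine mul_left_cancel₀ (mul_ne_zero hx2 hP) ?_
    linear_combination z 2 * e14 - y 2 * f14
  · refine mul_left_cancel₀ (mul_ne_zero hx2 hP) ?_
    linear_combination y 1 * f15 - z 1 * e15

/-- With P the minor of y and z, the coordinates of YXXX and ZXXX give x₀³ = P and (x₀³ + P) y₂ =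
(x₀³ + P) z₁ = 0, so the off-diagonal entries vanish. After that YXYY, ZXZZ and YXYZ give z₃ = 0, y₄
= 0 and the cross relation. -/
theorem Relations.isDiagTriple_of_ne_zero [IsDomain R] (h2 : (2 : R) ≠ 0) {x y z : Model R}
    (h : Relations x y z) (hd : linDet x y z ≠ 0) (hy : y 1 ≠ 0) : IsDiagTriple x y z := by
  obtain ⟨y0, z0, hx, hP⟩ := h.linear hd
  obtain ⟨x1, x2⟩ := h.x_linear h2 hd
  have e : ∀ i, ⁅⁅⁅y, x⁆, x⁆, x⁆ i = ⁅⁅y, z⁆, y⁆ i := fun i => by rw [h.one]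
  have f : ∀ i, ⁅⁅⁅z, x⁆, x⁆, x⁆ i = ⁅⁅z, y⁆, z⁆ i := fun i => by rw [h.two]
  have e12 := e 12
  have e13 := e 13
  have f12 := f 12
  have e19 := e 19
  have e21 := e 21
  have f20 := f 20
  simp only [lie_apply_0, lie_apply_1, lie_apply_2, lie_apply_3, lie_apply_4, lie_apply_5,
        lie_apply_6, lie_apply_7, lie_apply_8, lie_apply_9, lie_apply_11,
        lie_apply_12, lie_apply_13, lie_apply_19, lie_apply_20,
        lie_apply_21, x1, x2, y0, z0] at e12 e13 f12 e19 e21 f20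
  have hx3 : x 0 ^ 3 = y 1 * z 2 - y 2 * z 1 := by
    apply mul_left_cancel₀ hy
    linear_combination e12
  have hx2 : 2 * x 0 ^ 3 ≠ 0 := mul_ne_zero h2 (pow_ne_zero 3 hx)
  have y2 : y 2 = 0 := by
    refine mul_left_cancel₀ hx2 ?_
    linear_combination e13 + y 2 * hx3
  have z1 : z 1 = 0 := by
    refine mul_left_cancel₀ hx2 ?_
    linear_combination f12 + z 1 * hx3
  simp only [y2, z1] at e19 e21 f20 hx3
  ring_nf at e19 e21 f20
  have hy2 : y 1 ^ 2 ≠ 0 := pow_ne_zero 2 hy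
  have hz : z 2 ≠ 0 := by
    rintro hz
    rw [hz, mul_zero, mul_zero, sub_zero] at hx3
    exact hx (pow_eq_zero_iff (by norm_num) |>.1 hx3)
  have z3 : z 3 = 0 := by
    refine mul_left_cancel₀ hy2 ?_
    linear_combination e19
  have y4 : y 4 = 0 := by
    refine mul_left_cancel₀ (pow_ne_zero 2 hz) ?_
    linear_combination f20
  have hk : y 3 * z 2 = z 4 * y 1 := by
    refine mul_left_cancel₀ hy ?_
    linear_combination e21
  exact ⟨x1, x2, y0, y2, y4, z0, z1, z3, by linear_combination hx3, hk⟩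

/-- Three elements of the model with nonzero linear determinant that satisfy the defining relations
form a diagonal triple, up to the order of the last two. -/
theorem Relations.isDiagTriple_or [IsDomain R] (h2 : (2 : R) ≠ 0) {x y z : Model R}
    (h : Relations x y z) (hd : linDet x y z ≠ 0) : IsDiagTriple x y z ∨ IsDiagTriple x z y := by
  by_cases hy : y 1 = 0
  · right
    have hz : z 1 ≠ 0 := fun hz => (h.linear hd).2.2.2 (by rw [hy, hz]; ring)
    exact h.swap.isDiagTriple_of_ne_zero h2 (by rwa [linDet_swap, neg_ne_zero]) hz
  · exact Or.inl (h.isDiagTriple_of_ne_zero h2 hd hy)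

theorem IsDiagTriple.linDet_eq {x y z : Model R} (h : IsDiagTriple x y z) :
    linDet x y z = x 0 * y 1 * z 2 := by
  unfold linDet
  rw [h.x1, h.x2, h.y2]
  ring

end Model
end

/-! ### Weights and triangular endomorphisms -/

noncomputable section

namespace Model

variable {R : Type*} [CommRing R]

/-- The weights of the basis vectors under the diagonal action `X ↦ l X`, `Y ↦ a Y`, `Z ↦ b Z`. -/
def weight (l a b : R) : Fin 25 → R :=
  ![l, a, b, a * l, b * l, a * b, a * l ^ 2, b * l ^ 2, a ^ 2 * l, b ^ 2 * l, a * b * l, a * b * l,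
    a * l ^ 3, b * l ^ 3, a ^ 2 * l ^ 2, b ^ 2 * l ^ 2, a * b * l ^ 2, a * b * l ^ 2,
    a * b * l ^ 2, a ^ 3 * l, b ^ 3 * l, a ^ 2 * b * l, a ^ 2 * b * l, a * b ^ 2 * l, a * b ^ 2 * l]

/-- The linear parts are diagonal, so each basis word goes to a multiple of itself modulo higher
degree, and the order of the basis refines the degree. -/
theorem liftLinear_apply_of_isDiagTriple {x y z : Model R} (h : IsDiagTriple x y z) (v : Model R)
    (i : Fin 25) (hv : ∀ j < i, v j = 0) :
    liftLinear x y z v i = weight (x 0) (y 1) (z 2) i * v i := by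
  obtain ⟨x1, x2, y0, y2, y4, z0, z1, z3, -, -⟩ := h
  fin_cases i
  all_goals
    simp at hv
    simp [liftLinear, weight, x1, x2, y0, y2, z0, z1, hv, -lie_skew, -lie_lie]
    try ring

end Model
end

noncomputable section

namespace Model

variable {R : Type*} [CommRing R]

/-- An additive endomorphism of the model is triangular with diagonal entries `d`. -/
def IsTriangular (A : Model R →+ Model R) (d : Fin 25 → R) : Prop :=
  ∀ (v : Model R) (i : Fin 25), (∀ j < i, v j = 0) → A v i = d i * v i

/-- A multiple of the n-th basis vector adjusts the coordinate n and leaves the earlier ones alone,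
so the coordinates can be treated in order. Taking for P equality with a target gives surjectivity;
taking for P a set of residues gives normal forms. -/
theorem IsTriangular.exists_forall {A : Model R →+ Model R} {d : Fin 25 → R}
    (hA : IsTriangular A d) (l : ℕ) (P : Fin 25 → R → Prop)
    (hP : ∀ i : Fin 25, l ≤ i → ∀ r, ∃ q, P i (r + d i * q)) (w : Model R) :
    ∃ v : Model R, (∀ j : Fin 25, (j : ℕ) < l → v j = 0) ∧
      (∀ j : Fin 25, (j : ℕ) < l → (w + A v) j = w j) ∧
      ∀ j : Fin 25, l ≤ j → P j ((w + A v) j) := by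
  have key : ∀ n, ∃ v : Model R, (∀ j : Fin 25, (j : ℕ) < l → v j = 0) ∧
      ∀ j : Fin 25, l ≤ j → (j : ℕ) < n → P j ((w + A v) j) := by
    intro n
    induction n with
    | zero => exact ⟨0, fun _ _ => rfl, fun j _ hj => absurd hj (by omega)⟩
    | succ n ih =>
      obtain ⟨v, hv, h⟩ := ih
      by_cases hn : l ≤ n ∧ n < 25
      · obtain ⟨q, hq⟩ := hP ⟨n, hn.2⟩ hn.1 ((w + A v) ⟨n, hn.2⟩)
        have h0 : ∀ j < (⟨n, hn.2⟩ : Fin 25), (q • basisVec ⟨n, hn.2⟩ : Model R) j = 0 :=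
          fun j hj => by rw [smul_apply, basisVec_apply, if_neg hj.ne, mul_zero]
        refine ⟨v + q • basisVec ⟨n, hn.2⟩, fun j hj => ?_, fun j hlj hj => ?_⟩
        · rw [add_apply, hv j hj, h0 j (Fin.lt_def.2 (lt_of_lt_of_le hj hn.1)), add_zero]
        · rw [map_add, ← add_assoc, add_apply]
          rcases Nat.lt_succ_iff_lt_or_eq.1 hj with hj | hj
          · rw [hA _ j fun k hk => h0 k (hk.trans hj), h0 j hj, mul_zero, add_zero]
            exact h j hlj hj
          · obtain rfl : j = ⟨n, hn.2⟩ := Fin.ext hj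
            rw [hA _ _ h0, smul_apply, basisVec_apply, if_pos rfl, mul_one]
            exact hq
      · exact ⟨v, hv, fun j hlj hj => h j hlj (by omega)⟩
  obtain ⟨v, hv, h⟩ := key 25
  refine ⟨v, hv, fun j hj => ?_, fun j hj => h j hj j.2⟩
  rw [add_apply, hA _ _ fun k hk => hv k (lt_trans hk hj), hv j hj, mul_zero, add_zero]

theorem IsTriangular.surjective {A : Model R →+ Model R} {d : Fin 25 → R}
    (hA : IsTriangular A d) (hd : ∀ i, IsUnit (d i)) : Function.Surjective A := by
  intro t
  obtain ⟨v, -, -, h⟩ := hA.exists_forall 0 (fun i r => r = t i) (fun i _ r => by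
    obtain ⟨u, hu⟩ := hd i
    refine ⟨↑u⁻¹ * (t i - r), ?_⟩
    rw [← hu, Units.mul_inv_cancel_left]
    ring) 0
  exact ⟨v, ext fun i => by simpa using h i (Nat.zero_le _)⟩

theorem IsTriangular.injective [IsDomain R] {A : Model R →+ Model R} {d : Fin 25 → R}
    (hA : IsTriangular A d) (hd : ∀ i, d i ≠ 0) : Function.Injective A := by
  rw [injective_iff_map_eq_zero]
  intro v hv
  refine ext fun i => ?_
  induction i using WellFoundedLT.induction with
  | _ i ih =>
    have h := hA v i ih
    rw [hv, zero_apply] at h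
    exact (mul_eq_zero.1 h.symm).resolve_left (hd i)

/-- Uniqueness of normal forms: at the first nonzero coordinate of v, two representatives in the box
would differ by a nonzero multiple of d. -/
theorem IsTriangular.eq_zero_of_mem_box {A : Model ℤ →+ Model ℤ} {d : Fin 25 → ℤ}
    (hA : IsTriangular A d) (l : ℕ) {w v : Model ℤ} (hv : ∀ j : Fin 25, (j : ℕ) < l → v j = 0)
    (hw : ∀ j : Fin 25, l ≤ j → 0 ≤ w j ∧ w j < d j)
    (hwv : ∀ j : Fin 25, l ≤ j → 0 ≤ (w + A v) j ∧ (w + A v) j < d j) : v = 0 := by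
  have key : ∀ n, ∀ i : Fin 25, (i : ℕ) < n → v i = 0 := by
    intro n
    induction n with
    | zero => exact fun i hi => absurd hi (by omega)
    | succ n ih =>
      intro i hi
      rcases Nat.lt_succ_iff_lt_or_eq.1 hi with hi | hi
      · exact ih i hi
      · by_cases hl : l ≤ i
        · have h1 := hw i hl
          have h2 := hwv i hl
          rw [add_apply, hA v i fun j hj => ih j (by omega)] at h2
          have h3 : v i < 1 := by
            by_contra! h
            nlinarith
          have h4 : -1 < v i := by
            by_contra! h
            nlinarith
          omega
        · exact hv i (by omega)
  exact ext fun i => key 25 i i.2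

theorem IsTriangular.index_range {A : Model ℤ →+ Model ℤ} {d : Fin 25 → ℤ}
    (hA : IsTriangular A d) (hd : ∀ i, d i ≠ 0) : A.range.index = (∏ i, d i).natAbs := by
  let bE : Module.Basis (Fin 25) ℤ (Model ℤ) := Module.Basis.ofEquivFun
    (AddEquiv.toIntLinearEquiv (show Model ℤ ≃+ (Fin 25 → ℤ) from AddEquiv.refl _))
  have hrepr : ∀ (v : Model ℤ) (i : Fin 25), bE.repr v i = v i := fun v i => rfl
  have hE : ∀ i, bE i = basisVec i := fun i => bE.repr.injective (by
    ext j
    rw [Module.Basis.repr_self]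
    refine Eq.trans ?_ (hrepr (basisVec i) j).symm
    rw [basisVec_apply, Finsupp.single_apply]
    simp only [eq_comm])
  let bN : Module.Basis (Fin 25) ℤ A.range := bE.map
    (AddEquiv.toIntLinearEquiv (AddMonoidHom.ofInjective (hA.injective hd)))
  have hN : ∀ i, (bN i : Model ℤ) = A (basisVec i) := fun i => by
    rw [← hE]
    rfl
  rw [AddSubgroup.index_eq_natAbs_det bE _ bN, Module.Basis.det_apply, Matrix.det_of_isLowerTriangular]
  · congr 1
    refine Finset.prod_congr rfl fun i _ => ?_
    rw [Module.Basis.toMatrix_apply, hrepr, hN, hA _ _ fun j hj => by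
      rw [basisVec_apply, if_neg hj.ne], basisVec_apply, if_pos rfl, mul_one]
  · intro i j hij
    have hij : i < j := hij
    rw [Module.Basis.toMatrix_apply, hrepr, hN, hA _ _ fun k hk => by
      rw [basisVec_apply, if_neg (hk.trans hij).ne], basisVec_apply, if_neg hij.ne, mul_zero]

end Model
end

/-! ### Normal forms of diagonal triples over ℤ_p -/

noncomputable section

namespace Model

/-- The exponents of the weights of the basis vectors for `l = p ^ k`, `a = p ^ i`, `b = p ^ j`. -/
def weightExp (k i j : ℕ) : Fin 25 → ℕ :=
  ![k, i, j, i + k, j + k, i + j, i + 2 * k, j + 2 * k, 2 * i + k, 2 * j + k, i + j + k, i + j + k,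
    i + 3 * k, j + 3 * k, 2 * i + 2 * k, 2 * j + 2 * k, i + j + 2 * k, i + j + 2 * k,
    i + j + 2 * k, 3 * i + k, 3 * j + k, 2 * i + j + k, 2 * i + j + k, i + 2 * j + k, i + 2 * j + k]

variable {R : Type*} [CommRing R]

theorem weight_pow (p : R) (k i j : ℕ) (l : Fin 25) :
    weight (p ^ k) (p ^ i) (p ^ j) l = p ^ weightExp k i j l := by
  fin_cases l <;> simp [weight, weightExp] <;> ring

theorem weight_mul (l a b l' a' b' : R) (i : Fin 25) :
    weight (l * l') (a * a') (b * b') i = weight l a b i * weight l' a' b' i := by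
  fin_cases i <;> simp [weight] <;> ring

theorem isUnit_weight {l a b : R} (hl : IsUnit l) (ha : IsUnit a) (hb : IsUnit b) (i : Fin 25) :
    IsUnit (weight l a b i) := by
  obtain ⟨l, rfl⟩ := hl
  obtain ⟨a, rfl⟩ := ha
  obtain ⟨b, rfl⟩ := hb
  refine IsUnit.of_mul_eq_one (weight (↑l⁻¹) (↑a⁻¹) (↑b⁻¹) i) ?_
  rw [← weight_mul, Units.mul_inv, Units.mul_inv, Units.mul_inv]
  fin_cases i <;> simp [weight]

/-- The linear endomorphism of the model that maps the basis vectors, as Lie words in the generators,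
to the same words in `x, y, z`. -/
def gen (x y z : Model R) : Model R →ₗ[R] Model R := liftLinear x y z

theorem gen_zero (x y z : Model R) : gen x y z (basisVec 0) = x := liftLinear_zero x y z

theorem gen_one (x y z : Model R) : gen x y z (basisVec 1) = y := liftLinear_one x y z

theorem gen_two (x y z : Model R) : gen x y z (basisVec 2) = z := liftLinear_two x y z

theorem gen_lie {x y z : Model R} (h : Relations x y z) (u v : Model R) :
    gen x y z ⁅u, v⁆ = ⁅gen x y z u, gen x y z v⁆ :=
  liftLinear_lie x y z h.one h.two u v

theorem isTriangular_gen {x y z : Model R} (h : IsDiagTriple x y z) :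
    IsTriangular (gen x y z).toAddMonoidHom
      (weight (x 0) (y 1) (z 2)) :=
  fun v i hv => liftLinear_apply_of_isDiagTriple h v i hv

/-- A diagonal triple over `ℤ` whose diagonal entries are powers of `p` and whose other entries
are reduced. -/
structure IsReduced (p k i j : ℕ) (x y z : Model ℤ) : Prop where
  diag : IsDiagTriple x y z
  x0 : x 0 = (p : ℤ) ^ k
  y1 : y 1 = (p : ℤ) ^ i
  z2 : z 2 = (p : ℤ) ^ j
  x_box : ∀ l : Fin 25, 3 ≤ (l : ℕ) → 0 ≤ x l ∧ x l < (p : ℤ) ^ weightExp k i j l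
  y_box : ∀ l : Fin 25, 5 ≤ (l : ℕ) → 0 ≤ y l ∧ y l < (p : ℤ) ^ weightExp k i j l
  z_box : ∀ l : Fin 25, 5 ≤ (l : ℕ) → 0 ≤ z l ∧ z l < (p : ℤ) ^ weightExp k i j l
  y3_box : i ≤ j → 0 ≤ y 3 ∧ y 3 < (p : ℤ) ^ (i + k)
  z4_box : j ≤ i → 0 ≤ z 4 ∧ z 4 < (p : ℤ) ^ (j + k)

section Padic

variable {p : ℕ} [Fact p.Prime]

theorem exists_natCast_eq_add_pow_mul (e : ℕ) {u : ℤ_[p]} (hu : IsUnit u) (r : ℤ_[p]) :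
    ∃ q : ℤ_[p], ∃ n : ℤ, (0 ≤ n ∧ n < (p : ℤ) ^ e) ∧ r + (p : ℤ_[p]) ^ e * u * q = n := by
  obtain ⟨u, rfl⟩ := hu
  obtain ⟨c, hc⟩ := Ideal.mem_span_singleton.1 (PadicInt.appr_spec e r)
  refine ⟨-(↑u⁻¹ * c), r.appr e, ⟨by positivity, by exact_mod_cast r.appr_lt e⟩, ?_⟩
  have : (p : ℤ_[p]) ^ e * ↑u * -(↑u⁻¹ * c) = -((p : ℤ_[p]) ^ e * c) := by
    rw [mul_neg, mul_assoc, Units.mul_inv_cancel_left]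
  rw [this, ← hc]
  push_cast
  ring

theorem exists_eq_pow_mul_unit {r : ℤ_[p]} (hr : r ≠ 0) :
    ∃ (n : ℕ) (u : ℤ_[p]ˣ), r = (p : ℤ_[p]) ^ n * u :=
  ⟨r.valuation, PadicInt.unitCoeff hr, by rw [mul_comm]; exact PadicInt.unitCoeff_spec hr⟩

theorem IsDiagTriple.of_map {R S : Type*} [CommRing R] [CommRing S] {f : R →+* S}
    (hf : Function.Injective f) {x y z : Model R}
    (h : IsDiagTriple (mapCoeff f x) (mapCoeff f y) (mapCoeff f z)) : IsDiagTriple x y z := by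
  obtain ⟨x1, x2, y0, y2, y4, z0, z1, z3, hc, hk⟩ := h
  simp only [mapCoeff_apply, ← map_pow, ← map_mul, hf.eq_iff, map_eq_zero_iff f hf] at *
  exact ⟨x1, x2, y0, y2, y4, z0, z1, z3, hc, hk⟩

theorem exists_mapCoeff_eq {v : Model ℤ_[p]} (h : ∀ l, ∃ n : ℤ, v l = n) :
    ∃ V : Model ℤ, mapCoeff (Int.castRingHom ℤ_[p]) V = v := by
  choose V hV using h
  exact ⟨V, ext fun l => (hV l).symm⟩

/-- A change of generators with unit diagonal shifts the two linked coefficients by a common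
parameter: t determines s. It can reduce only one of them, and the one with the smaller exponent is
chosen. -/
theorem exists_cross (i j k : ℕ) (y₃ z₄ : ℤ_[p]) (u₀ u₁ u₂ : ℤ_[p]ˣ) :
    ∃ t s : ℤ_[p], t * u₁ = s * u₂ ∧
      ((i ≤ j → ∃ n : ℤ, (0 ≤ n ∧ n < (p : ℤ) ^ (i + k)) ∧
        y₃ + (p : ℤ_[p]) ^ (i + k) * (u₁ * u₀ : ℤ_[p]ˣ) * t = n) ∧
      (j < i → ∃ n : ℤ, (0 ≤ n ∧ n < (p : ℤ) ^ (j + k)) ∧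
        z₄ + (p : ℤ_[p]) ^ (j + k) * (u₂ * u₀ : ℤ_[p]ˣ) * s = n)) := by
  rcases le_or_gt i j with hij | hij
  · obtain ⟨t, n, hn, h⟩ := exists_natCast_eq_add_pow_mul (i + k) (u₁ * u₀).isUnit y₃
    refine ⟨t, t * u₁ * ↑u₂⁻¹, ?_, fun _ => ⟨n, hn, h⟩, fun h => absurd hij h.not_ge⟩
    rw [Units.inv_mul_cancel_right]
  · obtain ⟨s, n, hn, h⟩ := exists_natCast_eq_add_pow_mul (j + k) (u₂ * u₀).isUnit z₄
    refine ⟨s * u₂ * ↑u₁⁻¹, s, ?_, fun h => absurd hij h.not_gt, fun _ => ⟨n, hn, h⟩⟩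
    rw [Units.inv_mul_cancel_right]

theorem IsDiagTriple.gen_apply_zero {R : Type*} [CommRing R] {x y z : Model R}
    (h : IsDiagTriple x y z) (v : Model R) : gen x y z v 0 = v 0 * x 0 := by
  simp [gen, liftLinear, h.y0, h.z0, -lie_skew, -lie_lie]

theorem IsDiagTriple.gen_apply_one {R : Type*} [CommRing R] {x y z : Model R}
    (h : IsDiagTriple x y z) (v : Model R) : gen x y z v 1 = v 1 * y 1 := by
  simp [gen, liftLinear, h.x1, h.z1, -lie_skew, -lie_lie]

theorem IsDiagTriple.gen_apply_two {R : Type*} [CommRing R] {x y z : Model R}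
    (h : IsDiagTriple x y z) (v : Model R) : gen x y z v 2 = v 2 * z 2 := by
  simp [gen, liftLinear, h.x2, h.y2, -lie_skew, -lie_lie]

theorem IsDiagTriple.gen_apply_three {R : Type*} [CommRing R] {x y z : Model R}
    (h : IsDiagTriple x y z) (v : Model R) :
    gen x y z v 3 = v 0 * x 3 + v 1 * y 3 + v 3 * (y 1 * x 0) := by
  simp [gen, liftLinear, h.x1, h.y0, h.z0, h.z1, h.z3, -lie_skew, -lie_lie]

theorem IsDiagTriple.gen_apply_four {R : Type*} [CommRing R] {x y z : Model R}
    (h : IsDiagTriple x y z) (v : Model R) :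
    gen x y z v 4 = v 0 * x 4 + v 2 * z 4 + v 4 * (z 2 * x 0) := by
  simp [gen, liftLinear, h.x2, h.y0, h.y2, h.z0, h.y4, -lie_skew, -lie_lie]

theorem map_gen {R : Type*} [CommRing R] (f : Model R →ₗ[R] Model R)
    (hf : ∀ u v, f ⁅u, v⁆ = ⁅f u, f v⁆) (a b c v : Model R) :
    f (gen a b c v) = gen (f a) (f b) (f c) v := by
  simp only [gen, liftLinear, LinearMap.coe_mk, AddHom.coe_mk, map_add, map_smul, hf]

/-- Rigidity replaces a computation: the composite satisfies the relations and has nonzero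
determinant, so it is diagonal. -/
theorem IsDiagTriple.comp {R : Type*} [CommRing R] [IsDomain R] (h2 : (2 : R) ≠ 0)
    {x y z a b c : Model R} (h : IsDiagTriple x y z) (h' : IsDiagTriple a b c)
    (hx : x 0 ≠ 0) (hy : y 1 ≠ 0) (hz : z 2 ≠ 0) (ha : a 0 ≠ 0) (hb : b 1 ≠ 0) (hc : c 2 ≠ 0) :
    IsDiagTriple (gen x y z a) (gen x y z b)
      (gen x y z c) := by
  have hrel : Relations (gen x y z a) (gen x y z b)
      (gen x y z c) :=
    h'.relations.map (gen x y z) (gen_lie h.relations)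
  refine hrel.isDiagTriple_of_ne_zero h2 ?_ ?_
  · rw [linDet]
    simp only [h.gen_apply_zero, h.gen_apply_one, h.gen_apply_two, h'.x1,
      h'.x2, h'.y0, h'.y2, h'.z0, h'.z1]
    simp [ha, hb, hc, hx, hy, hz]
  · rw [h.gen_apply_one]
    exact mul_ne_zero hb hy

theorem IsDiagTriple.range_comp {R : Type*} [CommRing R] {x y z a b c : Model R}
    (h : IsDiagTriple x y z) (h' : IsDiagTriple a b c) (ha : IsUnit (a 0)) (hb : IsUnit (b 1))
    (hc : IsUnit (c 2)) :
    Set.range (gen (gen x y z a) (gen x y z b)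
      (gen x y z c)) = Set.range (gen x y z) := by
  have hs : Function.Surjective (gen a b c) :=
    (isTriangular_gen h').surjective (isUnit_weight ha hb hc)
  rw [← hs.range_comp (gen x y z)]
  exact congrArg Set.range (funext fun v => (map_gen _ (gen_lie h.relations) a b c v).symm)

/-- Comparing norms in the cube relation cancels the powers of p. The identity for the unit parts is
what makes their inverses the diagonal of a triple satisfying the relations. -/
theorem IsDiagTriple.valuation {x y z : Model ℤ_[p]} (h : IsDiagTriple x y z) {k i j : ℕ}
    {u₀ u₁ u₂ : ℤ_[p]ˣ} (hx : x 0 = (p : ℤ_[p]) ^ k * u₀) (hy : y 1 = (p : ℤ_[p]) ^ i * u₁)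
    (hz : z 2 = (p : ℤ_[p]) ^ j * u₂) : u₀ ^ 3 = u₁ * u₂ := by
  have hp : (p : ℤ_[p]) ≠ 0 := Nat.cast_ne_zero.2 (Fact.out : p.Prime).ne_zero
  have hcube : (p : ℤ_[p]) ^ (3 * k) * (u₀ ^ 3 : ℤ_[p]ˣ) =
      (p : ℤ_[p]) ^ (i + j) * (u₁ * u₂ : ℤ_[p]ˣ) := by
    have hc := h.cube
    rw [hx, hy, hz] at hc
    push_cast
    linear_combination hc
  have hijk : 3 * k = i + j := by
    have hn := congrArg norm hcube
    rw [norm_mul, norm_mul, PadicInt.norm_units, PadicInt.norm_units, PadicInt.norm_p_pow,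
      PadicInt.norm_p_pow, mul_one, mul_one] at hn
    have := zpow_right_injective₀ (a := (p : ℝ)) (by exact_mod_cast (Fact.out : p.Prime).pos)
      (by exact_mod_cast (Fact.out : p.Prime).ne_one) hn
    omega
  rw [hijk] at hcube
  exact Units.ext (mul_left_cancel₀ (pow_ne_zero _ hp) hcube)

theorem isDiagTriple_unit {R : Type*} [CommRing R] {u₀ u₁ u₂ : Rˣ} (hu : u₀ ^ 3 = u₁ * u₂)
    {t s : R} (hts : t * u₁ = s * u₂) :
    IsDiagTriple ((↑u₀⁻¹ : R) • basisVec 0 : Model R) ((↑u₁⁻¹ : R) • basisVec 1 + t • basisVec 3)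
      ((↑u₂⁻¹ : R) • basisVec 2 + s • basisVec 4) := by
  constructor <;> simp [basisVec_apply]
  · rw [← Units.val_pow_eq_pow_val, inv_pow, hu, mul_inv, Units.val_mul]
  · have h1 := congrArg (fun r => r * (↑u₁⁻¹ : R) * (↑u₂⁻¹ : R)) hts
    simp only [Units.mul_inv_cancel_right] at h1
    rw [h1, mul_right_comm, Units.mul_inv_cancel_right]

/-- Every diagonal triple over `ℤ_p` generates the same Lie ring as one whose diagonal entries are
powers of `p`, and for which one of the entries linked by the cross relation is reduced. -/
theorem exists_normalized {x y z : Model ℤ_[p]} (h : IsDiagTriple x y z) (hx : x 0 ≠ 0)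
    (hy : y 1 ≠ 0) (hz : z 2 ≠ 0) : ∃ (k i j : ℕ) (x' y' z' : Model ℤ_[p]),
      IsDiagTriple x' y' z' ∧ x' 0 = (p : ℤ_[p]) ^ k ∧ y' 1 = (p : ℤ_[p]) ^ i ∧
      z' 2 = (p : ℤ_[p]) ^ j ∧
      (i ≤ j → ∃ n : ℤ, (0 ≤ n ∧ n < (p : ℤ) ^ (i + k)) ∧ y' 3 = n) ∧
      (j < i → ∃ n : ℤ, (0 ≤ n ∧ n < (p : ℤ) ^ (j + k)) ∧ z' 4 = n) ∧
      Set.range (gen x' y' z') = Set.range (gen x y z) := by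
  obtain ⟨k, u₀, hx'⟩ := exists_eq_pow_mul_unit hx
  obtain ⟨i, u₁, hy'⟩ := exists_eq_pow_mul_unit hy
  obtain ⟨j, u₂, hz'⟩ := exists_eq_pow_mul_unit hz
  have hu := h.valuation hx' hy' hz'
  obtain ⟨t, s, hts, ht, hs⟩ :=
    exists_cross i j k (((u₁⁻¹ : ℤ_[p]ˣ) : ℤ_[p]) * y 3) (((u₂⁻¹ : ℤ_[p]ˣ) : ℤ_[p]) * z 4) u₀ u₁ u₂
  have hd := isDiagTriple_unit hu hts
  obtain ⟨a, ha⟩ : ∃ a : Model ℤ_[p], a = (↑u₀⁻¹ : ℤ_[p]) • basisVec 0 := ⟨_, rfl⟩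
  obtain ⟨b, hb⟩ : ∃ b : Model ℤ_[p], b = (↑u₁⁻¹ : ℤ_[p]) • basisVec 1 + t • basisVec 3 := ⟨_, rfl⟩
  obtain ⟨c, hc⟩ : ∃ c : Model ℤ_[p], c = (↑u₂⁻¹ : ℤ_[p]) • basisVec 2 + s • basisVec 4 := ⟨_, rfl⟩
  rw [← ha, ← hb, ← hc] at hd
  have ha0 : a 0 = (↑u₀⁻¹ : ℤ_[p]) := by simp [ha, basisVec_apply]
  have hb0 : b 0 = 0 := by simp [hb, basisVec_apply]
  have hb1 : b 1 = (↑u₁⁻¹ : ℤ_[p]) := by simp [hb, basisVec_apply]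
  have hb3 : b 3 = t := by simp [hb, basisVec_apply]
  have hc0 : c 0 = 0 := by simp [hc, basisVec_apply]
  have hc2 : c 2 = (↑u₂⁻¹ : ℤ_[p]) := by simp [hc, basisVec_apply]
  have hc4 : c 4 = s := by simp [hc, basisVec_apply]
  refine ⟨k, i, j, _, _, _, h.comp two_ne_zero hd hx hy hz (by rw [ha0]; exact Units.ne_zero _)
    (by rw [hb1]; exact Units.ne_zero _) (by rw [hc2]; exact Units.ne_zero _),
    ?_, ?_, ?_, ?_, ?_, h.range_comp hd (by rw [ha0]; exact Units.isUnit _)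
      (by rw [hb1]; exact Units.isUnit _) (by rw [hc2]; exact Units.isUnit _)⟩
  · rw [h.gen_apply_zero, ha0, hx', mul_left_comm, Units.inv_mul, mul_one]
  · rw [h.gen_apply_one, hb1, hy', mul_left_comm, Units.inv_mul, mul_one]
  · rw [h.gen_apply_two, hc2, hz', mul_left_comm, Units.inv_mul, mul_one]
  · intro hij
    obtain ⟨n, hn, he⟩ := ht hij
    refine ⟨n, hn, ?_⟩
    rw [h.gen_apply_three, hb0, hb1, hb3, hy', hx', ← he]
    push_cast
    ring
  · intro hij
    obtain ⟨n, hn, he⟩ := hs hij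
    refine ⟨n, hn, ?_⟩
    rw [h.gen_apply_four, hc0, hc2, hc4, hz', hx', ← he]
    push_cast
    ring

/-- Every diagonal triple over `ℤ_p` whose diagonal entries are powers of `p` generates the same
Lie ring as one with the same entries in small degrees and reduced entries in higher degrees. -/
theorem exists_box {k i j : ℕ} {x y z : Model ℤ_[p]} (h : IsDiagTriple x y z)
    (hx : x 0 = (p : ℤ_[p]) ^ k) (hy : y 1 = (p : ℤ_[p]) ^ i) (hz : z 2 = (p : ℤ_[p]) ^ j) :
    ∃ x' y' z' : Model ℤ_[p], IsDiagTriple x' y' z' ∧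
      (∀ l : Fin 25, (l : ℕ) < 3 → x' l = x l) ∧ (∀ l : Fin 25, (l : ℕ) < 5 → y' l = y l) ∧
      (∀ l : Fin 25, (l : ℕ) < 5 → z' l = z l) ∧
      (∀ l : Fin 25, 3 ≤ (l : ℕ) →
        ∃ n : ℤ, (0 ≤ n ∧ n < (p : ℤ) ^ weightExp k i j l) ∧ x' l = n) ∧
      (∀ l : Fin 25, 5 ≤ (l : ℕ) →
        ∃ n : ℤ, (0 ≤ n ∧ n < (p : ℤ) ^ weightExp k i j l) ∧ y' l = n) ∧
      (∀ l : Fin 25, 5 ≤ (l : ℕ) →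
        ∃ n : ℤ, (0 ≤ n ∧ n < (p : ℤ) ^ weightExp k i j l) ∧ z' l = n) ∧
      Set.range (gen x' y' z') = Set.range (gen x y z) := by
  have hp : (p : ℤ_[p]) ≠ 0 := Nat.cast_ne_zero.2 (Fact.out : p.Prime).ne_zero
  have hA := isTriangular_gen h
  let Box : Fin 25 → ℤ_[p] → Prop := fun l r =>
    ∃ n : ℤ, (0 ≤ n ∧ n < (p : ℤ) ^ weightExp k i j l) ∧ r = n
  have hbox : ∀ l : Fin 25, ∀ r : ℤ_[p], ∃ q, Box l (r + weight (x 0) (y 1) (z 2) l * q) :=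
    fun l r => by
      rw [hx, hy, hz, weight_pow]
      simpa [Box] using exists_natCast_eq_add_pow_mul (weightExp k i j l) isUnit_one r
  -- Reduction starts at the coordinate 3 for x but at 5 for y and z, whose coordinates 3 and 4 are
  -- bound by the conditions on diagonal triples.
  obtain ⟨ξ, hξ, hξw, hξb⟩ := hA.exists_forall 3 Box (fun l _ => hbox l) x
  obtain ⟨η, hη, hηw, hηb⟩ := hA.exists_forall 5 Box (fun l _ => hbox l) y
  obtain ⟨ζ, hζ, hζw, hζb⟩ := hA.exists_forall 5 Box (fun l _ => hbox l) z
  obtain ⟨a, ha⟩ : ∃ a : Model ℤ_[p], a = basisVec 0 + ξ := ⟨_, rfl⟩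
  obtain ⟨b, hb⟩ : ∃ b : Model ℤ_[p], b = basisVec 1 + η := ⟨_, rfl⟩
  obtain ⟨c, hc⟩ : ∃ c : Model ℤ_[p], c = basisVec 2 + ζ := ⟨_, rfl⟩
  have hxa : x + (gen x y z).toAddMonoidHom ξ =
      gen x y z a := by
    rw [ha, map_add, gen_zero]
    rfl
  have hyb : y + (gen x y z).toAddMonoidHom η =
      gen x y z b := by
    rw [hb, map_add, gen_one]
    rfl
  have hzc : z + (gen x y z).toAddMonoidHom ζ =
      gen x y z c := by
    rw [hc, map_add, gen_two]
    rfl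
  rw [hxa] at hξw hξb
  rw [hyb] at hηw hηb
  rw [hzc] at hζw hζb
  have a' : ∀ l : Fin 25, (l : ℕ) < 3 → a l = basisVec 0 l := fun l hl => by
    rw [ha, add_apply, hξ l hl, add_zero]
  have b' : ∀ l : Fin 25, (l : ℕ) < 5 → b l = basisVec 1 l := fun l hl => by
    rw [hb, add_apply, hη l hl, add_zero]
  have c' : ∀ l : Fin 25, (l : ℕ) < 5 → c l = basisVec 2 l := fun l hl => by
    rw [hc, add_apply, hζ l hl, add_zero]
  have hd : IsDiagTriple a b c := by
    constructor <;> simp [a', b', c', basisVec_apply]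
  have ha0 : a 0 = 1 := by simp [a', basisVec_apply]
  have hb1 : b 1 = 1 := by simp [b', basisVec_apply]
  have hc2 : c 2 = 1 := by simp [c', basisVec_apply]
  exact ⟨_, _, _, h.comp two_ne_zero hd (by rw [hx]; exact pow_ne_zero _ hp)
    (by rw [hy]; exact pow_ne_zero _ hp) (by rw [hz]; exact pow_ne_zero _ hp)
    (by rw [ha0]; exact one_ne_zero) (by rw [hb1]; exact one_ne_zero)
    (by rw [hc2]; exact one_ne_zero), hξw, hηw, hζw, hξb, hηb, hζb,
    h.range_comp hd (by rw [ha0]; exact isUnit_one) (by rw [hb1]; exact isUnit_one)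
    (by rw [hc2]; exact isUnit_one)⟩

theorem exists_int_cross {k i j : ℕ} {y₃ z₄ : ℤ_[p]}
    (hcross : y₃ * (p : ℤ_[p]) ^ j = z₄ * (p : ℤ_[p]) ^ i)
    (hy : i ≤ j → ∃ n : ℤ, (0 ≤ n ∧ n < (p : ℤ) ^ (i + k)) ∧ y₃ = n)
    (hz : j < i → ∃ n : ℤ, (0 ≤ n ∧ n < (p : ℤ) ^ (j + k)) ∧ z₄ = n) :
    ∃ m n : ℤ, y₃ = m ∧ z₄ = n ∧ (i ≤ j → 0 ≤ m ∧ m < (p : ℤ) ^ (i + k)) ∧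
      (j ≤ i → 0 ≤ n ∧ n < (p : ℤ) ^ (j + k)) := by
  have hp : (p : ℤ_[p]) ≠ 0 := Nat.cast_ne_zero.2 (Fact.out : p.Prime).ne_zero
  rcases lt_trichotomy i j with hij | rfl | hij
  · obtain ⟨m, hm, rfl⟩ := hy hij.le
    obtain ⟨d, rfl⟩ := Nat.exists_eq_add_of_lt hij
    refine ⟨m, m * p ^ (d + 1), rfl, ?_, fun _ => hm, fun h => absurd hij h.not_gt⟩
    apply mul_right_cancel₀ (pow_ne_zero i hp)
    rw [← hcross]
    push_cast
    ring
  · obtain ⟨m, hm, rfl⟩ := hy le_rfl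
    exact ⟨m, m, rfl, (mul_right_cancel₀ (pow_ne_zero i hp) hcross).symm, fun _ => hm, fun _ => hm⟩
  · obtain ⟨m, hm, rfl⟩ := hz hij
    obtain ⟨d, rfl⟩ := Nat.exists_eq_add_of_lt hij
    refine ⟨m * p ^ (d + 1), m, ?_, rfl, fun h => absurd hij h.not_gt, fun _ => hm⟩
    apply mul_right_cancel₀ (pow_ne_zero j hp)
    rw [hcross]
    push_cast
    ring

/-- Every diagonal triple over `ℤ_p` with nonzero diagonal entries generates the same Lie ring as a
reduced triple over `ℤ`. -/
theorem exists_isReduced {x y z : Model ℤ_[p]} (h : IsDiagTriple x y z) (hx : x 0 ≠ 0)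
    (hy : y 1 ≠ 0) (hz : z 2 ≠ 0) : ∃ (k i j : ℕ) (X Y Z : Model ℤ), IsReduced p k i j X Y Z ∧
      Set.range (gen (mapCoeff (Int.castRingHom ℤ_[p]) X)
        (mapCoeff (Int.castRingHom ℤ_[p]) Y) (mapCoeff (Int.castRingHom ℤ_[p]) Z)) =
        Set.range (gen x y z) := by
  obtain ⟨k, i, j, x', y', z', h', hx', hy', hz', h3, h4, hr'⟩ := exists_normalized h hx hy hz
  obtain ⟨x, y, z, h, ex, ey, ez, bx, bY, bz, hr⟩ := exists_box h' hx' hy' hz'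
  rw [← ex 0 (by simp)] at hx'
  rw [← ey 1 (by simp)] at hy'
  rw [← ez 2 (by simp)] at hz'
  rw [← ey 3 (by simp)] at h3
  rw [← ez 4 (by simp)] at h4
  obtain ⟨m, n, em, en, h3, h4⟩ := exists_int_cross (by rw [← hy', ← hz', h.cross]) h3 h4
  obtain ⟨X, rfl⟩ : ∃ X : Model ℤ, mapCoeff (Int.castRingHom ℤ_[p]) X = x := by
    refine exists_mapCoeff_eq fun l => ?_
    rcases lt_or_ge (l : ℕ) 3 with hl | hl
    · obtain rfl | rfl | rfl : l = 0 ∨ l = 1 ∨ l = 2 := by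
        simp only [Fin.ext_iff]; simp; omega
      · exact ⟨p ^ k, by simpa using hx'⟩
      · exact ⟨0, by simpa using h.x1⟩
      · exact ⟨0, by simpa using h.x2⟩
    · exact (bx l hl).imp fun n hn => hn.2
  obtain ⟨Y, rfl⟩ : ∃ X : Model ℤ, mapCoeff (Int.castRingHom ℤ_[p]) X = y := by
    refine exists_mapCoeff_eq fun l => ?_
    rcases lt_or_ge (l : ℕ) 5 with hl | hl
    · obtain rfl | rfl | rfl | rfl | rfl : l = 0 ∨ l = 1 ∨ l = 2 ∨ l = 3 ∨ l = 4 := by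
        simp only [Fin.ext_iff]; simp; omega
      · exact ⟨0, by simpa using h.y0⟩
      · exact ⟨p ^ i, by simpa using hy'⟩
      · exact ⟨0, by simpa using h.y2⟩
      · exact ⟨m, em⟩
      · exact ⟨0, by simpa using h.y4⟩
    · exact (bY l hl).imp fun n hn => hn.2
  obtain ⟨Z, rfl⟩ : ∃ X : Model ℤ, mapCoeff (Int.castRingHom ℤ_[p]) X = z := by
    refine exists_mapCoeff_eq fun l => ?_
    rcases lt_or_ge (l : ℕ) 5 with hl | hl
    · obtain rfl | rfl | rfl | rfl | rfl : l = 0 ∨ l = 1 ∨ l = 2 ∨ l = 3 ∨ l = 4 := by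
        simp only [Fin.ext_iff]; simp; omega
      · exact ⟨0, by simpa using h.z0⟩
      · exact ⟨0, by simpa using h.z1⟩
      · exact ⟨p ^ j, by simpa using hz'⟩
      · exact ⟨0, by simpa using h.z3⟩
      · exact ⟨n, en⟩
    · exact (bz l hl).imp fun n hn => hn.2
  refine ⟨k, i, j, X, Y, Z, ⟨h.of_map (RingHom.injective_int _), ?_, ?_, ?_, fun l hl => ?_,
    fun l hl => ?_, fun l hl => ?_, ?_, ?_⟩, hr.trans hr'⟩
  · exact Int.cast_injective (α := ℤ_[p]) (by simpa using hx')
  · exact Int.cast_injective (α := ℤ_[p]) (by simpa using hy')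
  · exact Int.cast_injective (α := ℤ_[p]) (by simpa using hz')
  · obtain ⟨n, hn, e⟩ := bx l hl
    rwa [Int.cast_injective (α := ℤ_[p]) e]
  · obtain ⟨n, hn, e⟩ := bY l hl
    rwa [Int.cast_injective (α := ℤ_[p]) e]
  · obtain ⟨n, hn, e⟩ := bz l hl
    rwa [Int.cast_injective (α := ℤ_[p]) e]
  · rwa [Int.cast_injective (α := ℤ_[p]) em]
  · rwa [Int.cast_injective (α := ℤ_[p]) en]

end Padic

end Model
end

/-! ### The subgroup of a reduced triple: index and uniqueness -/

noncomputable section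

namespace Model

/-- The endomorphism of the Lie ring `Model R` with given values on the generators. -/
def endo {R : Type*} [CommRing R] {x y z : Model R} (h : Relations x y z) :
    Model R →ₗ⁅ℤ⁆ Model R where
  toFun := gen x y z
  map_add' := map_add _
  map_smul' n v := map_zsmul (gen x y z) n v
  map_lie' := gen_lie h _ _

theorem endo_apply {R : Type*} [CommRing R] {x y z : Model R} (h : Relations x y z)
    (v : Model R) : endo h v = gen x y z v := rfl

end Model

namespace ExpGroup

open Model

theorem ker_map_mapCoeff_castRingHom (N : ℕ) :
    ((map (mapCoeff (Int.castRingHom (ZMod N)))).ker : Set (ExpGroup (Model ℤ))) =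
      of '' Set.range fun v : Model ℤ => N • v := by
  ext g
  obtain ⟨v, rfl⟩ := of.surjective g
  rw [of.injective.mem_set_image]
  constructor
  · intro h
    have h : mapCoeff (Int.castRingHom (ZMod N)) v = 0 := h
    have h' : ∀ i, ∃ n : ℤ, v i = N * n := fun i => by
      have hi : mapCoeff (Int.castRingHom (ZMod N)) v i = 0 := by rw [h, Model.zero_apply]
      exact (ZMod.intCast_zmod_eq_zero_iff_dvd _ N).1 hi
    choose w hw using h'
    refine ⟨w, Model.ext fun i => ?_⟩
    rw [hw i]
    change (N • (w : Model ℤ)) i = _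
    rw [← natCast_zsmul]
    exact zsmul_apply _ _ _
  · rintro ⟨w, rfl⟩
    refine Eq.trans (b := of (mapCoeff (Int.castRingHom (ZMod N)) (N • w))) rfl ?_
    rw [map_nsmul]
    refine congrArg of (Model.ext fun i => ?_)
    rw [← natCast_zsmul, zsmul_apply]
    simp

theorem mapCoeff_surjective {R S : Type*} [CommRing R] [CommRing S] {f : R →+* S}
    (hf : Function.Surjective f) : Function.Surjective (mapCoeff f) := fun v => by
  choose g hg using hf
  exact ⟨fun i => g (v i), Model.ext fun i => hg _⟩

/-- The index of a sublattice that is closed under the group operations is the same in the group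
and in the Lie ring. -/
theorem index_range_map (f : Model ℤ →ₗ⁅ℤ⁆ Model ℤ)
    (hf : (f : Model ℤ →+ Model ℤ).range.index ≠ 0) :
    (map f).range.index = (f : Model ℤ →+ Model ℤ).range.index := by
  obtain ⟨S, hS⟩ : ∃ S, (f : Model ℤ →+ Model ℤ).range = S := ⟨_, rfl⟩
  obtain ⟨N, hN⟩ : ∃ N, S.index = N := ⟨_, rfl⟩
  rw [hS, hN] at hf ⊢
  have : NeZero N := ⟨hf⟩
  have hNS : ∀ v : Model ℤ, N • v ∈ S := fun v => by
    rw [← hN]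
    exact S.nsmul_index_mem v
  let π : Model ℤ →ₗ⁅ℤ⁆ Model (ZMod N) := mapCoeff (Int.castRingHom (ZMod N))
  have hπ : Function.Surjective π := mapCoeff_surjective (ZMod.ringHom_surjective _)
  have hSset : (S : Set (Model ℤ)) = Set.range f := by
    rw [← hS]
    rfl
  have : Finite (Model (ZMod N)) := inferInstanceAs (Finite (Fin 25 → ZMod N))
  have : Finite (ExpGroup (Model (ZMod N))) := this
  have hker : ∀ v : Model ℤ, π v = 0 → v ∈ S := fun v hv => by
    have h : of v ∈ ((map π).ker : Set (ExpGroup (Model ℤ))) := hv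
    rw [ker_map_mapCoeff_castRingHom, of.injective.mem_set_image] at h
    obtain ⟨w, rfl⟩ := h
    exact hNS w
  -- Both subgroups contain the kernel of reduction modulo N, so their indices can be computed in
  -- the finite quotients. There they have the same underlying set.
  have h1 : ((map f).range.map (map π)).index = (map f).range.index := by
    refine Subgroup.index_map_eq _ hπ fun g hg => ?_
    have := hker (of.symm g) hg
    rwa [← SetLike.mem_coe, hSset] at this
  have h2 : (S.map (π : Model ℤ →+ Model (ZMod N))).index = S.index :=
    AddSubgroup.index_map_eq _ hπ fun v hv => hker v hv
  rw [← hN, ← h1, ← h2]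
  have hset : (((map f).range.map (map π) : Subgroup _) : Set (ExpGroup (Model (ZMod N)))) =
      ((S.map (π : Model ℤ →+ Model (ZMod N)) : AddSubgroup _) : Set (Model (ZMod N))) := by
    rw [AddSubgroup.coe_map, hSset]
    rfl
  have hcard : Nat.card ((map f).range.map (map π)) =
      Nat.card (S.map (π : Model ℤ →+ Model (ZMod N))) := Nat.card_congr (Equiv.setCongr hset)
  refine Nat.eq_of_mul_eq_mul_right (Nat.card_pos (α := (map f).range.map (map π))) ?_
  rw [Subgroup.index_mul_card, hcard, AddSubgroup.index_mul_card]
  rfl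

end ExpGroup

namespace Model

variable {p k i j : ℕ} {x y z : Model ℤ}

theorem IsReduced.add_eq (h : IsReduced p k i j x y z) (hp : 1 < p) : i + j = 3 * k := by
  have hc := h.diag.cube
  rw [h.x0, h.y1, h.z2, ← pow_mul, ← pow_add] at hc
  have hc : p ^ (k * 3) = p ^ (i + j) := by exact_mod_cast hc
  have := Nat.pow_right_injective hp hc
  omega

theorem IsReduced.isTriangular (h : IsReduced p k i j x y z) :
    IsTriangular (endo h.diag.relations : Model ℤ →+ Model ℤ)
      fun l => (p : ℤ) ^ weightExp k i j l := by
  have := isTriangular_gen h.diag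
  rw [h.x0, h.y1, h.z2] at this
  intro v l hv
  exact (this v l hv).trans (congrArg (· * v l) (weight_pow _ _ _ _ _))

/-- The subgroup of the group of the model that belongs to a reduced triple. -/
def IsReduced.subgroup (h : IsReduced p k i j x y z) : Subgroup (ExpGroup (Model ℤ)) :=
  (ExpGroup.map (endo h.diag.relations)).range

theorem IsReduced.mem_subgroup (h : IsReduced p k i j x y z) (v : Model ℤ) :
    ExpGroup.of v ∈ h.subgroup ↔ v ∈ Set.range (gen x y z) := Iff.rfl

theorem IsReduced.injective (h : IsReduced p k i j x y z) (hp : 1 < p) :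
    Function.Injective (gen x y z) :=
  h.isTriangular.injective fun _ => pow_ne_zero _ (by exact_mod_cast (by omega : p ≠ 0))

/-- The sum is the exponent of p in the determinant of the endomorphism, hence in the index. -/
theorem sum_weightExp (h : i + j = 3 * k) : ∑ l, weightExp k i j l = 102 * k := by
  have e : ∑ l, weightExp k i j l = 33 * k + 23 * (i + j) := by
    simp only [weightExp, Fin.sum_univ_succ, Matrix.cons_val_zero, Matrix.cons_val_succ,
      Fin.sum_univ_zero]
    ring
  rw [e, h]
  ring

theorem IsReduced.index_subgroup (h : IsReduced p k i j x y z) (hp : 1 < p) :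
    h.subgroup.index = p ^ (102 * k) := by
  have hp0 : (p : ℤ) ≠ 0 := by exact_mod_cast (by omega : p ≠ 0)
  have hi : (endo h.diag.relations : Model ℤ →+ Model ℤ).range.index = p ^ (102 * k) := by
    rw [h.isTriangular.index_range fun _ => pow_ne_zero _ hp0, Finset.prod_pow_eq_pow_sum,
      sum_weightExp (h.add_eq hp), Int.natAbs_pow, Int.natAbs_natCast]
  rw [← hi]
  exact ExpGroup.index_range_map _ (by rw [hi]; positivity)

theorem IsReduced.proIsomorphic_subgroup (h : IsReduced p k i j x y z) (hp : 1 < p) :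
    ProIsomorphic h.subgroup (ExpGroup (Model ℤ)) :=
  proIsomorphic_of_mulEquiv (MonoidHom.ofInjective
    (f := ExpGroup.map (endo h.diag.relations)) (h.injective hp)).symm

section Unique

variable {k' i' j' : ℕ} {x' y' z' : Model ℤ}

/-- The triple a, b, c is the quotient of the two endomorphisms. It satisfies the relations because
the larger endomorphism is injective, and rigidity makes it diagonal. -/
theorem IsReduced.exists_of_range_subset (h : IsReduced p k i j x y z)
    (h' : IsReduced p k' i' j' x' y' z') (hp : 1 < p)
    (hr : Set.range (gen x' y' z') ⊆ Set.range (gen x y z)) :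
    ∃ a b c : Model ℤ, IsDiagTriple a b c ∧ gen x y z a = x' ∧ gen x y z b = y' ∧
      gen x y z c = z' := by
  have hp0 : ∀ n, (p : ℤ) ^ n ≠ 0 := fun n => pow_ne_zero n (by exact_mod_cast (by omega : p ≠ 0))
  obtain ⟨a, ha⟩ := hr ⟨basisVec 0, gen_zero x' y' z'⟩
  obtain ⟨b, hb⟩ := hr ⟨basisVec 1, gen_one x' y' z'⟩
  obtain ⟨c, hc⟩ := hr ⟨basisVec 2, gen_two x' y' z'⟩
  have hx := h.x0
  have hy := h.y1
  have hz := h.z2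
  have hrel : Relations a b c := by
    have hl := gen_lie h.diag.relations
    constructor <;> apply h.injective hp
    · simp only [hl, ha, hb, hc, h'.diag.relations.one]
    · simp only [hl, ha, hb, hc, h'.diag.relations.two]
  have a0 : a 0 ≠ 0 := fun e => hp0 k' (by
    rw [← h'.x0, ← ha, h.diag.gen_apply_zero, e, zero_mul])
  have a1 : a 1 = 0 := by
    have := h'.diag.x1
    rw [← ha, h.diag.gen_apply_one, hy] at this
    exact (mul_eq_zero.1 this).resolve_right (hp0 _)
  have a2 : a 2 = 0 := by
    have := h'.diag.x2
    rw [← ha, h.diag.gen_apply_two, hz] at this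
    exact (mul_eq_zero.1 this).resolve_right (hp0 _)
  have b1 : b 1 ≠ 0 := fun e => hp0 i' (by
    rw [← h'.y1, ← hb, h.diag.gen_apply_one, e, zero_mul])
  have b2 : b 2 = 0 := by
    have := h'.diag.y2
    rw [← hb, h.diag.gen_apply_two, hz] at this
    exact (mul_eq_zero.1 this).resolve_right (hp0 _)
  have c2 : c 2 ≠ 0 := fun e => hp0 j' (by
    rw [← h'.z2, ← hc, h.diag.gen_apply_two, e, zero_mul])
  refine ⟨a, b, c, hrel.isDiagTriple_of_ne_zero two_ne_zero ?_ b1, ha, hb, hc⟩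
  rw [linDet, a1, a2, b2]
  simp [a0, b1, c2]

theorem IsReduced.le_of_range_subset (h : IsReduced p k i j x y z)
    (h' : IsReduced p k' i' j' x' y' z') (hp : 1 < p)
    (hr : Set.range (gen x' y' z') ⊆ Set.range (gen x y z)) :
    k ≤ k' ∧ i ≤ i' ∧ j ≤ j' := by
  obtain ⟨a, b, c, -, rfl, rfl, rfl⟩ := h.exists_of_range_subset h' hp hr
  have hx := h'.x0
  have hy := h'.y1
  have hz := h'.z2
  rw [h.diag.gen_apply_zero, h.x0] at hx
  rw [h.diag.gen_apply_one, h.y1] at hy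
  rw [h.diag.gen_apply_two, h.z2] at hz
  have key : ∀ m n : ℕ, (p : ℤ) ^ m ∣ (p : ℤ) ^ n → m ≤ n := fun m n hmn =>
    (Nat.pow_dvd_pow_iff_le_right hp).1 (by exact_mod_cast hmn)
  exact ⟨key _ _ (hx ▸ dvd_mul_left _ _), key _ _ (hy ▸ dvd_mul_left _ _),
    key _ _ (hz ▸ dvd_mul_left _ _)⟩

theorem eq_zero_of_mem_Ico {d m s : ℤ} (hm : 0 ≤ m ∧ m < d) (hms : 0 ≤ m + s * d ∧ m + s * d < d) :
    s = 0 := by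
  have h1 : s < 1 := by
    by_contra! h
    nlinarith
  have h2 : -1 < s := by
    by_contra! h
    nlinarith
  omega

/-- Different reduced triples generate different Lie rings. -/
theorem IsReduced.unique (h : IsReduced p k i j x y z) (h' : IsReduced p k' i' j' x' y' z')
    (hp : 1 < p)
    (hr : Set.range (gen x y z) = Set.range (gen x' y' z')) :
    k = k' ∧ i = i' ∧ j = j' ∧ x = x' ∧ y = y' ∧ z = z' := by
  obtain ⟨rfl, rfl, rfl⟩ : k = k' ∧ i = i' ∧ j = j' := by
    obtain ⟨h1, h2, h3⟩ := h.le_of_range_subset h' hp hr.ge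
    obtain ⟨h4, h5, h6⟩ := h'.le_of_range_subset h hp hr.le
    exact ⟨le_antisymm h1 h4, le_antisymm h2 h5, le_antisymm h3 h6⟩
  have hp0 : ∀ n, (p : ℤ) ^ n ≠ 0 := fun n => pow_ne_zero n (by exact_mod_cast (by omega : p ≠ 0))
  obtain ⟨a, b, c, hd, rfl, rfl, rfl⟩ := h.exists_of_range_subset h' hp hr.ge
  have a0 : a 0 = 1 := by
    have := h'.x0
    rw [h.diag.gen_apply_zero, h.x0] at this
    exact mul_right_cancel₀ (hp0 _) (this.trans (one_mul _).symm)
  have b1 : b 1 = 1 := by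
    have := h'.y1
    rw [h.diag.gen_apply_one, h.y1] at this
    exact mul_right_cancel₀ (hp0 _) (this.trans (one_mul _).symm)
  have c2 : c 2 = 1 := by
    have := h'.z2
    rw [h.diag.gen_apply_two, h.z2] at this
    exact mul_right_cancel₀ (hp0 _) (this.trans (one_mul _).symm)
  have hbc : b 3 = c 4 := by
    have := hd.cross
    rwa [b1, c2, mul_one, mul_one] at this
  -- By the cross relation the two linked coefficients are shifted by the same parameter, up to
  -- powers of p; the box for the one with the smaller exponent forces the parameter to be zero.
  have b3 : b 3 = 0 := by
    rcases le_total i j with hij | hij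
    · have := h'.y3_box hij
      rw [h.diag.gen_apply_three, hd.y0, b1, h.x0, h.y1, zero_mul, one_mul, zero_add,
        ← pow_add] at this
      exact eq_zero_of_mem_Ico (h.y3_box hij) this
    · have := h'.z4_box hij
      rw [h.diag.gen_apply_four, hd.z0, c2, h.x0, h.z2, zero_mul, one_mul, zero_add,
        ← pow_add] at this
      rw [hbc]
      exact eq_zero_of_mem_Ico (h.z4_box hij) this
  have c4 : c 4 = 0 := hbc ▸ b3
  have hA := h.isTriangular
  have hax : gen x y z a = x + endo h.diag.relations (a - basisVec 0) := by
    rw [endo_apply, map_sub, gen_zero, add_sub_cancel]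
  have hby : gen x y z b = y + endo h.diag.relations (b - basisVec 1) := by
    rw [endo_apply, map_sub, gen_one, add_sub_cancel]
  have hcz : gen x y z c = z + endo h.diag.relations (c - basisVec 2) := by
    rw [endo_apply, map_sub, gen_two, add_sub_cancel]
  have ha : a - basisVec 0 = 0 := by
    refine hA.eq_zero_of_mem_box 3 (fun l hl => ?_) h.x_box (hax ▸ h'.x_box)
    obtain rfl | rfl | rfl : l = 0 ∨ l = 1 ∨ l = 2 := by
      simp only [Fin.ext_iff]; simp; omega
    all_goals simp [basisVec_apply, a0, hd.x1, hd.x2]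
  have hb : b - basisVec 1 = 0 := by
    refine hA.eq_zero_of_mem_box 5 (fun l hl => ?_) h.y_box (hby ▸ h'.y_box)
    obtain rfl | rfl | rfl | rfl | rfl : l = 0 ∨ l = 1 ∨ l = 2 ∨ l = 3 ∨ l = 4 := by
      simp only [Fin.ext_iff]; simp; omega
    all_goals simp [basisVec_apply, b1, b3, hd.y0, hd.y2, hd.y4]
  have hc : c - basisVec 2 = 0 := by
    refine hA.eq_zero_of_mem_box 5 (fun l hl => ?_) h.z_box (hcz ▸ h'.z_box)
    obtain rfl | rfl | rfl | rfl | rfl : l = 0 ∨ l = 1 ∨ l = 2 ∨ l = 3 ∨ l = 4 := by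
      simp only [Fin.ext_iff]; simp; omega
    all_goals simp [basisVec_apply, c2, c4, hd.z0, hd.z1, hd.z3]
  refine ⟨rfl, rfl, rfl, ?_, ?_, ?_⟩
  · rw [hax, ha, map_zero, add_zero]
  · rw [hby, hb, map_zero, add_zero]
  · rw [hcz, hc, map_zero, add_zero]

end Unique

end Model
end

/-! ### Counting reduced triples -/

noncomputable section

namespace Model

section Count

variable (p k i j : ℕ)

/-- The ranges of the coordinates of the first entry of a reduced triple. -/
def xBox (l : Fin 25) : Finset ℤ :=
  if l = 0 then {(p : ℤ) ^ k} else if (l : ℕ) < 3 then {0} else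
    Finset.Ico 0 ((p : ℤ) ^ weightExp k i j l)

/-- The ranges of the coordinates of the second entry of a reduced triple. -/
def yBox (s : ℤ) (l : Fin 25) : Finset ℤ :=
  if l = 1 then {(p : ℤ) ^ i} else if l = 3 then {s} else if (l : ℕ) < 5 then {0} else
    Finset.Ico 0 ((p : ℤ) ^ weightExp k i j l)

/-- The ranges of the coordinates of the third entry of a reduced triple. -/
def zBox (s : ℤ) (l : Fin 25) : Finset ℤ :=
  if l = 2 then {(p : ℤ) ^ j} else if l = 4 then {s} else if (l : ℕ) < 5 then {0} else
    Finset.Ico 0 ((p : ℤ) ^ weightExp k i j l)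

/-- The reduced triples. -/
def reducedTriples : Finset ((Fin 25 → ℤ) × (Fin 25 → ℤ) × (Fin 25 → ℤ)) :=
  (Finset.Ico (0 : ℤ) ((p : ℤ) ^ (min i j + k))).biUnion fun s =>
    Fintype.piFinset (xBox p k i j) ×ˢ Fintype.piFinset (yBox p k i j (s * p ^ (i - j))) ×ˢ
      Fintype.piFinset (zBox p k i j (s * p ^ (j - i)))

variable {p k i j}

theorem mem_xBox (x : Fin 25 → ℤ) : x ∈ Fintype.piFinset (xBox p k i j) ↔
    x 0 = (p : ℤ) ^ k ∧ x 1 = 0 ∧ x 2 = 0 ∧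
      ∀ l : Fin 25, 3 ≤ (l : ℕ) → 0 ≤ x l ∧ x l < (p : ℤ) ^ weightExp k i j l := by
  rw [Fintype.mem_piFinset]
  constructor
  · intro h
    refine ⟨by simpa [xBox] using h 0, by simpa [xBox] using h 1, by simpa [xBox] using h 2,
      fun l hl => ?_⟩
    have := h l
    rw [xBox, if_neg (by rintro rfl; simp at hl), if_neg (by omega), Finset.mem_Ico] at this
    exact this
  · rintro ⟨h0, h1, h2, h⟩ l
    rcases lt_or_ge (l : ℕ) 3 with hl | hl
    · obtain rfl | rfl | rfl : l = 0 ∨ l = 1 ∨ l = 2 := by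
        simp only [Fin.ext_iff]; simp; omega
      all_goals simp [xBox, h0, h1, h2]
    · rw [xBox, if_neg (by rintro rfl; simp at hl), if_neg (by omega), Finset.mem_Ico]
      exact h l hl

theorem mem_yBox (s : ℤ) (y : Fin 25 → ℤ) : y ∈ Fintype.piFinset (yBox p k i j s) ↔
    y 0 = 0 ∧ y 1 = (p : ℤ) ^ i ∧ y 2 = 0 ∧ y 3 = s ∧ y 4 = 0 ∧
      ∀ l : Fin 25, 5 ≤ (l : ℕ) → 0 ≤ y l ∧ y l < (p : ℤ) ^ weightExp k i j l := by
  rw [Fintype.mem_piFinset]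
  constructor
  · intro h
    refine ⟨by simpa [yBox] using h 0, by simpa [yBox] using h 1, by simpa [yBox] using h 2,
      by simpa [yBox] using h 3, by simpa [yBox] using h 4, fun l hl => ?_⟩
    have := h l
    rw [yBox, if_neg (by rintro rfl; simp at hl), if_neg (by rintro rfl; simp at hl),
      if_neg (by omega), Finset.mem_Ico] at this
    exact this
  · rintro ⟨h0, h1, h2, h3, h4, h⟩ l
    rcases lt_or_ge (l : ℕ) 5 with hl | hl
    · obtain rfl | rfl | rfl | rfl | rfl : l = 0 ∨ l = 1 ∨ l = 2 ∨ l = 3 ∨ l = 4 := by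
        simp only [Fin.ext_iff]; simp; omega
      all_goals simp [yBox, h0, h1, h2, h3, h4]
    · rw [yBox, if_neg (by rintro rfl; simp at hl), if_neg (by rintro rfl; simp at hl),
        if_neg (by omega), Finset.mem_Ico]
      exact h l hl

theorem mem_zBox (s : ℤ) (z : Fin 25 → ℤ) : z ∈ Fintype.piFinset (zBox p k i j s) ↔
    z 0 = 0 ∧ z 1 = 0 ∧ z 2 = (p : ℤ) ^ j ∧ z 3 = 0 ∧ z 4 = s ∧
      ∀ l : Fin 25, 5 ≤ (l : ℕ) → 0 ≤ z l ∧ z l < (p : ℤ) ^ weightExp k i j l := by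
  rw [Fintype.mem_piFinset]
  constructor
  · intro h
    refine ⟨by simpa [zBox] using h 0, by simpa [zBox] using h 1, by simpa [zBox] using h 2,
      by simpa [zBox] using h 3, by simpa [zBox] using h 4, fun l hl => ?_⟩
    have := h l
    rw [zBox, if_neg (by rintro rfl; simp at hl), if_neg (by rintro rfl; simp at hl),
      if_neg (by omega), Finset.mem_Ico] at this
    exact this
  · rintro ⟨h0, h1, h2, h3, h4, h⟩ l
    rcases lt_or_ge (l : ℕ) 5 with hl | hl
    · obtain rfl | rfl | rfl | rfl | rfl : l = 0 ∨ l = 1 ∨ l = 2 ∨ l = 3 ∨ l = 4 := by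
        simp only [Fin.ext_iff]; simp; omega
      all_goals simp [zBox, h0, h1, h2, h3, h4]
    · rw [zBox, if_neg (by rintro rfl; simp at hl), if_neg (by rintro rfl; simp at hl),
        if_neg (by omega), Finset.mem_Ico]
      exact h l hl

/-- The integral solutions of the cross relation are the multiples of the primitive pair (p^(i-j),
p^(j-i)), where truncated subtraction makes one exponent zero. The box for the smaller coefficient
becomes a bound p^(min i j + k) for the multiplier s. -/
theorem exists_cross_iff (hp : 1 < p) {y₃ z₄ : ℤ} :
    (∃ s : ℤ, (0 ≤ s ∧ s < (p : ℤ) ^ (min i j + k)) ∧ y₃ = s * p ^ (i - j) ∧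
      z₄ = s * p ^ (j - i)) ↔
    y₃ * (p : ℤ) ^ j = z₄ * (p : ℤ) ^ i ∧ (i ≤ j → 0 ≤ y₃ ∧ y₃ < (p : ℤ) ^ (i + k)) ∧
      (j ≤ i → 0 ≤ z₄ ∧ z₄ < (p : ℤ) ^ (j + k)) := by
  have hp0 : (p : ℤ) ≠ 0 := by exact_mod_cast (by omega : p ≠ 0)
  constructor
  · rintro ⟨s, hs, rfl, rfl⟩
    refine ⟨?_, fun hij => ?_, fun hij => ?_⟩
    · rw [mul_assoc, mul_assoc, ← pow_add, ← pow_add]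
      congr 2
      omega
    · rwa [Nat.sub_eq_zero_of_le hij, pow_zero, mul_one, ← min_eq_left hij]
    · rwa [Nat.sub_eq_zero_of_le hij, pow_zero, mul_one, ← min_eq_right hij]
  · rintro ⟨hc, hy, hz⟩
    rcases le_total i j with hij | hij
    · refine ⟨y₃, by rw [min_eq_left hij]; exact hy hij, ?_, ?_⟩
      · rw [Nat.sub_eq_zero_of_le hij, pow_zero, mul_one]
      · refine mul_right_cancel₀ (pow_ne_zero i hp0) ?_
        rw [← hc, mul_assoc, ← pow_add, Nat.sub_add_cancel hij]
    · refine ⟨z₄, by rw [min_eq_right hij]; exact hz hij, ?_, ?_⟩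
      · refine mul_right_cancel₀ (pow_ne_zero j hp0) ?_
        rw [hc, mul_assoc, ← pow_add, Nat.sub_add_cancel hij]
      · rw [Nat.sub_eq_zero_of_le hij, pow_zero, mul_one]

theorem mem_reducedTriples (hp : 1 < p) (hij : i + j = 3 * k)
    (T : (Fin 25 → ℤ) × (Fin 25 → ℤ) × (Fin 25 → ℤ)) :
    T ∈ reducedTriples p k i j ↔ IsReduced p k i j T.1 T.2.1 T.2.2 := by
  obtain ⟨x, y, z⟩ := T
  simp only [reducedTriples, Finset.mem_biUnion, Finset.mem_product, mem_xBox, mem_yBox, mem_zBox,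
    Finset.mem_Ico]
  constructor
  · rintro ⟨s, hs, ⟨x0, x1, x2, x⟩, ⟨y0, y1, y2, y3, y4, y⟩, z0, z1, z2, z3, z4, z⟩
    obtain ⟨hc, h3, h4⟩ := (exists_cross_iff hp).1 ⟨s, hs, y3, z4⟩
    exact ⟨⟨x1, x2, y0, y2, y4, z0, z1, z3, by rw [x0, y1, z2, ← pow_mul, ← pow_add, hij, mul_comm],
      by rw [y1, z2, hc]⟩, x0, y1, z2, x, y, z, h3, h4⟩
  · intro h
    obtain ⟨s, hs, h3, h4⟩ := (exists_cross_iff hp).2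
      ⟨by rw [← h.z2, ← h.y1, h.diag.cross], h.y3_box, h.z4_box⟩
    exact ⟨s, hs, ⟨h.x0, h.diag.x1, h.diag.x2, h.x_box⟩,
      ⟨h.diag.y0, h.y1, h.diag.y2, h3, h.diag.y4, h.y_box⟩,
      h.diag.z0, h.diag.z1, h.z2, h.diag.z3, h4, h.z_box⟩

theorem card_Ico_pow (e : ℕ) : (Finset.Ico (0 : ℤ) ((p : ℤ) ^ e)).card = p ^ e := by
  rw [Int.card_Ico, sub_zero, ← Nat.cast_pow, Int.toNat_natCast]

theorem card_xBox (hij : i + j = 3 * k) :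
    (Fintype.piFinset (xBox p k i j)).card = p ^ (98 * k) := by
  have h : ∀ l, (xBox p k i j l).card = p ^ (if (l : ℕ) < 3 then 0 else weightExp k i j l) := by
    intro l
    unfold xBox
    split_ifs with h1 h2 h3
    · simp
    · subst h1; simp at h2
    · simp
    · exact card_Ico_pow _
  rw [Fintype.card_piFinset, Finset.prod_congr rfl fun l _ => h l, Finset.prod_pow_eq_pow_sum]
  have e : ∑ l : Fin 25, (if (l : ℕ) < 3 then 0 else weightExp k i j l) =
      32 * k + 22 * (i + j) := by
    simp only [Fin.sum_univ_succ, weightExp, Matrix.cons_val_zero, Matrix.cons_val_succ,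
      Fin.sum_univ_zero, Fin.val_zero, Fin.val_succ, zero_add, Nat.reduceAdd, Nat.reduceLT,
      Nat.lt_irrefl, if_true, if_false, Nat.zero_lt_succ]
    ring
  rw [e, hij, show 32 * k + 22 * (3 * k) = 98 * k by ring]

theorem sum_weightExp_ge_five : ∑ l : Fin 25, (if (l : ℕ) < 5 then 0 else weightExp k i j l) =
      30 * k + 21 * (i + j) := by
  simp only [Fin.sum_univ_succ, weightExp, Matrix.cons_val_zero, Matrix.cons_val_succ,
    Fin.sum_univ_zero, Fin.val_zero, Fin.val_succ, zero_add, Nat.reduceAdd, Nat.reduceLT,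
    Nat.lt_irrefl, if_true, if_false, Nat.zero_lt_succ]
  ring

theorem card_yBox (hij : i + j = 3 * k) (s : ℤ) :
    (Fintype.piFinset (yBox p k i j s)).card = p ^ (93 * k) := by
  have h : ∀ l, (yBox p k i j s l).card = p ^ (if (l : ℕ) < 5 then 0 else weightExp k i j l) := by
    intro l
    unfold yBox
    split_ifs with h1 h2 h3 h4
    · simp
    · subst h1; simp at h2
    · simp
    · subst h3; simp at h4
    · simp
    · exact card_Ico_pow _
  rw [Fintype.card_piFinset, Finset.prod_congr rfl fun l _ => h l, Finset.prod_pow_eq_pow_sum]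
  rw [sum_weightExp_ge_five, hij, show 30 * k + 21 * (3 * k) = 93 * k by ring]

theorem card_zBox (hij : i + j = 3 * k) (s : ℤ) :
    (Fintype.piFinset (zBox p k i j s)).card = p ^ (93 * k) := by
  have h : ∀ l, (zBox p k i j s l).card = p ^ (if (l : ℕ) < 5 then 0 else weightExp k i j l) := by
    intro l
    unfold zBox
    split_ifs with h1 h2 h3 h4
    · simp
    · subst h1; simp at h2
    · simp
    · subst h3; simp at h4
    · simp
    · exact card_Ico_pow _
  rw [Fintype.card_piFinset, Finset.prod_congr rfl fun l _ => h l, Finset.prod_pow_eq_pow_sum]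
  rw [sum_weightExp_ge_five, hij, show 30 * k + 21 * (3 * k) = 93 * k by ring]

/-- The exponents are 98k for x, 93k for each of y and z, and min i j + k for the common parameter
s, which is recovered from y 3. -/
theorem card_reducedTriples (hp : 1 < p) (hij : i + j = 3 * k) :
    (reducedTriples p k i j).card = p ^ (285 * k + min i j) := by
  have hp0 : (p : ℤ) ≠ 0 := by exact_mod_cast (by omega : p ≠ 0)
  rw [reducedTriples, Finset.card_biUnion, Finset.sum_congr rfl fun s _ => by
    rw [Finset.card_product, Finset.card_product, card_xBox hij, card_yBox hij, card_zBox hij],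
    Finset.sum_const, card_Ico_pow, smul_eq_mul]
  · ring
  · intro s _ s' _ hss
    rw [Function.onFun, Finset.disjoint_left]
    rintro ⟨x, y, z⟩ h h'
    simp only [Finset.mem_product, mem_yBox, mem_zBox] at h h'
    apply hss
    have hy := h.2.1.2.2.2.1.symm.trans h'.2.1.2.2.2.1
    exact mul_right_cancel₀ (pow_ne_zero _ hp0) hy

theorem card_isReduced (hp : 1 < p) (hij : i + j = 3 * k) :
    Nat.card {T : Model ℤ × Model ℤ × Model ℤ // IsReduced p k i j T.1 T.2.1 T.2.2} =
      p ^ (285 * k + min i j) := by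
  rw [← card_reducedTriples hp hij, ← Nat.card_eq_finsetCard]
  exact Nat.card_congr (Equiv.subtypeEquivRight fun T => (mem_reducedTriples hp hij T).symm)

end Count

end Model
end

/-! ### From pro-isomorphic subgroups to reduced triples -/

noncomputable section

namespace Model

theorem mapCoeff_smul {R S : Type*} [CommRing R] [CommRing S] (f : R →+* S) (r : R)
    (v : Model R) : mapCoeff f (r • v) = f r • mapCoeff f v :=
  ext fun i => by
    rw [mapCoeff_apply, smul_apply, map_mul, smul_apply, mapCoeff_apply]

theorem map_gen_of_semilinear {R S : Type*} [CommRing R] [CommRing S] (σ : R →+* S)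
    (f : Model R →+ Model S) (hf : ∀ (r : R) (v : Model R), f (r • v) = σ r • f v)
    (hl : ∀ u v, f ⁅u, v⁆ = ⁅f u, f v⁆)
    (x y z v : Model R) : f (gen x y z v) = gen (f x) (f y) (f z) (mapCoeff σ v) := by
  simp only [gen, liftLinear, LinearMap.coe_mk, AddHom.coe_mk, map_add, hf, hl,
    mapCoeff_apply]

theorem mapCoeff_gen {R S : Type*} [CommRing R] [CommRing S] (f : R →+* S) (x y z v : Model R) :
    mapCoeff f (gen x y z v) =
      gen (mapCoeff f x) (mapCoeff f y) (mapCoeff f z) (mapCoeff f v) := by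
  simp only [gen, liftLinear, LinearMap.coe_mk, AddHom.coe_mk, map_add, mapCoeff_smul,
    LieHom.map_lie, mapCoeff_apply]

theorem gen_basisVec {R : Type*} [CommRing R] (v : Model R) :
    gen (basisVec 0) (basisVec 1) (basisVec 2) v = v := liftLinear_basisVec v

/-- A homomorphism from the Lie ring `Model ℤ` is determined by the images of the generators. -/
theorem map_eq_gen {S : Type*} [CommRing S] (f : Model ℤ →+ Model S)
    (hl : ∀ u v, f ⁅u, v⁆ = ⁅f u, f v⁆) (v : Model ℤ) :
    f v = gen (f (basisVec 0)) (f (basisVec 1)) (f (basisVec 2))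
      (mapCoeff (Int.castRingHom S) v) := by
  have h1 : gen (basisVec 0) (basisVec 1) (basisVec 2) v = v := gen_basisVec v
  have h := map_gen_of_semilinear (Int.castRingHom S) f (x := basisVec 0) (y := basisVec 1)
    (z := basisVec 2) (v := v) (hl := hl)
  rw [h1] at h
  rw [h fun n w => map_intCast_smul f ℤ S n w]

theorem exists_padic_limit {p : ℕ} [Fact p.Prime] (a : ∀ n, Model (ZMod (p ^ n)))
    (ha : ∀ n, mapCoeff (ZMod.castHom (pow_dvd_pow p n.le_succ) (ZMod (p ^ n))) (a (n + 1)) = a n) :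
    ∃ x : Model ℤ_[p], ∀ n, mapCoeff (PadicInt.toZModPow n) x = a n := by
  have hp : ∀ n, NeZero (p ^ n) := fun n => ⟨pow_ne_zero _ (Fact.out : p.Prime).ne_zero⟩
  have key : ∀ i : Fin 25, ∃ r : ℤ_[p], ∀ n, PadicInt.toZModPow n r = a n i := fun i => by
    have hs : ∀ n, (p : ℤ) ^ n ∣ ((a (n + 1) i).val : ℤ) - ((a n i).val : ℤ) := fun n => by
      have h : ZMod.castHom (pow_dvd_pow p n.le_succ) (ZMod (p ^ n)) (a (n + 1) i) = a n i := by
        conv_rhs => rw [← ha n]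
        rfl
      have := (ZMod.intCast_zmod_eq_zero_iff_dvd
        (((a (n + 1) i).val : ℤ) - ((a n i).val : ℤ)) (p ^ n)).1 (by
          push_cast
          rw [ZMod.natCast_zmod_val, sub_eq_zero, ← h, ZMod.natCast_val]
          rfl)
      exact_mod_cast this
    refine ⟨_, fun n => (PadicInt.toZModPow_ofIntSeq_of_pow_dvd_sub
      (fun n => ((a n i).val : ℤ)) p hs n).trans ?_⟩
    rw [Int.cast_natCast, ZMod.natCast_zmod_val]
  choose x hx using key
  exact ⟨x, fun n => ext fun i => hx i n⟩

theorem ext_toZModPow {p : ℕ} [Fact p.Prime] {u v : Model ℤ_[p]}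
    (h : ∀ n, mapCoeff (PadicInt.toZModPow n) u = mapCoeff (PadicInt.toZModPow n) v) : u = v :=
  ext fun i => PadicInt.ext_of_toZModPow.1 fun n => by
    rw [← mapCoeff_apply, h n, mapCoeff_apply]

theorem relations_of_toZModPow {p : ℕ} [Fact p.Prime] {x y z : Model ℤ_[p]}
    (h : ∀ n, Relations (mapCoeff (PadicInt.toZModPow n) x) (mapCoeff (PadicInt.toZModPow n) y)
      (mapCoeff (PadicInt.toZModPow n) z)) : Relations x y z :=
  ⟨ext_toZModPow fun n => by simp only [LieHom.map_lie, (h n).one],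
    ext_toZModPow fun n => by simp only [LieHom.map_lie, (h n).two]⟩

theorem relations_basisVec {R : Type*} [CommRing R] :
    Relations (basisVec 0 : Model R) (basisVec 1) (basisVec 2) :=
  ⟨basisVec_relation_one, basisVec_relation_two⟩

theorem range_gen_swap {R : Type*} [CommRing R] {x y z : Model R} (h : Relations x y z) :
    Set.range (gen x z y) = Set.range (gen x y z) := by
  have key : ∀ {y z : Model R}, Relations x y z → Set.range (gen x z y) ⊆ Set.range (gen x y z) := by
    rintro y z h _ ⟨v, rfl⟩
    refine ⟨gen (basisVec 0) (basisVec 2) (basisVec 1) v, ?_⟩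
    rw [map_gen _ (gen_lie h), gen_zero, gen_one, gen_two]
  exact (key h).antisymm (key h.swap)

theorem linDet_gen {R : Type*} [CommRing R] (x y z a b c : Model R) :
    linDet (gen x y z a) (gen x y z b) (gen x y z c) = linDet a b c * linDet x y z := by
  have h0 : ∀ v, gen x y z v 0 = v 0 * x 0 + v 1 * y 0 + v 2 * z 0 := fun v => by
    simp [gen, liftLinear, -lie_skew, -lie_lie]
  have h1 : ∀ v, gen x y z v 1 = v 0 * x 1 + v 1 * y 1 + v 2 * z 1 := fun v => by
    simp [gen, liftLinear, -lie_skew, -lie_lie]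
  have h2 : ∀ v, gen x y z v 2 = v 0 * x 2 + v 1 * y 2 + v 2 * z 2 := fun v => by
    simp [gen, liftLinear, -lie_skew, -lie_lie]
  simp only [linDet, h0, h1, h2]
  ring

end Model

namespace ExpGroup

open Model

variable {N : ℕ}

theorem exp_pow_eq_one (g : ExpGroup (Model (ZMod N))) : g ^ N = 1 := by
  obtain ⟨v, rfl⟩ := of.surjective g
  rw [of_pow, ← of_zero]
  refine congrArg of (Model.ext fun i => ?_)
  rw [zsmul_apply, Model.zero_apply]
  simp

/-- A homomorphism from the group of `Model ℤ` to that of `Model (ZMod N)`, where `N` is coprime to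
`6`, is a homomorphism of Lie rings. -/
theorem exists_lieHom (hN : Nat.Coprime 24 N) (F : ExpGroup (Model ℤ) →* ExpGroup (Model (ZMod N))) :
    ∃ f : Model ℤ →+ Model (ZMod N), (∀ u v, f ⁅u, v⁆ = ⁅f u, f v⁆) ∧ ∀ v, of (f v) = F (of v) := by
  let π : Model ℤ →ₗ⁅ℤ⁆ Model (ZMod N) := mapCoeff (Int.castRingHom (ZMod N))
  have hπ' : Function.Surjective π := mapCoeff_surjective (ZMod.ringHom_surjective _)
  have hπ : Function.Surjective (map π) := hπ'
  -- The kernel of reduction consists of N-th powers, which die in a group of exponent dividing N.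
  -- So F factors through the group over `ZMod N`, where 24 is invertible.
  have hker : (map π).ker ≤ F.ker := fun g hg => by
    have hg' : g ∈ ((map π).ker : Set (ExpGroup (Model ℤ))) := hg
    rw [ker_map_mapCoeff_castRingHom] at hg'
    obtain ⟨_, ⟨w, rfl⟩, rfl⟩ := hg'
    have e : of (N • w) = of w ^ N := by rw [of_pow, natCast_zsmul]
    rw [MonoidHom.mem_ker]
    simp only [e]
    rw [map_pow, exp_pow_eq_one]
  let G := (map π).liftOfSurjective hπ ⟨F, hker⟩
  obtain ⟨c, hc⟩ : ∃ c : ℤ, ∀ v : Model (ZMod N), (c * 24) • v = v := by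
    have h := Int.gcd_eq_gcd_ab 24 N
    have h24 : Int.gcd 24 N = 1 := hN
    refine ⟨Int.gcdA 24 N, fun v => Model.ext fun i => ?_⟩
    rw [zsmul_apply]
    have h' := congrArg (fun n : ℤ => (n : ZMod N)) h
    simp only [h24, Int.cast_add, Int.cast_mul, Int.cast_natCast, ZMod.natCast_self, zero_mul,
      add_zero] at h'
    rw [Int.cast_mul, mul_comm (_ : ZMod N) ((24 : ℤ) : ZMod N), ← h']
    simp
  refine ⟨((toLieHom G hc hc).comp π : Model ℤ →ₗ⁅ℤ⁆ Model (ZMod N)),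
    LieHom.map_lie ((toLieHom G hc hc).comp π), fun v => ?_⟩
  have := (map π).liftOfRightInverse_comp_apply _ (Function.rightInverse_surjInv hπ) ⟨F, hker⟩ (of v)
  exact this

/-- Such a subgroup contains the kernel of reduction modulo N, so membership is decided modulo N. -/
theorem mem_iff_exists_of_forall_mem {H : Subgroup (ExpGroup (Model ℤ))}
    (hH : ∀ v : Model ℤ, of (N • v) ∈ H) (w : Model ℤ) :
    of w ∈ H ↔ ∃ w' : Model ℤ, of w' ∈ H ∧ mapCoeff (Int.castRingHom (ZMod N)) w' =
      mapCoeff (Int.castRingHom (ZMod N)) w := by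
  refine ⟨fun h => ⟨w, h, rfl⟩, fun ⟨w', hw', h⟩ => ?_⟩
  have hg : (of w')⁻¹ * of w ∈ ((map (mapCoeff (Int.castRingHom (ZMod N)))).ker :
      Set (ExpGroup (Model ℤ))) := by
    rw [SetLike.mem_coe, MonoidHom.mem_ker, map_mul, map_inv, map_of, map_of, h, inv_mul_cancel]
  rw [ker_map_mapCoeff_castRingHom] at hg
  obtain ⟨_, ⟨u, rfl⟩, hu⟩ := hg
  have := mul_mem hw' (hu ▸ hH u : (of w')⁻¹ * of w ∈ H)
  rwa [mul_inv_cancel_left] at this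

end ExpGroup
end

/-! ### Limits over ℤ_p and the classification of pro-isomorphic subgroups -/

noncomputable section

namespace Model

variable {p : ℕ} [Fact p.Prime]

theorem mapCoeff_toZModPow_intCast (n : ℕ) (w : Model ℤ) :
    mapCoeff (PadicInt.toZModPow n) (mapCoeff (Int.castRingHom ℤ_[p]) w) =
      mapCoeff (Int.castRingHom (ZMod (p ^ n))) w :=
  ext fun i => by simp only [mapCoeff_apply, eq_intCast, map_intCast]

/-- A subgroup with the same profinite completion as the whole group is, modulo all powers of `p`,
the image of an endomorphism of the Lie ring over `ℤ_p`. -/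
theorem exists_padic_of_proIsomorphic (hp3 : 3 < p) {D : Subgroup (ExpGroup (Model ℤ))}
    (h : ProIsomorphic D (ExpGroup (Model ℤ))) :
    ∃ x y z : Model ℤ_[p], Relations x y z ∧ ∀ (n : ℕ) (q : Model (ZMod (p ^ n))),
      (∃ w : Model ℤ, ExpGroup.of w ∈ D ∧ mapCoeff (Int.castRingHom (ZMod (p ^ n))) w = q) ↔
        ∃ v : Model ℤ_[p], mapCoeff (PadicInt.toZModPow n) (gen x y z v) = q := by
  have hpp : p.Prime := Fact.out
  have hp : ∀ n, NeZero (p ^ n) := fun n => ⟨pow_ne_zero _ hpp.ne_zero⟩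
  have hfin : ∀ n, Finite (ExpGroup (Model (ZMod (p ^ n)))) := fun n =>
    inferInstanceAs (Finite (Fin 25 → ZMod (p ^ n)))
  have h24 : ∀ n, Nat.Coprime 24 (p ^ n) := fun n => by
    refine Nat.Coprime.pow_right n ((Nat.coprime_comm.1 ((Nat.Prime.coprime_iff_not_dvd hpp).2 ?_)))
    intro hd
    have h8 : p ∣ 2 ^ 3 * 3 := by simpa using hd
    rcases (Nat.Prime.dvd_mul hpp).1 h8 with h2 | h2
    · have := Nat.le_of_dvd (by norm_num) (hpp.dvd_of_dvd_pow h2)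
      omega
    · have := Nat.le_of_dvd (by norm_num) h2
      omega
  let r : ∀ n, ExpGroup (Model (ZMod (p ^ (n + 1)))) →* ExpGroup (Model (ZMod (p ^ n))) := fun n =>
    ExpGroup.map (mapCoeff (ZMod.castHom (pow_dvd_pow p n.le_succ) (ZMod (p ^ n))))
  let π : ∀ n, D →* ExpGroup (Model (ZMod (p ^ n))) := fun n =>
    (ExpGroup.map (mapCoeff (Int.castRingHom (ZMod (p ^ n))))).comp D.subtype
  -- The reductions of D modulo p^n are replaced by homomorphisms from the whole group with the same
  -- images. These are Lie homomorphisms, determined by the values on the generators, whose limits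
  -- are x, y, z.
  obtain ⟨F, hF, hFπ⟩ := exists_coherent_homs h π r fun n d => by
    refine congrArg ExpGroup.of (ext fun i => ?_)
    change ZMod.castHom (pow_dvd_pow p n.le_succ) (ZMod (p ^ n))
      (Int.castRingHom (ZMod (p ^ (n + 1))) (ExpGroup.of.symm (d : ExpGroup (Model ℤ)) i)) =
        Int.castRingHom (ZMod (p ^ n)) (ExpGroup.of.symm (d : ExpGroup (Model ℤ)) i)
    rw [eq_intCast, eq_intCast, map_intCast]
  choose f hfl hf using fun n => ExpGroup.exists_lieHom (h24 n) (F n)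
  have hcoh : ∀ (w : Model ℤ) (n : ℕ),
      mapCoeff (ZMod.castHom (pow_dvd_pow p n.le_succ) (ZMod (p ^ n))) (f (n + 1) w) = f n w :=
    fun w n => ExpGroup.of.injective (by
      rw [hf n, ← hF n, ← hf (n + 1)]
      rfl)
  obtain ⟨x, hx⟩ := exists_padic_limit (fun n => f n (basisVec 0)) (hcoh _)
  obtain ⟨y, hy⟩ := exists_padic_limit (fun n => f n (basisVec 1)) (hcoh _)
  obtain ⟨z, hz⟩ := exists_padic_limit (fun n => f n (basisVec 2)) (hcoh _)
  have hgen : ∀ (n : ℕ) (v : Model ℤ_[p]) (w : Model ℤ), mapCoeff (PadicInt.toZModPow n) v =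
      mapCoeff (Int.castRingHom (ZMod (p ^ n))) w →
      mapCoeff (PadicInt.toZModPow n) (gen x y z v) = f n w := fun n v w hvw => by
    rw [mapCoeff_gen, hvw, hx, hy, hz, map_eq_gen (f n) (hfl n) w]
  refine ⟨x, y, z, relations_of_toZModPow fun n => ?_, fun n q => ?_⟩
  · rw [hx, hy, hz]
    exact relations_basisVec.map (f n) (hfl n)
  · have h1 : (∃ w : Model ℤ, ExpGroup.of w ∈ D ∧
        mapCoeff (Int.castRingHom (ZMod (p ^ n))) w = q) ↔ ExpGroup.of q ∈ (π n).range := by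
      constructor
      · rintro ⟨w, hw, rfl⟩
        exact ⟨⟨_, hw⟩, rfl⟩
      · rintro ⟨⟨w, hw⟩, e⟩
        exact ⟨w, hw, e⟩
    rw [h1, ← hFπ]
    constructor
    · rintro ⟨w, hw⟩
      refine ⟨mapCoeff (Int.castRingHom ℤ_[p]) (ExpGroup.of.symm w), ?_⟩
      rw [hgen n _ _ (mapCoeff_toZModPow_intCast n _)]
      exact ExpGroup.of.injective ((hf n _).trans hw)
    · rintro ⟨v, rfl⟩
      obtain ⟨w, hw⟩ := ExpGroup.mapCoeff_surjective
        (ZMod.ringHom_surjective (Int.castRingHom (ZMod (p ^ n)))) (mapCoeff (PadicInt.toZModPow n) v)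
      refine ⟨ExpGroup.of w, ?_⟩
      rw [hgen n v w hw.symm, hf]

theorem linDet_mapCoeff {R S : Type*} [CommRing R] [CommRing S] (f : R →+* S) (x y z : Model R) :
    linDet (mapCoeff f x) (mapCoeff f y) (mapCoeff f z) = f (linDet x y z) := by
  simp only [linDet, mapCoeff_apply, map_add, map_sub, map_mul]

/-- The determinant is multiplicative. If it vanished, preimages of the p^m-fold generators modulo
p^(3m+1) would give p^(3m) ≡ 0 modulo p^(3m+1). -/
theorem linDet_ne_zero_of_forall_exists {m : ℕ} {x y z : Model ℤ_[p]}
    (h : ∀ (n : ℕ) (w : Model ℤ), ∃ v : Model ℤ_[p], mapCoeff (PadicInt.toZModPow n) (gen x y z v) =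
      mapCoeff (Int.castRingHom (ZMod (p ^ n))) (p ^ m • w)) : linDet x y z ≠ 0 := by
  intro h0
  obtain ⟨a, ha⟩ := h (3 * m + 1) (basisVec 0)
  obtain ⟨b, hb⟩ := h (3 * m + 1) (basisVec 1)
  obtain ⟨c, hc⟩ := h (3 * m + 1) (basisVec 2)
  have h1 := linDet_gen x y z a b c
  rw [h0, mul_zero] at h1
  have h2 := linDet_mapCoeff (PadicInt.toZModPow (3 * m + 1)) (gen x y z a) (gen x y z b)
    (gen x y z c)
  rw [h1, map_zero, ha, hb, hc, linDet_mapCoeff, eq_intCast] at h2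
  have h3 : linDet (p ^ m • basisVec 0 : Model ℤ) (p ^ m • basisVec 1) (p ^ m • basisVec 2) =
      ((p ^ (3 * m) : ℕ) : ℤ) := by
    have e : ∀ i j : Fin 25, (p ^ m • basisVec i : Model ℤ) j = p ^ m * basisVec i j :=
      fun i j => by
        rw [← natCast_zsmul]
        exact (zsmul_apply _ _ _).trans (by push_cast; rfl)
    simp only [linDet, e, basisVec_apply]
    simp
    ring
  rw [h3, Int.cast_natCast, ZMod.natCast_eq_zero_iff,
    Nat.pow_dvd_pow_iff_le_right (Fact.out : p.Prime).one_lt] at h2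
  omega

theorem gen_range_of_isDiagTriple_or {x y z : Model ℤ_[p]} (h : Relations x y z)
    (hd : linDet x y z ≠ 0) : ∃ (k i j : ℕ) (X Y Z : Model ℤ), IsReduced p k i j X Y Z ∧
      Set.range (gen (mapCoeff (Int.castRingHom ℤ_[p]) X) (mapCoeff (Int.castRingHom ℤ_[p]) Y)
        (mapCoeff (Int.castRingHom ℤ_[p]) Z)) = Set.range (gen x y z) := by
  have key : ∀ {y z : Model ℤ_[p]}, IsDiagTriple x y z → linDet x y z ≠ 0 →
      ∃ (k i j : ℕ) (X Y Z : Model ℤ), IsReduced p k i j X Y Z ∧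
      Set.range (gen (mapCoeff (Int.castRingHom ℤ_[p]) X) (mapCoeff (Int.castRingHom ℤ_[p]) Y)
        (mapCoeff (Int.castRingHom ℤ_[p]) Z)) = Set.range (gen x y z) := by
    intro y z h hd
    rw [h.linDet_eq] at hd
    exact exists_isReduced h (left_ne_zero_of_mul (left_ne_zero_of_mul hd))
      (right_ne_zero_of_mul (left_ne_zero_of_mul hd)) (right_ne_zero_of_mul hd)
  rcases h.isDiagTriple_or two_ne_zero hd with h' | h'
  · exact key h' hd
  · rw [← range_gen_swap h]
    exact key h' (by rwa [linDet_swap, neg_ne_zero])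

/-- Every subgroup of `p`-power index with the same profinite completion as the whole group belongs
to a reduced triple. -/
theorem exists_isReduced_of_proIsomorphic (hp3 : 3 < p) {D : Subgroup (ExpGroup (Model ℤ))} {m : ℕ}
    (hm : D.index = p ^ m) (h : ProIsomorphic D (ExpGroup (Model ℤ))) :
    ∃ (k i j : ℕ) (x y z : Model ℤ), ∃ hr : IsReduced p k i j x y z, hr.subgroup = D := by
  have hpp : p.Prime := Fact.out
  obtain ⟨x, y, z, hrel, hxyz⟩ := exists_padic_of_proIsomorphic hp3 h
  have hD : ∀ (N : ℕ) (v : Model ℤ), m ≤ N → ExpGroup.of (p ^ N • v) ∈ D := fun N v hN => by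
    have := pow_index_mem_of_isNilpotent (p ^ m) D hm (pow_ne_zero _ hpp.ne_zero)
      (ExpGroup.of (p ^ (N - m) • v))
    rwa [ExpGroup.of_pow, natCast_zsmul, ← mul_nsmul', ← pow_add, Nat.add_sub_cancel' hN] at this
  have hdet : linDet x y z ≠ 0 := linDet_ne_zero_of_forall_exists (m := m) fun n w =>
    (hxyz n _).1 ⟨_, hD m w le_rfl, rfl⟩
  obtain ⟨k, i, j, X, Y, Z, hr, hrange⟩ := gen_range_of_isDiagTriple_or hrel hdet
  refine ⟨k, i, j, X, Y, Z, hr, ?_⟩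
  have hT : ∀ (N : ℕ) (v : Model ℤ), 102 * k ≤ N → ExpGroup.of (p ^ N • v) ∈ hr.subgroup :=
    fun N v hN => by
      have := pow_index_mem_of_isNilpotent (p ^ (102 * k)) hr.subgroup
        (hr.index_subgroup hpp.one_lt) (pow_ne_zero _ hpp.ne_zero)
        (ExpGroup.of (p ^ (N - 102 * k) • v))
      rwa [ExpGroup.of_pow, natCast_zsmul, ← mul_nsmul', ← pow_add, Nat.add_sub_cancel' hN] at this
  -- Both subgroups contain all p^N-fold multiples, so they may be compared modulo p^N, where both
  -- are the reduction of the same ℤ_p-lattice.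
  obtain ⟨N, hN⟩ : ∃ N, N = max m (102 * k) := ⟨_, rfl⟩
  ext g
  obtain ⟨w, rfl⟩ := ExpGroup.of.surjective g
  rw [ExpGroup.mem_iff_exists_of_forall_mem (fun v => hT N v (by omega)) w,
    ExpGroup.mem_iff_exists_of_forall_mem (fun v => hD N v (by omega)) w, hxyz]
  constructor
  · rintro ⟨w', hw', e⟩
    obtain ⟨v, rfl⟩ := (hr.mem_subgroup w').1 hw'
    obtain ⟨u, hu⟩ := hrange.le ⟨mapCoeff (Int.castRingHom ℤ_[p]) v, rfl⟩
    refine ⟨u, ?_⟩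
    rw [hu, ← e, ← mapCoeff_gen, mapCoeff_toZModPow_intCast]
  · rintro ⟨u, hu⟩
    obtain ⟨v, hv⟩ := hrange.ge ⟨u, rfl⟩
    obtain ⟨v', hv'⟩ := ExpGroup.mapCoeff_surjective
        (ZMod.ringHom_surjective (Int.castRingHom (ZMod (p ^ N)))) (mapCoeff (PadicInt.toZModPow N) v)
    refine ⟨gen X Y Z v', (hr.mem_subgroup _).2 ⟨v', rfl⟩, ?_⟩
    rw [← hu, ← hv, mapCoeff_gen, mapCoeff_gen, mapCoeff_toZModPow_intCast,
      mapCoeff_toZModPow_intCast, mapCoeff_toZModPow_intCast, hv']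

end Model
end

/-! ### The number of pro-isomorphic subgroups of p-power index -/

noncomputable section

namespace Model

theorem IsReduced.unique_of_subgroup_eq {p k i j k' i' j' : ℕ} {x y z x' y' z' : Model ℤ}
    (h : IsReduced p k i j x y z) (h' : IsReduced p k' i' j' x' y' z') (hp : 1 < p)
    (hs : h.subgroup = h'.subgroup) :
    k = k' ∧ i = i' ∧ j = j' ∧ x = x' ∧ y = y' ∧ z = z' := by
  refine h.unique h' hp (Set.ext fun v => ?_)
  rw [← h.mem_subgroup, ← h'.mem_subgroup, hs]

variable {p : ℕ}

theorem proIsoCount_eq_zero (hp : p.Prime) (hp3 : 3 < p) {n : ℕ} (hn : ¬ 102 ∣ n) :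
    proIsoCount (ExpGroup (Model ℤ)) (p ^ n) = 0 := by
  have : Fact p.Prime := ⟨hp⟩
  have : IsEmpty {D : Subgroup (ExpGroup (Model ℤ)) // D.index = p ^ n ∧
      ProIsomorphic D (ExpGroup (Model ℤ))} := by
    refine ⟨fun ⟨D, hD, h⟩ => hn ?_⟩
    obtain ⟨k, i, j, x, y, z, hr, rfl⟩ := exists_isReduced_of_proIsomorphic hp3 hD h
    rw [hr.index_subgroup hp.one_lt] at hD
    exact ⟨k, (Nat.pow_right_injective hp.two_le hD).symm⟩
  exact Nat.card_of_isEmpty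

theorem proIsoCount_eq_sum (hp : p.Prime) (hp3 : 3 < p) (k : ℕ) :
    proIsoCount (ExpGroup (Model ℤ)) (p ^ (102 * k)) =
      ∑ a ∈ Finset.HasAntidiagonal.antidiagonal (3 * k), p ^ (285 * k + min a.1 a.2) := by
  have : Fact p.Prime := ⟨hp⟩
  let T : Finset.HasAntidiagonal.antidiagonal (3 * k) → Type := fun a =>
    {t : Model ℤ × Model ℤ × Model ℤ // IsReduced p k a.1.1 a.1.2 t.1 t.2.1 t.2.2}
  have hT : ∀ a, Nat.card (T a) = p ^ (285 * k + min a.1.1 a.1.2) := fun a =>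
    card_isReduced hp.one_lt (Finset.HasAntidiagonal.mem_antidiagonal.1 a.2)
  have : ∀ a, Finite (T a) := fun a => Nat.finite_of_card_ne_zero (by
    rw [hT]
    exact pow_ne_zero _ hp.ne_zero)
  let e : (Σ a, T a) → {D : Subgroup (ExpGroup (Model ℤ)) // D.index = p ^ (102 * k) ∧
      ProIsomorphic D (ExpGroup (Model ℤ))} := fun t =>
    ⟨t.2.2.subgroup, t.2.2.index_subgroup hp.one_lt, t.2.2.proIsomorphic_subgroup hp.one_lt⟩
  have he : Function.Bijective e := by
    constructor
    · rintro ⟨⟨⟨i, j⟩, ha⟩, ⟨x, y, z⟩, h⟩ ⟨⟨⟨i', j'⟩, ha'⟩, ⟨x', y', z'⟩, h'⟩ hs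
      have hs' := congrArg Subtype.val hs
      dsimp only [e] at hs'
      obtain ⟨-, hi, hj, hx, hy, hz⟩ := IsReduced.unique_of_subgroup_eq _ _ hp.one_lt hs'
      subst hi hj hx hy hz
      rfl
    · rintro ⟨D, hD, h⟩
      obtain ⟨k', i, j, x, y, z, hr, rfl⟩ := exists_isReduced_of_proIsomorphic hp3 hD h
      obtain rfl : k' = k := by
        rw [hr.index_subgroup hp.one_lt] at hD
        have := Nat.pow_right_injective hp.two_le hD
        omega
      exact ⟨⟨⟨(i, j), Finset.HasAntidiagonal.mem_antidiagonal.2 (hr.add_eq hp.one_lt)⟩, (x, y, z), hr⟩, rfl⟩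
  rw [proIsoCount, ← Nat.card_eq_of_bijective e he, Nat.card_sigma, Finset.sum_congr rfl fun a _ => hT a]
  exact Finset.sum_coe_sort _ fun a : ℕ × ℕ => p ^ (285 * k + min a.1 a.2)

end Model
end

/-! ### Summation of the local zeta function -/

noncomputable section

open Finset.HasAntidiagonal in
/-- The sums over the pairs with a given sum of the powers of `p` with the minimum as exponent. -/
def minPowSum (p n : ℕ) : ℕ := ∑ a ∈ antidiagonal n, p ^ min a.1 a.2

theorem minPowSum_zero (p : ℕ) : minPowSum p 0 = 1 := by
  simp [minPowSum]

theorem minPowSum_one (p : ℕ) : minPowSum p 1 = 2 := by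
  simp [minPowSum, Finset.Nat.antidiagonal_succ]

/-- The two pairs with a zero entry contribute 2; lowering both entries of the others by one gives
the pairs with sum n. -/
theorem minPowSum_add_two (p n : ℕ) : minPowSum p (n + 2) = 2 + p * minPowSum p n := by
  rw [minPowSum, Finset.Nat.antidiagonal_succ_succ', minPowSum, Finset.mul_sum]
  simp [pow_succ']
  ring

theorem minPowSum_three_mul_add_two (p k : ℕ) :
    minPowSum p (3 * (k + 2)) = 2 + 2 * p + 2 * p ^ 2 + p ^ 3 * minPowSum p (3 * k) := by
  rw [show 3 * (k + 2) = 3 * k + 2 + 2 + 2 by ring, minPowSum_add_two, minPowSum_add_two,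
    minPowSum_add_two]
  ring

theorem minPowSum_three (p : ℕ) : minPowSum p 3 = 2 + 2 * p := by
  rw [minPowSum_add_two, minPowSum_one]
  ring

theorem hasSum_of_recurrence {c : ℕ → ℂ} {p : ℂ} (hp : p ≠ 1) (h0 : c 0 = 1)
    (h1 : c 1 = 2 + 2 * p) (hc : ∀ k, c (k + 2) = 2 + 2 * p + 2 * p ^ 2 + p ^ 3 * c k)
    {A : ℂ} (hA : ‖A‖ < 1) (hA' : ‖p ^ 3 * A ^ 2‖ < 1) :
    HasSum (fun k => c k * A ^ k)
      ((1 + A + 2 * (p * A) + 2 * (p ^ 2 * A ^ 2)) / ((1 - A) * (1 - p ^ 3 * A ^ 2))) := by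
  have hp1 : p - 1 ≠ 0 := by
    rwa [sub_ne_zero]
  -- The constant sequence -D solves the recurrence, so c + D is geometric with ratio p³ along the
  -- even and along the odd indices.
  obtain ⟨D, hD⟩ : ∃ D : ℂ, D = 2 / (p - 1) := ⟨_, rfl⟩
  have hDp : D * (p - 1) = 2 := by
    rw [hD]
    field_simp
  have heven : ∀ l, c (2 * l) = (1 + D) * (p ^ 3) ^ l - D := by
    intro l
    induction l with
    | zero => simp [h0]
    | succ l ih =>
      rw [show 2 * (l + 1) = 2 * l + 2 by ring, hc]
      rw [ih]
      linear_combination (-1 - p - p ^ 2) * hDp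
  have hodd : ∀ l, c (2 * l + 1) = (2 + 2 * p + D) * (p ^ 3) ^ l - D := by
    intro l
    induction l with
    | zero => simp [h1]
    | succ l ih =>
      rw [show 2 * (l + 1) + 1 = 2 * l + 1 + 2 by ring, hc]
      rw [ih]
      linear_combination (-1 - p - p ^ 2) * hDp
  have hA2 : ‖A ^ 2‖ < 1 := by
    rw [norm_pow]
    exact pow_lt_one₀ (norm_nonneg _) hA two_ne_zero
  have g1 := hasSum_geometric_of_norm_lt_one hA'
  have g2 := hasSum_geometric_of_norm_lt_one hA2
  have s1 : HasSum (fun l => c (2 * l) * A ^ (2 * l))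
      ((1 + D) * (1 - p ^ 3 * A ^ 2)⁻¹ - D * (1 - A ^ 2)⁻¹) := by
    refine ((g1.mul_left (1 + D)).sub (g2.mul_left D)).congr_fun fun l => ?_
    rw [heven, mul_pow, pow_mul A]
    ring
  have s2 : HasSum (fun l => c (2 * l + 1) * A ^ (2 * l + 1))
      (A * ((2 + 2 * p + D) * (1 - p ^ 3 * A ^ 2)⁻¹ - D * (1 - A ^ 2)⁻¹)) := by
    refine (((g1.mul_left (2 + 2 * p + D)).sub (g2.mul_left D)).mul_left A).congr_fun
      fun l => ?_
    rw [hodd, mul_pow, pow_succ A, pow_mul A]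
    ring
  have ne : ∀ {B : ℂ}, ‖B‖ < 1 → 1 - B ≠ 0 := fun {B} hB h => by
    rw [← sub_eq_zero.1 h, norm_one] at hB
    exact lt_irrefl _ hB
  have n1 := ne hA
  have n2 := ne hA2
  have n3 := ne hA'
  rw [show (1 + A + 2 * (p * A) + 2 * (p ^ 2 * A ^ 2)) / ((1 - A) * (1 - p ^ 3 * A ^ 2)) = _ from ?_]
  · exact HasSum.even_add_odd (f := fun k => c k * A ^ k) s1 s2
  rw [div_eq_iff (mul_ne_zero n1 n3)]
  have i2 : (1 - A ^ 2)⁻¹ * (1 - A) * (1 + A) = 1 := by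
    field_simp
    ring
  have i3 : (1 - p ^ 3 * A ^ 2)⁻¹ * (1 - p ^ 3 * A ^ 2) = 1 := inv_mul_cancel₀ n3
  linear_combination (-((1 + D) + A * (2 + 2 * p + D)) * (1 - A)) * i3
    + D * (1 - p ^ 3 * A ^ 2) * i2 - A ^ 2 * (p ^ 2 + p + 1) * hDp

theorem hasSum_minPowSum {p : ℕ} (hp : 1 < p) {A : ℂ} (hA : ‖A‖ < 1)
    (hA' : ‖(p : ℂ) ^ 3 * A ^ 2‖ < 1) :
    HasSum (fun k => (minPowSum p (3 * k) : ℂ) * A ^ k)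
      ((1 + A + 2 * (p * A) + 2 * (p ^ 2 * A ^ 2)) / ((1 - A) * (1 - p ^ 3 * A ^ 2))) :=
  hasSum_of_recurrence (c := fun k => (minPowSum p (3 * k) : ℂ)) (by exact_mod_cast hp.ne')
    (by rw [mul_zero, minPowSum_zero, Nat.cast_one])
    (by rw [mul_one, minPowSum_three]; push_cast; rfl)
    (fun k => by rw [minPowSum_three_mul_add_two]; push_cast; rfl) hA hA'

theorem proIsoCount_eq_mul {p : ℕ} (hp : p.Prime) (hp3 : 3 < p) (k : ℕ) :
    proIsoCount (ExpGroup (Model ℤ)) (p ^ (102 * k)) = p ^ (285 * k) * minPowSum p (3 * k) := by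
  rw [Model.proIsoCount_eq_sum hp hp3, minPowSum, Finset.mul_sum]
  simp only [pow_add]

theorem hasSum_proIsoCount {p : ℕ} (hp : p.Prime) (hp3 : 3 < p) {s : ℂ} (hs : 573 / 204 < s.re) :
    HasSum (fun k : ℕ => (proIsoCount (ExpGroup (Model ℤ)) (p ^ k) : ℂ) * (p : ℂ) ^ (-(k * s)))
      ((1 + (p : ℂ) ^ (285 - 102 * s) + 2 * (p : ℂ) ^ (286 - 102 * s)
          + 2 * (p : ℂ) ^ (572 - 204 * s)) /
        ((1 - (p : ℂ) ^ (285 - 102 * s)) * (1 - (p : ℂ) ^ (573 - 204 * s)))) := by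
  have hp0 : (p : ℂ) ≠ 0 := Nat.cast_ne_zero.2 hp.ne_zero
  obtain ⟨A, hA⟩ : ∃ A, A = (p : ℂ) ^ (285 - 102 * s) := ⟨_, rfl⟩
  have e1 : (p : ℂ) ^ (286 - 102 * s) = p * A := by
    rw [hA, show (286 - 102 * s : ℂ) = 1 + (285 - 102 * s) by ring, Complex.cpow_add _ _ hp0,
      Complex.cpow_one]
  have hA2 : (p : ℂ) ^ (570 - 204 * s) = A ^ 2 := by
    rw [hA, ← Complex.cpow_nat_mul]
    congr 1
    push_cast
    ring
  have e2 : (p : ℂ) ^ (572 - 204 * s) = p ^ 2 * A ^ 2 := by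
    rw [← hA2, show (572 - 204 * s : ℂ) = (2 : ℕ) + (570 - 204 * s) by push_cast; ring,
      Complex.cpow_add _ _ hp0, Complex.cpow_natCast]
  have e3 : (p : ℂ) ^ (573 - 204 * s) = p ^ 3 * A ^ 2 := by
    rw [← hA2, show (573 - 204 * s : ℂ) = (3 : ℕ) + (570 - 204 * s) by push_cast; ring,
      Complex.cpow_add _ _ hp0, Complex.cpow_natCast]
  have hp1 : (1 : ℝ) < p := by exact_mod_cast hp.one_lt
  have n1 : ‖A‖ < 1 := by
    rw [hA, Complex.norm_natCast_cpow_of_pos hp.pos]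
    refine Real.rpow_lt_one_of_one_lt_of_neg hp1 ?_
    simp
    linarith
  have n3 : ‖(p : ℂ) ^ 3 * A ^ 2‖ < 1 := by
    rw [← e3, Complex.norm_natCast_cpow_of_pos hp.pos]
    refine Real.rpow_lt_one_of_one_lt_of_neg hp1 ?_
    simp
    linarith
  rw [e1, e2, e3, ← hA]
  have hinj : Function.Injective fun k : ℕ => 102 * k := fun a b h => by simpa using h
  rw [← hinj.hasSum_iff]
  · refine (hasSum_minPowSum hp.one_lt n1 n3).congr_fun fun k => ?_
    rw [Function.comp_apply, proIsoCount_eq_mul hp hp3]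
    have e : (p : ℂ) ^ (285 * k) * (p : ℂ) ^ (-(((102 * k : ℕ) : ℂ) * s)) = A ^ k := by
      rw [hA, ← Complex.cpow_natCast, ← Complex.cpow_add _ _ hp0, ← Complex.cpow_nat_mul]
      congr 1
      push_cast
      ring
    rw [← e]
    push_cast
    ring
  · intro n hn
    rw [Model.proIsoCount_eq_zero hp hp3 fun ⟨k, hk⟩ => hn ⟨k, hk.symm⟩, Nat.cast_zero, zero_mul]
end

/-! ### Failure of the functional equation -/

noncomputable section

open Polynomial

/-- The numerator of the local zeta functions, as a polynomial in `t` over `ℚ[x]`. -/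
def zetaNum : ℚ[X][X] :=
  1 + C (X ^ 285 + 2 * X ^ 286) * X ^ 102 + C (2 * X ^ 572) * X ^ 204

/-- The denominator of the local zeta functions, as a polynomial in `t` over `ℚ[x]`. -/
def zetaDen : ℚ[X][X] :=
  (1 - C (X ^ 285) * X ^ 102) * (1 - C (X ^ 573) * X ^ 204)

theorem specialize_mul (P Q : ℚ[X][X]) (a : ℚ) :
    specialize (P * Q) a = specialize P a * specialize Q a := Polynomial.map_mul _

theorem specialize_one_add (f g : ℚ[X]) (m n : ℕ) (a : ℚ) :
    specialize (1 + C f * X ^ m + C g * X ^ n) a =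
      1 + C (f.eval a) * X ^ m + C (g.eval a) * X ^ n := by
  simp [specialize]

theorem specialize_one_sub (f g : ℚ[X]) (m n : ℕ) (a : ℚ) :
    specialize ((1 - C f * X ^ m) * (1 - C g * X ^ n)) a =
      (1 - C (f.eval a) * X ^ m) * (1 - C (g.eval a) * X ^ n) := by
  simp [specialize]

theorem eval_X_pow (a : ℚ) (n : ℕ) : (X ^ n : ℚ[X]).eval a = a ^ n := by
  simp

theorem specialize_zetaNum (a : ℚ) : specialize zetaNum a =
    1 + C (a ^ 285 + 2 * a ^ 286) * X ^ 102 + C (2 * a ^ 572) * X ^ 204 := by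
  unfold zetaNum
  refine (specialize_one_add _ _ _ _ _).trans ?_
  simp only [eval_add, eval_mul, eval_X_pow a, eval_ofNat]

theorem specialize_zetaDen (a : ℚ) : specialize zetaDen a =
    (1 - C (a ^ 285) * X ^ 102) * (1 - C (a ^ 573) * X ^ 204) := by
  unfold zetaDen
  refine (specialize_one_sub _ _ _ _ _).trans ?_
  simp only [eval_X_pow a]

/-- Only exponents divisible by 102 matter. There the recurrence makes the coefficients from k = 3
on vanish, and k = 0, 1, 2 give the numerator. -/
theorem zetaDen_mul_mk {p : ℕ} (hp : p.Prime) (hp3 : 3 < p) :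
    (specialize zetaDen p : PowerSeries ℚ) *
      PowerSeries.mk (fun k => (proIsoCount (ExpGroup (Model ℤ)) (p ^ k) : ℚ)) =
        (specialize zetaNum p : PowerSeries ℚ) := by
  obtain ⟨a, ha⟩ : ∃ a : ℕ → ℚ, a = fun n => (proIsoCount (ExpGroup (Model ℤ)) (p ^ n) : ℚ) :=
    ⟨_, rfl⟩
  have h1 : ∀ n, ¬ 102 ∣ n → a n = 0 := fun n hn => by
    simp only [ha, Model.proIsoCount_eq_zero hp hp3 hn, Nat.cast_zero]
  have h2 : ∀ k, a (102 * k) = p ^ (285 * k) * minPowSum p (3 * k) := fun k => by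
    simp only [ha, proIsoCount_eq_mul hp hp3]
    push_cast
    rfl
  have a0 : a 0 = 1 := by simpa [minPowSum_zero] using h2 0
  have a1 : a 102 = p ^ 285 * (2 + 2 * p) := by simpa [minPowSum_three] using h2 1
  have hrec : ∀ k, a (102 * (k + 2)) = p ^ (285 * (k + 2)) * (2 + 2 * p + 2 * p ^ 2) +
      p ^ 573 * a (102 * k) := fun k => by
    rw [h2, h2, minPowSum_three_mul_add_two]
    push_cast
    ring
  rw [← ha, specialize_zetaDen, specialize_zetaNum]
  have e1 : (((1 - C ((p : ℚ) ^ 285) * X ^ 102) * (1 - C ((p : ℚ) ^ 573) * X ^ 204) : ℚ[X]) :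
      PowerSeries ℚ) * PowerSeries.mk a = PowerSeries.mk a -
        PowerSeries.C ((p : ℚ) ^ 285) * (PowerSeries.X ^ 102 * PowerSeries.mk a) -
        PowerSeries.C ((p : ℚ) ^ 573) * (PowerSeries.X ^ 204 * PowerSeries.mk a) +
        PowerSeries.C ((p : ℚ) ^ 858) * (PowerSeries.X ^ 306 * PowerSeries.mk a) := by
    rw [show (p : ℚ) ^ 858 = p ^ 285 * p ^ 573 by ring, map_mul]
    simp only [coe_mul, coe_sub, coe_one, coe_C, coe_pow, coe_X]
    ring
  have e2 : ∀ β δ : ℚ, ((1 + C β * X ^ 102 + C δ * X ^ 204 : ℚ[X]) : PowerSeries ℚ) =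
      1 + PowerSeries.C β * PowerSeries.X ^ 102 + PowerSeries.C δ * PowerSeries.X ^ 204 :=
    fun β δ => by simp only [coe_mul, coe_add, coe_one, coe_C, coe_pow, coe_X]
  obtain ⟨β, hβ⟩ : ∃ β : ℚ, β = (p : ℚ) ^ 285 + 2 * p ^ 286 := ⟨_, rfl⟩
  rw [e1, e2, ← hβ]
  ext n
  simp only [map_sub, map_add, PowerSeries.coeff_C_mul, PowerSeries.coeff_X_pow_mul',
    PowerSeries.coeff_mk, PowerSeries.coeff_one, PowerSeries.coeff_X_pow]
  by_cases hn : 102 ∣ n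
  · obtain ⟨k, rfl⟩ := hn
    obtain rfl | rfl | rfl | ⟨k, rfl⟩ : k = 0 ∨ k = 1 ∨ k = 2 ∨ ∃ l, k = l + 3 := by
      rcases k with _ | _ | _ | k <;> simp
    · simp [a0]
    · simp [a0, a1, hβ]
      ring
    · have := hrec 0
      simp at this
      simp [a0, a1, this]
      ring
    · rw [if_pos (by omega), if_pos (by omega), if_pos (by omega), if_neg (by omega),
        if_neg (by omega), if_neg (by omega), show 102 * (k + 3) - 102 = 102 * (k + 2) by omega,
        show 102 * (k + 3) - 204 = 102 * (k + 1) by omega, show 102 * (k + 3) - 306 = 102 * k by omega,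
        hrec k, show k + 3 = k + 1 + 2 by rfl, hrec (k + 1)]
      ring
  · have h3 : ∀ d, 102 ∣ d → (if d ≤ n then a (n - d) else 0) = 0 := fun d hd => by
      split_ifs with h
      · exact h1 _ fun h' => hn ((Nat.dvd_sub_iff_left h hd).1 h')
      · rfl
    rw [h3 102 (by norm_num), h3 204 (by norm_num), h3 306 (by norm_num), h1 n hn, if_neg (by omega),
      if_neg (by omega), if_neg (by omega)]
    ring

theorem infinite_setOf_not_dvd {S : Set ℕ} (hS : {q : ℕ | q.Prime ∧ ¬ q ∈ S}.Finite) :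
    {q : ℕ | q.Prime ∧ 3 < q ∧ q ∈ S}.Infinite := by
  intro h
  refine Nat.infinite_setOfPred_prime (((h.union hS).union (Set.finite_Iic 3)).subset fun q hq => ?_)
  by_cases h3 : q ≤ 3
  · exact Or.inr h3
  · by_cases hS : q ∈ S
    · exact Or.inl (Or.inl ⟨hq, not_le.1 h3, hS⟩)
    · exact Or.inl (Or.inr ⟨hq, hS⟩)

theorem eq_of_infinite_specialize_eq {P Q : ℚ[X][X]} {S : Set ℕ} (hS : S.Infinite)
    (h : ∀ q ∈ S, specialize P q = specialize Q q) : P = Q := by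
  refine Polynomial.ext fun n => Polynomial.eq_of_infinite_eval_eq _ _
    ((hS.image (Nat.cast_injective (R := ℚ)).injOn).mono ?_)
  rintro _ ⟨q, hq, rfl⟩
  have := congrArg (fun R => Polynomial.coeff R n) (h q hq)
  simpa [specialize, Polynomial.coeff_map] using this

theorem mul_zetaDen_eq_of_localZetaEq {P Q : ℚ[X][X]} {p : ℕ} (hp : p.Prime) (hp3 : 3 < p)
    (h : LocalZetaEq (ExpGroup (Model ℤ)) P Q p) :
    specialize (P * zetaDen) p = specialize (Q * zetaNum) p := by
  rw [specialize_mul, specialize_mul]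
  apply Polynomial.coe_injective ℚ
  rw [Polynomial.coe_mul, Polynomial.coe_mul, ← zetaDen_mul_mk hp hp3, ← h.2]
  ring

/-- If two polynomials with nonzero constant terms agree up to a monomial factor, then they agree up
to a constant factor. -/
theorem eq_C_mul_of_forall_eval_eq {F G : ℚ[X]} (hF : F.coeff 0 ≠ 0) (hG : G.coeff 0 ≠ 0) {κ : ℚ}
    (hκ : κ ≠ 0) {c : ℤ} {S : Set ℚ} (hS : S.Infinite)
    (h : ∀ t ∈ S, t ≠ 0 ∧ F.eval t = κ * t ^ c * G.eval t) : F = C κ * G := by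
  obtain ⟨n, rfl | rfl⟩ := c.eq_nat_or_neg
  · have e : F = X ^ n * (C κ * G) := Polynomial.eq_of_infinite_eval_eq _ _ (hS.mono fun t ht => by
      have := (h t ht).2
      simp only [Set.mem_ofPred_eq, eval_mul, eval_pow, eval_X, eval_C, this, zpow_natCast]
      ring)
    obtain rfl | hn := n.eq_zero_or_pos
    · simpa using e
    · refine absurd ?_ hF
      rw [e, Polynomial.coeff_X_pow_mul', if_neg (by omega)]
  · have e : X ^ n * F = C κ * G := Polynomial.eq_of_infinite_eval_eq _ _ (hS.mono fun t ht => by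
      obtain ⟨h0, h1⟩ := h t ht
      simp only [Set.mem_ofPred_eq, eval_mul, eval_pow, eval_X, eval_C, h1, zpow_neg, zpow_natCast]
      field_simp)
    obtain rfl | hn := n.eq_zero_or_pos
    · simpa using e
    · have := congrArg (fun R => Polynomial.coeff R 0) e
      simp only [Polynomial.coeff_X_pow_mul', if_neg (by omega : ¬ n ≤ 0), coeff_C_mul] at this
      exact absurd this.symm (mul_ne_zero hκ hG)

/-- Inversion changes each of the two factors by a monomial and a sign, and the signs cancel; 858 =
285 + 573 and 306 = 102 + 204. -/
theorem eval_specialize_zetaDen_inv {a t : ℚ} (ha : a ≠ 0) (ht : t ≠ 0) :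
    (specialize zetaDen a⁻¹).eval t⁻¹ * (a ^ 858 * t ^ 306) = (specialize zetaDen a).eval t := by
  rw [specialize_zetaDen, specialize_zetaDen]
  simp only [eval_mul, eval_sub, eval_one, eval_C, eval_pow, eval_X]
  have e1 : (1 - a⁻¹ ^ 285 * t⁻¹ ^ 102) * (a ^ 285 * t ^ 102) = a ^ 285 * t ^ 102 - 1 := by
    rw [sub_mul, inv_pow, inv_pow, mul_mul_mul_comm, inv_mul_cancel₀ (pow_ne_zero _ ha),
      inv_mul_cancel₀ (pow_ne_zero _ ht)]
    ring
  have e2 : (1 - a⁻¹ ^ 573 * t⁻¹ ^ 204) * (a ^ 573 * t ^ 204) = a ^ 573 * t ^ 204 - 1 := by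
    rw [sub_mul, inv_pow, inv_pow, mul_mul_mul_comm, inv_mul_cancel₀ (pow_ne_zero _ ha),
      inv_mul_cancel₀ (pow_ne_zero _ ht)]
    ring
  calc _ = ((1 - a⁻¹ ^ 285 * t⁻¹ ^ 102) * (a ^ 285 * t ^ 102)) *
      ((1 - a⁻¹ ^ 573 * t⁻¹ ^ 204) * (a ^ 573 * t ^ 204)) := by ring
    _ = _ := by rw [e1, e2]; ring

theorem eval_specialize_zetaNum_inv {a t : ℚ} (ht : t ≠ 0) :
    (specialize zetaNum a⁻¹).eval t⁻¹ * t ^ 204 =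
      (C (2 * a⁻¹ ^ 572) + C (a⁻¹ ^ 285 + 2 * a⁻¹ ^ 286) * X ^ 102 + X ^ 204 : ℚ[X]).eval t := by
  rw [specialize_zetaNum]
  simp only [eval_mul, eval_add, eval_one, eval_C, eval_pow, eval_X]
  have e1 : t⁻¹ ^ 102 * t ^ 204 = t ^ 102 := by
    rw [show t ^ 204 = t ^ 102 * t ^ 102 by ring, ← mul_assoc, inv_pow,
      inv_mul_cancel₀ (pow_ne_zero _ ht), one_mul]
  have e2 : t⁻¹ ^ 204 * t ^ 204 = 1 := by
    rw [inv_pow, inv_mul_cancel₀ (pow_ne_zero _ ht)]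
  linear_combination (a⁻¹ ^ 285 + 2 * a⁻¹ ^ 286) * e1 + 2 * a⁻¹ ^ 572 * e2

theorem finite_setOf_eval_eq_zero {P : ℚ[X]} (hP : P ≠ 0) : {t | P.eval t = 0}.Finite :=
  Polynomial.finite_setOfPred_isRoot hP

theorem finite_setOf_eval_inv_eq_zero {P : ℚ[X]} (hP : P ≠ 0) : {t | P.eval t⁻¹ = 0}.Finite :=
  (finite_setOf_eval_eq_zero hP).preimage inv_injective.injOn

theorem specialize_zetaDen_ne_zero (a : ℚ) : specialize zetaDen a ≠ 0 := by
  intro h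
  have := congrArg (Polynomial.eval 0) h
  rw [specialize_zetaDen] at this
  simp at this

/-- Eliminates P and Q between their two values and the functional equations of P / Q and of the
denominator. In the application π, u, w, v are p^858, t^102, t^204 and t^(c-102). -/
theorem numerator_eq {P Q N D P' Q' N' D' κ π v w u : ℚ} (hQ : Q ≠ 0) (hQ' : Q' ≠ 0) (hD : D' ≠ 0)
    (hπ : π ≠ 0) (hu : u ≠ 0) (h : P * D = Q * N) (h' : P' * D' = Q' * N')
    (hDD : D' * (π * (u * w)) = D) (hfe : P' * Q = κ * (v * u) * (P * Q')) :
    N' * w = κ * π⁻¹ * v * N := by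
  have hm : π * π⁻¹ = 1 := mul_inv_cancel₀ hπ
  refine mul_left_cancel₀ (mul_ne_zero (mul_ne_zero (mul_ne_zero hQ hQ') (mul_ne_zero hD hπ)) hu) ?_
  linear_combination Q' * N' * Q * hDD - Q * D * h' + D' * D * hfe + D' * κ * v * u * Q' * h
    - Q * Q' * D' * u * κ * v * N * hm

theorem not_hasFunctionalEquationAt {p : ℕ} (hp : p.Prime) :
    ¬ HasFunctionalEquationAt (ExpGroup (Model ℤ)) p := by
  rintro ⟨P, Q, hfin, ⟨hQp, -⟩, hQ', a, b, c, hfe⟩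
  have hp0 : (p : ℚ) ≠ 0 := Nat.cast_ne_zero.2 hp.ne_zero
  -- Infinitely many primes determine P / Q as a rational function of two variables, which may then
  -- be evaluated at p⁻¹.
  have hPQ : P * zetaDen = Q * zetaNum :=
    eq_of_infinite_specialize_eq (infinite_setOf_not_dvd hfin) fun q hq => mul_zetaDen_eq_of_localZetaEq hq.1 hq.2.1 hq.2.2
  have hPQa : ∀ x t : ℚ, (specialize P x).eval t * (specialize zetaDen x).eval t =
      (specialize Q x).eval t * (specialize zetaNum x).eval t := fun x t => by
    have := congrArg (fun R => (specialize R x).eval t) hPQ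
    simpa only [specialize_mul, eval_mul] using this
  let S : Set ℚ := ({t | (specialize Q p).eval t = 0} ∪ {t | (specialize Q (p : ℚ)⁻¹).eval t⁻¹ = 0} ∪
    {t | (specialize zetaDen p).eval t = 0} ∪ {0})ᶜ
  have hS : S.Infinite := (((finite_setOf_eval_eq_zero hQp).union
    (finite_setOf_eval_inv_eq_zero hQ')).union (finite_setOf_eval_eq_zero
      (specialize_zetaDen_ne_zero p)) |>.union (Set.finite_singleton 0)).infinite_compl
  have key := eq_C_mul_of_forall_eval_eq
    (F := C (2 * (p : ℚ)⁻¹ ^ 572) + C ((p : ℚ)⁻¹ ^ 285 + 2 * (p : ℚ)⁻¹ ^ 286) * X ^ 102 + X ^ 204)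
    (G := specialize zetaNum p) (κ := (-1) ^ a * (p : ℚ) ^ b * ((p : ℚ) ^ 858)⁻¹) (c := c - 102)
    (by simp [hp0]) (by simp [specialize_zetaNum])
    (mul_ne_zero (mul_ne_zero (zpow_ne_zero _ (by norm_num)) (zpow_ne_zero _ hp0))
      (inv_ne_zero (pow_ne_zero _ hp0))) hS ?_
  · rw [specialize_zetaNum] at key
    -- The constant term gives κ = 2 p^(-572), the top coefficient 1 = κ · 2 p^572; together 1 = 4.
    have k0 := congrArg (fun R => Polynomial.coeff R 0) key
    have k1 := congrArg (fun R => Polynomial.coeff R 204) key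
    generalize (-1) ^ a * (p : ℚ) ^ b * ((p : ℚ) ^ 858)⁻¹ = κ at k0 k1
    simp only [coeff_add, coeff_C_mul, coeff_X_pow, coeff_C, coeff_one, Nat.reduceEqDiff, if_true,
      if_false, mul_zero, mul_one, add_zero, zero_add, OfNat.zero_ne_ofNat, OfNat.ofNat_ne_zero] at k0 k1
    rw [← k0, inv_pow] at k1
    have : (p : ℚ) ^ 572 ≠ 0 := pow_ne_zero _ hp0
    field_simp at k1
    norm_num at k1
  · intro t ht
    simp only [S, Set.mem_compl_iff, Set.mem_union, Set.mem_ofPred_eq, Set.mem_singleton_iff,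
      not_or] at ht
    obtain ⟨⟨⟨t1, t2⟩, t3⟩, t0⟩ := ht
    refine ⟨t0, ?_⟩
    rw [← eval_specialize_zetaNum_inv t0]
    have f1 := hPQa p t
    have f2 := hPQa (p : ℚ)⁻¹ t⁻¹
    have f3 := eval_specialize_zetaDen_inv hp0 t0
    have f4 := hfe t t0
    have hu : (t : ℚ) ^ c = t ^ (c - 102) * t ^ 102 := by
      rw [← zpow_natCast t 102, ← zpow_add₀ t0, Nat.cast_ofNat, sub_add_cancel]
    rw [hu] at f4
    have t3' : (specialize zetaDen (p : ℚ)⁻¹).eval t⁻¹ ≠ 0 := fun h0 => t3 (by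
      rw [← f3, h0, zero_mul])
    rw [show t ^ 306 = t ^ 102 * t ^ 204 by ring] at f3
    exact numerator_eq t1 t2 t3' (pow_ne_zero _ hp0) (pow_ne_zero _ t0) f1 f2 f3 f4

end

theorem theorem1 :
    (Module.Free ℤ Lam ∧ Module.finrank ℤ Lam = 25) ∧
    ∃ (Γ : Type) (_ : Group Γ),
      IsExp 24 Lam Γ ∧
      (∀ g : Γ, IsOfFinOrder g → g = 1) ∧
      Group.FG Γ ∧
      Group.IsNilpotent Γ ∧ Group.nilpotencyClass Γ = 4 ∧
      HasHirschLength Γ 25 ∧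
      (∀ p : ℕ, p.Prime → 3 < p →
        (∀ s : ℂ, 573 / 204 < s.re →
          HasSum (fun k : ℕ => (proIsoCount Γ (p ^ k) : ℂ) * (p : ℂ) ^ (-(k * s)))
            ((1 + (p : ℂ) ^ (285 - 102 * s) + 2 * (p : ℂ) ^ (286 - 102 * s)
                + 2 * (p : ℂ) ^ (572 - 204 * s)) /
              ((1 - (p : ℂ) ^ (285 - 102 * s)) * (1 - (p : ℂ) ^ (573 - 204 * s))))) ∧
        ¬ HasFunctionalEquationAt Γ p) :=
  ⟨⟨LieLattice.module_free_lam.1, LieLattice.module_free_lam.2⟩, ExpGroup (Model ℤ), inferInstance,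
    LieLattice.isExp_model, Model.isOfFinOrder_eq_one, Model.expGroup_fg, inferInstance,
    Model.nilpotencyClass_eq_four, Model.hasHirschLength, fun _ hp hp3 =>
      ⟨fun _ hs => hasSum_proIsoCount hp hp3 hs, not_hasFunctionalEquationAt hp⟩⟩
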